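/- Let $G$ be a finite abelian group of order $n\ge 2$, written additively, with exponent $\kappa$. For $A\subseteq G$ let $3A=\{a+b+c : a,b,c\in A\}$, and call a nonempty $A$ \emph{3-incomplete} if $3A\neq G$. Let $$\chi(G,3)=\min\{m : \text{every } A\subseteq G \text{ with } |A|\ge m \text{ satisfies } 3A=G\},$$ $$S(G,3)=\{|3A| : A\subseteq G,\ |A|=\chi(G,3)-1,\ 3A\ne G\},$$ and let $\nu_3(t)$ denote the exponent of $3$ in the prime factorization of $t$. Then in each of the following cases $\chi(G,3)$ equals the stated maximum size of a 3-incomplete subset of $G$ plus $1$, and: (1) If $n$ has a prime divisor congruent to $2$ mod $3$ and $p$ is the smallest such prime, then the maximum size of a 3-incomplete subset of $G$ is $\frac{(p+1)n}{3p}$, and $S(G,3)=\{n-n/p\}$. (2) If $3\mid n$ and $n$ has no prime divisor congruent to $2$ mod $3$, then the maximum size of a 3-incomplete subset of $G$ is $n/3$, and $$S(G,3)=\{n-n/d : d\mid n,\ 3\mid d,\ d\ne 3\}\cup\{n-2n/d : d\mid n,\ 1\le\nu_3(d)\le\nu_3(\kappa)\}.$$ (3) If all positive divisors of $n$ are congruent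 to $1$ mod $3$, then the maximum size of a 3-incomplete subset of $G$ is $(n-1)/3$; moreover $S(G,3)=\{n-3\}$ if $G$ is an elementary abelian $7$-group, and $S(G,3)=\{n-3,n-1\}$ otherwise. -/

import Mathlib

namespace SumsetBasis

/-- The `h`-fold sumset `hA`: all sums of `h` not necessarily distinct elements of `A`. -/
def hfold {G : Type*} [AddCommGroup G] [DecidableEq G] (h : ℕ) (A : Finset G) : Finset G :=
  (Fintype.piFinset (fun _ : Fin h => A)).image (fun a => ∑ i, a i)

theorem mem_hfold {G : Type*} [AddCommGroup G] [DecidableEq G] {h : ℕ} {A : Finset G} {x : G} :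
    x ∈ hfold h A ↔ ∃ a : Fin h → G, (∀ i, a i ∈ A) ∧ ∑ i, a i = x := by
  simp [hfold]

/-- A nonempty subset `A` of `G` is `h`-incomplete if `hA` is a proper subset of `G`. -/
def IsIncomplete {G : Type*} [AddCommGroup G] [Fintype G] [DecidableEq G]
    (h : ℕ) (A : Finset G) : Prop :=
  A.Nonempty ∧ hfold h A ≠ Finset.univ

/-- The set of the sizes of the `h`-incomplete subsets of `G`. -/
def incompleteSizes (G : Type*) [AddCommGroup G] [Fintype G] [DecidableEq G] (h : ℕ) : Set ℕ :=
  {k | ∃ A : Finset G, IsIncomplete h A ∧ A.card = k}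

/-- The `h`-critical number `χ(G, h) = min {m : A ⊆ G, |A| ≥ m ⇒ hA = G}`
(a minimum over a nonempty set: every `m > |G|` belongs to it vacuously). -/
noncomputable def criticalNumber (G : Type*) [AddCommGroup G] [Fintype G] [DecidableEq G]
    (h : ℕ) : ℕ :=
  sInf {m : ℕ | ∀ A : Finset G, m ≤ A.card → hfold h A = Finset.univ}

/-- `S(G, h) = {|hA| : A ⊆ G, |A| = χ(G, h) - 1, hA ≠ G}`. -/
def S (G : Type*) [AddCommGroup G] [Fintype G] [DecidableEq G] (h : ℕ) : Set ℕ :=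
  {s | ∃ A : Finset G, A.card + 1 = criticalNumber G h ∧ hfold h A ≠ Finset.univ ∧
    (hfold h A).card = s}

/-- `G` is an elementary abelian `p`-group: a nontrivial abelian group
in which every element is annihilated by `p`. -/
def IsElementaryAbelian (p : ℕ) (G : Type*) [AddCommGroup G] : Prop :=
  Nontrivial G ∧ ∀ g : G, p • g = 0

end SumsetBasis

/-!
Let `n = |G|`. For a nonempty `A` with `3A ≠ G`, let `H` be the period of `3A` and `B` the image of
`A` in `G ⧸ H`, a group of order `d`. Then `|A| ≤ |H| |B|` and `|3A| = |H| |3B|`, and since `3B` has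
trivial period, Kneser's theorem (`kneser`, proved here by Dyson transforms) gives
`3 |B| - 2 ≤ |3B| ≤ d - 1`. So everything depends on `(|B|, |3B|)` and on the residue of `d` modulo
`3`: `|B|` is at most `(d + 1) / 3`, `d / 3` or `(d - 1) / 3` when `d` is `2`, `0` or `1` modulo `3`.
This yields all the upper bounds. Equality in the first case forces `d = p` and `|3B| = d - 1`; in
the second `|3B|` is `d - 2` or `d - 1`; in the third `H = 0` and `|3A|` is `n - 3`, `n - 2` or
`n - 1`.

Sets whose threefold sumset misses exactly two elements `x` and `x - t` are described through their
`t`-ends, the `a ∈ A` with `a + t ∉ A`: as `2A` avoids `x - A` and `x - t - A`, a set of extremal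
size has only one or two ends, so that up to full cosets of `⟨t⟩` it consists of one or two
progressions of difference `t`. If `3 |B| = d`, there is one progression, whose length modulo
`ord t` shows that `ord t` carries the full power of `3` dividing `d`; hence the condition on the
exponent (`exists_padicValNat_addOrderOf_eq`). If all divisors of `n` are `1` modulo `3`, comparing
the ends of `A`, `2A` and `3A` in both directions excludes `|3A| = n - 2` (`card_add_two_ne`).

In an elementary abelian `7`-group `|3A| = n - 1` is impossible (`card_add_one_ne`). Translate `A`
so that the missing element is `0`. By Cauchy-Davenport `A` has at most two points on each line
through `0`, hence exactly two. In each plane, counting and Cauchy-Davenport on parallel lines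
produce two full affine lines of `A`. So one can enlarge step by step a subspace `V` with a bottom
line, a line `⟨v⟩` off which `A ∩ V` is `v`-periodic, until `V = G`. But then a sum lying in `⟨v⟩`
can only use the two points of `A` on `⟨v⟩`, and `3A` misses a further element.

The examples come from preimages of intervals in cyclic quotients, from the union of `M \ H` and a
coset of `H` outside `M` for subgroups `H ≤ M` with `M` of index `3` (`exists_card_add_eq`), and from
completing a set in a subgroup `L` by a system of cosets of `L`, a third of the nonzero ones, in
which no sum of at most three vanishes (`exists_cone`, `exists_completion`).
-/

namespace SumsetBasis

open Finset
open scoped Pointwise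

universe u

variable {G : Type u} [AddCommGroup G]

/-! ### Periods and Kneser's theorem -/

/-- The stabilizer of a finite set `A` under translation, as a subgroup. -/
def period (A : Finset G) : AddSubgroup G where
  carrier := {g | ∀ x, x + g ∈ A ↔ x ∈ A}
  zero_mem' := by simp
  add_mem' := by
    intro a b ha hb x
    rw [← add_assoc, hb, ha]
  neg_mem' := by
    intro a ha x
    rw [← ha (x + -a)]
    simp

theorem mem_period_of_forall {A : Finset G} {g : G} (h : ∀ x ∈ A, x + g ∈ A) : g ∈ period A := by
  classical
  have himg : A.image (· + g) = A := by
    apply Finset.eq_of_subset_of_card_le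
    · intro y hy
      obtain ⟨x, hx, rfl⟩ := Finset.mem_image.1 hy
      exact h x hx
    · rw [Finset.card_image_of_injective _ (add_left_injective g)]
  intro x
  refine ⟨fun hx => ?_, h x⟩
  rw [← himg] at hx
  obtain ⟨y, hy, hyx⟩ := Finset.mem_image.1 hx
  rwa [← add_right_cancel hyx]

theorem card_eq_natCard_of_mem_iff [Finite G] (H : AddSubgroup G) (s : Finset G)
    (hs : ∀ x, x ∈ s ↔ x ∈ H) : s.card = Nat.card H := by
  rw [← Nat.card_eq_finsetCard]
  exact Nat.card_congr (Equiv.subtypeEquivRight hs)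

open Classical in
/-- A set invariant under `H` is a union of cosets of `H`, all of size `|H|`. -/
theorem card_eq_mul_card_image_mk [Finite G] {H : AddSubgroup G} {X : Finset G}
    (hX : H ≤ period X) :
    X.card = Nat.card H * (X.image (fun x : G => (x : G ⧸ H))).card := by
  have := Fintype.ofFinite G
  rw [mul_comm]
  rw [Finset.card_eq_sum_card_image (fun x : G => (x : G ⧸ H)) X]
  rw [Finset.sum_const_nat]
  intro q hq
  obtain ⟨a, ha, rfl⟩ := Finset.mem_image.1 hq
  have : (X.filter (fun x : G => (x : G ⧸ H) = (a : G ⧸ H)))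
      = (Finset.univ.filter (fun h => h ∈ H)).image (fun h => a + h) := by
    ext x
    simp only [Finset.mem_filter, Finset.mem_image, Finset.mem_univ, true_and]
    constructor
    · rintro ⟨hx, hxa⟩
      exact ⟨-a + x, QuotientAddGroup.eq.1 hxa.symm, by abel⟩
    · rintro ⟨h, hh, rfl⟩
      exact ⟨(hX hh a).2 ha, (QuotientAddGroup.eq.2 (by simpa using hh)).symm⟩
  rw [this, Finset.card_image_of_injective _ (add_right_injective a)]
  exact card_eq_natCard_of_mem_iff H _ (by simp)

theorem card_dvd_of_le_period [Finite G] {H : AddSubgroup G} {X : Finset G}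
    (hX : H ≤ period X) : Nat.card H ∣ X.card := by
  classical
  exact ⟨_, card_eq_mul_card_image_mk hX⟩

/-- If `X` consists of `a` of the `n` rows and `Y` of `b` of the `m` columns of a grid, then
`X \ Y` has at least `n - 1` cells or `Y \ X` has at least `m - 1`. -/
theorem grid_bound {a b m n : ℕ} (ha : 1 ≤ a) (hb : 1 ≤ b) (han : a < n) (hbm : b < m) :
    n ≤ a * (m - b) + 1 ∨ m ≤ b * (n - a) + 1 := by
  obtain ⟨a', rfl⟩ := Nat.exists_eq_add_of_lt han
  obtain ⟨b', rfl⟩ := Nat.exists_eq_add_of_lt hbm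
  have h1 : b + b' + 1 - b = b' + 1 := by omega
  have h2 : a + a' + 1 - a = a' + 1 := by omega
  rw [h1, h2]
  rcases le_total a' b' with h | h
  · left
    nlinarith
  · right
    nlinarith

/-- The map `(u, v) ↦ d + u + v` on `H × K` has fibres of size at most `|H ∩ K|`. -/
theorem card_mul_card_le [Finite G] (H K : AddSubgroup G) (d : G) (U V Y : Finset G)
    (hU : ∀ u ∈ U, u ∈ H) (hV : ∀ v ∈ V, v ∈ K) (hY : ∀ u ∈ U, ∀ v ∈ V, d + u + v ∈ Y) :
    U.card * V.card ≤ Nat.card (H ⊓ K : AddSubgroup G) * Y.card := by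
  classical
  have := Fintype.ofFinite G
  rw [← Finset.card_product]
  refine Finset.card_le_mul_card_image_of_maps_to (f := fun p : G × G => d + p.1 + p.2) ?_ _ ?_
  · rintro ⟨u, v⟩ h
    rw [Finset.mem_product] at h
    exact hY u h.1 v h.2
  · intro y hy
    rcases Finset.eq_empty_or_nonempty
      ((U ×ˢ V).filter fun p : G × G => d + p.1 + p.2 = y) with h | ⟨⟨u₀, v₀⟩, h₀⟩
    · rw [h]; simp
    · rw [← card_eq_natCard_of_mem_iff (H ⊓ K) (Finset.univ.filter (· ∈ H ⊓ K)) (by simp)]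
      refine Finset.card_le_card_of_injOn (fun p => p.1 - u₀) ?_ ?_
      · rintro ⟨u, v⟩ h
        simp only [Finset.coe_filter, Finset.mem_product, Set.mem_ofPred_eq, Finset.mem_filter,
          Finset.mem_univ, true_and] at h h₀ ⊢
        refine ⟨H.sub_mem (hU u h.1.1) (hU u₀ h₀.1.1), ?_⟩
        have h2 : u - u₀ = v₀ - v := by
          have h3 := h.2.trans h₀.2.symm
          rw [sub_eq_sub_iff_add_eq_add]
          rw [add_assoc, add_assoc] at h3
          rw [add_left_cancel h3]; abel
        rw [h2]
        exact K.sub_mem (hV v₀ h₀.1.2) (hV v h.1.2)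
      · rintro ⟨u, v⟩ h ⟨u', v'⟩ h' huu
        simp only [Finset.coe_filter, Finset.mem_product, Set.mem_ofPred_eq] at h h'
        have hu : u = u' := sub_left_injective huu
        subst hu
        have := h.2.trans h'.2.symm
        rw [add_left_cancel this]

/-- The union lemma behind Kneser's theorem: `|C| + |period C|` does not drop below the smaller
of the corresponding quantities of two sets whose union is `C`. -/
theorem card_add_card_period_union [Finite G] [DecidableEq G] (X Y : Finset G) {N : ℕ}
    (hX : N ≤ X.card + Nat.card (period X)) (hY : N ≤ Y.card + Nat.card (period Y)) :
    N ≤ (X ∪ Y).card + Nat.card (period (X ∪ Y)) := by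
  classical
  have := Fintype.ofFinite G
  by_cases hXY : X ⊆ Y
  · rwa [Finset.union_eq_right.2 hXY]
  by_cases hYX : Y ⊆ X
  · rwa [Finset.union_eq_left.2 hYX]
  obtain ⟨d, hdX, hdY⟩ := Finset.not_subset.1 hXY
  obtain ⟨e, heY, heX⟩ := Finset.not_subset.1 hYX
  set H := period X with hH
  set K := period Y with hK
  have hper : H ⊓ K ≤ period (X ∪ Y) := by
    rintro g ⟨hg1, hg2⟩ x
    rw [Finset.mem_union, Finset.mem_union, hg1 x, hg2 x]
  have hcard : Nat.card (H ⊓ K : AddSubgroup G) ≤ Nat.card (period (X ∪ Y)) :=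
    AddSubgroup.card_le_of_le hper
  set z := Nat.card (H ⊓ K : AddSubgroup G) with hz
  have hzpos : 0 < z := Nat.card_pos
  have c1 : (X ∪ Y).card = X.card + (Y \ X).card := by
    rw [← Finset.card_union_of_disjoint Finset.disjoint_sdiff, Finset.union_sdiff_self_eq_union]
  have c2 : (X ∪ Y).card = Y.card + (X \ Y).card := by
    rw [← Finset.card_union_of_disjoint Finset.disjoint_sdiff, Finset.union_sdiff_self_eq_union,
      Finset.union_comm]
  -- in the coset of `H + K` through `w`, `X` is made of `a` rows and `Y` of `b` columns
  have key : ∀ w : G, ∃ a b m n : ℕ, Nat.card H = z * m ∧ Nat.card K = z * n ∧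
      a ≤ n ∧ b ≤ m ∧ (w ∈ X → 1 ≤ a) ∧ (w ∉ X → a < n) ∧ (w ∈ Y → 1 ≤ b) ∧ (w ∉ Y → b < m) ∧
      z * (a * (m - b)) ≤ (X \ Y).card ∧ z * (b * (n - a)) ≤ (Y \ X).card := by
    intro w
    have hHf := card_eq_natCard_of_mem_iff H (univ.filter (· ∈ H)) (by simp)
    have hKf := card_eq_natCard_of_mem_iff K (univ.filter (· ∈ K)) (by simp)
    have dv : ∀ (F : AddSubgroup G) (Z : Finset G), H ⊓ K ≤ F → H ⊓ K ≤ period Z →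
        H ⊓ K ≤ period (univ.filter (fun g => g ∈ F ∧ w + g ∈ Z)) := by
      intro F Z hF hZ g hg x
      simp only [Finset.mem_filter, Finset.mem_univ, true_and]
      rw [← add_assoc, hZ hg (w + x), F.add_mem_cancel_right (hF hg)]
    obtain ⟨a, ha⟩ := card_dvd_of_le_period (dv K X inf_le_right inf_le_left)
    obtain ⟨b, hb⟩ := card_dvd_of_le_period (dv H Y inf_le_left inf_le_right)
    obtain ⟨m, hm⟩ := AddSubgroup.card_dvd_of_le (inf_le_left : H ⊓ K ≤ H)
    obtain ⟨n, hn⟩ := AddSubgroup.card_dvd_of_le (inf_le_right : H ⊓ K ≤ K)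
    rw [← hz] at ha hb hm hn
    have sA : univ.filter (fun g => g ∈ K ∧ w + g ∈ X) ⊆ univ.filter (· ∈ K) := by
      intro g; simp +contextual
    have sB : univ.filter (fun g => g ∈ H ∧ w + g ∈ Y) ⊆ univ.filter (· ∈ H) := by
      intro g; simp +contextual
    have cA : (univ.filter (fun g => g ∈ K ∧ w + g ∉ X)).card = z * (n - a) := by
      have : univ.filter (fun g => g ∈ K ∧ w + g ∉ X) =
        univ.filter (· ∈ K) \ univ.filter (fun g => g ∈ K ∧ w + g ∈ X) := by
        ext g; simp only [Finset.mem_filter, Finset.mem_univ, true_and, Finset.mem_sdiff]; tauto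
      rw [this, Finset.card_sdiff_of_subset sA, hKf, ha, hn, Nat.mul_sub]
    have cB : (univ.filter (fun g => g ∈ H ∧ w + g ∉ Y)).card = z * (m - b) := by
      have : univ.filter (fun g => g ∈ H ∧ w + g ∉ Y) =
        univ.filter (· ∈ H) \ univ.filter (fun g => g ∈ H ∧ w + g ∈ Y) := by
        ext g; simp only [Finset.mem_filter, Finset.mem_univ, true_and, Finset.mem_sdiff]; tauto
      rw [this, Finset.card_sdiff_of_subset sB, hHf, hb, hm, Nat.mul_sub]
    refine ⟨a, b, m, n, hm, hn, ?_, ?_, ?_, ?_, ?_, ?_, ?_, ?_⟩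
    · have := Finset.card_le_card sA
      rw [hKf, ha, hn] at this
      exact Nat.le_of_mul_le_mul_left this hzpos
    · have := Finset.card_le_card sB
      rw [hHf, hb, hm] at this
      exact Nat.le_of_mul_le_mul_left this hzpos
    · intro hw
      have : 0 < (univ.filter (fun g => g ∈ K ∧ w + g ∈ X)).card :=
        Finset.card_pos.2 ⟨0, by simp [hw]⟩
      rw [ha] at this
      exact Nat.pos_of_mul_pos_left this
    · intro hw
      have : 0 < (univ.filter (fun g => g ∈ K ∧ w + g ∉ X)).card :=
        Finset.card_pos.2 ⟨0, by simp [hw]⟩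
      rw [cA] at this
      have := Nat.pos_of_mul_pos_left this
      omega
    · intro hw
      have : 0 < (univ.filter (fun g => g ∈ H ∧ w + g ∈ Y)).card :=
        Finset.card_pos.2 ⟨0, by simp [hw]⟩
      rw [hb] at this
      exact Nat.pos_of_mul_pos_left this
    · intro hw
      have : 0 < (univ.filter (fun g => g ∈ H ∧ w + g ∉ Y)).card :=
        Finset.card_pos.2 ⟨0, by simp [hw]⟩
      rw [cB] at this
      have := Nat.pos_of_mul_pos_left this
      omega
    · have h := card_mul_card_le H K w (univ.filter (fun g => g ∈ H ∧ w + g ∉ Y))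
        (univ.filter (fun g => g ∈ K ∧ w + g ∈ X)) (X \ Y) (by simp +contextual)
        (by simp +contextual) (by
          intro u hu v hv
          simp only [Finset.mem_filter, Finset.mem_univ, true_and] at hu hv
          rw [Finset.mem_sdiff]
          constructor
          · rw [add_right_comm]; exact (hu.1 (w + v)).2 hv.2
          · intro h; exact hu.2 ((hv.1 (w + u)).1 h))
      rw [cB, ha, ← hz] at h
      refine Nat.le_of_mul_le_mul_left (le_trans (le_of_eq ?_) h) hzpos
      ring
    · have h := card_mul_card_le H K w (univ.filter (fun g => g ∈ H ∧ w + g ∈ Y))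
        (univ.filter (fun g => g ∈ K ∧ w + g ∉ X)) (Y \ X) (by simp +contextual)
        (by simp +contextual) (by
          intro u hu v hv
          simp only [Finset.mem_filter, Finset.mem_univ, true_and] at hu hv
          rw [Finset.mem_sdiff]
          constructor
          · exact (hv.1 (w + u)).2 hu.2
          · intro h; rw [add_right_comm] at h; exact hv.2 ((hu.1 (w + v)).1 h))
      rw [cA, hb, ← hz] at h
      refine Nat.le_of_mul_le_mul_left (le_trans (le_of_eq ?_) h) hzpos
      ring
  suffices h : Nat.card K ≤ (X \ Y).card + z ∨ Nat.card H ≤ (Y \ X).card + z by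
    rcases h with h | h <;> omega
  obtain ⟨a, b, m, n, hm, hn, han, hbm, ha, -, -, hb, h1, h2⟩ := key d
  obtain ⟨a', b', m', n', hm', hn', han', hbm', -, ha', hb', -, h1', h2'⟩ := key e
  have hmm : m' = m := Nat.eq_of_mul_eq_mul_left hzpos (hm'.symm.trans hm)
  have hnn : n' = n := Nat.eq_of_mul_eq_mul_left hzpos (hn'.symm.trans hn)
  subst hmm hnn
  have ha := ha hdX
  have hb := hb hdY
  have ha' := ha' heX
  have hb' := hb' heY
  rw [hm, hn]
  have fin1 : ∀ p, n' ≤ p + 1 → z * p ≤ (X \ Y).card → z * n' ≤ (X \ Y).card + z := by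
    intro p hp h
    calc z * n' ≤ z * (p + 1) := Nat.mul_le_mul_left _ hp
      _ = z * p + z := by ring
      _ ≤ _ := by omega
  have fin2 : ∀ p, m' ≤ p + 1 → z * p ≤ (Y \ X).card → z * m' ≤ (Y \ X).card + z := by
    intro p hp h
    calc z * m' ≤ z * (p + 1) := Nat.mul_le_mul_left _ hp
      _ = z * p + z := by ring
      _ ≤ _ := by omega
  have hd : n' ≤ a * (m' - b) + 1 ∨ m' ≤ b * (n' - a) + 1 ∨ m' ≤ a * (m' - b) := by
    rcases Nat.eq_zero_or_pos b with rfl | hb0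
    · right; right; simpa using Nat.le_mul_of_pos_left m' ha
    rcases Nat.eq_or_lt_of_le han with rfl | han
    · left
      have : a * 1 ≤ a * (m' - b) := Nat.mul_le_mul_left _ (by omega)
      omega
    · rcases grid_bound ha hb0 han hb with h | h
      · exact Or.inl h
      · exact Or.inr (Or.inl h)
  have he : n' ≤ a' * (m' - b') + 1 ∨ m' ≤ b' * (n' - a') + 1 ∨ n' ≤ b' * (n' - a') := by
    rcases Nat.eq_zero_or_pos a' with rfl | ha0
    · right; right; simpa using Nat.le_mul_of_pos_left n' hb'
    rcases Nat.eq_or_lt_of_le hbm' with rfl | hbm'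
    · right; left
      have : b' * 1 ≤ b' * (n' - a') := Nat.mul_le_mul_left _ (by omega)
      omega
    · rcases grid_bound ha0 hb' ha' hbm' with h | h
      · exact Or.inl h
      · exact Or.inr (Or.inl h)
  rcases hd with h | h | h
  · exact Or.inl (fin1 _ h h1)
  · exact Or.inr (fin2 _ h h2)
  rcases he with h' | h' | h'
  · exact Or.inl (fin1 _ h' h1')
  · exact Or.inr (fin2 _ h' h2')
  rcases le_total m' n' with hmn | hmn
  · exact Or.inr (fin2 _ (by omega) h2')
  · exact Or.inl (fin1 _ (by omega) h1)

/-- Every sum `a + b` lies in a part of `A + B` that satisfies Kneser's bound: apply Dyson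
transforms that keep `a` and `b` until none of them shrinks the second set. -/
theorem exists_subset_add_card_le [Finite G] [DecidableEq G] (k : ℕ) :
    ∀ A B : Finset G, B.card = k → ∀ a ∈ A, ∀ b ∈ B,
      ∃ D ⊆ A + B, a + b ∈ D ∧ A.card + B.card ≤ D.card + Nat.card (period D) := by
  induction k using Nat.strong_induction_on with
  | _ k ih =>
  intro A B hk a ha b hb
  by_cases hstab : ∀ a' ∈ A, ∀ b' ∈ B, a' + b' - b ∈ A
  · have hmem : ∀ x, x ∈ A.image (· + b) ↔ x - b ∈ A := by
      intro x
      rw [Finset.mem_image]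
      constructor
      · rintro ⟨y, hy, rfl⟩; simpa using hy
      · intro h; exact ⟨x - b, h, by abel⟩
    refine ⟨A.image (· + b), ?_, ?_, ?_⟩
    · intro x hx
      obtain ⟨y, hy, rfl⟩ := Finset.mem_image.1 hx
      exact Finset.add_mem_add hy hb
    · exact Finset.mem_image_of_mem _ ha
    · rw [Finset.card_image_of_injective _ (add_left_injective b)]
      have := Fintype.ofFinite G
      classical
      rw [← card_eq_natCard_of_mem_iff (period (A.image (· + b)))
        (univ.filter (· ∈ period (A.image (· + b)))) (by simp)]
      rw [← Finset.card_image_of_injective B (sub_left_injective (b := b))]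
      refine Nat.add_le_add_left (Finset.card_le_card ?_) _
      intro g hg
      obtain ⟨b', hb', rfl⟩ := Finset.mem_image.1 hg
      rw [Finset.mem_filter]
      refine ⟨Finset.mem_univ _, mem_period_of_forall ?_⟩
      intro x hx
      rw [hmem] at hx ⊢
      have := hstab _ hx b' hb'
      convert this using 1
      abel
  · push Not at hstab
    obtain ⟨a₀, ha₀, b₀, hb₀, h₀⟩ := hstab
    set e := a₀ - b with he
    set A' := A ∪ B.image (· + e) with hA'
    set B' := B.filter (fun x => x + e ∈ A) with hB'
    have hlt : B'.card < k := by
      rw [← hk]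
      refine Finset.card_lt_card ⟨Finset.filter_subset _ _, fun h => ?_⟩
      have := (Finset.mem_filter.1 (h hb₀)).2
      apply h₀
      convert this using 1
      rw [he]; abel
    have hcard : A'.card + B'.card = A.card + B.card := by
      rw [← Finset.card_image_of_injective B (add_left_injective e),
        ← Finset.card_union_add_card_inter A (B.image (· + e)),
        ← Finset.card_image_of_injective B' (add_left_injective e)]
      congr 2
      ext x
      simp only [hB', Finset.mem_image, Finset.mem_filter, Finset.mem_inter]
      constructor
      · rintro ⟨y, ⟨hy1, hy2⟩, rfl⟩; exact ⟨hy2, y, hy1, rfl⟩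
      · rintro ⟨hx, y, hy, rfl⟩; exact ⟨y, ⟨hy, hx⟩, rfl⟩
    obtain ⟨D, hD, hab, hDc⟩ := ih _ hlt A' B' rfl a (Finset.mem_union_left _ ha) b
      (Finset.mem_filter.2 ⟨hb, by rw [he]; simpa using ha₀⟩)
    refine ⟨D, hD.trans ?_, hab, by omega⟩
    intro x hx
    obtain ⟨u, hu, v, hv, rfl⟩ := Finset.mem_add.1 hx
    obtain ⟨hv1, hv2⟩ := Finset.mem_filter.1 hv
    rcases Finset.mem_union.1 hu with hu | hu
    · exact Finset.add_mem_add hu hv1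
    · obtain ⟨w, hw, rfl⟩ := Finset.mem_image.1 hu
      rw [show w + e + v = (v + e) + w by abel]
      exact Finset.add_mem_add hv2 hw

/-- **Kneser's theorem**: `|A| + |B| ≤ |A + B| + |period (A + B)|`. -/
theorem kneser [Finite G] [DecidableEq G] {A B : Finset G} (hA : A.Nonempty) (hB : B.Nonempty) :
    A.card + B.card ≤ (A + B).card + Nat.card (period (A + B)) := by
  have main : ∀ S : Finset G, S ⊆ A + B → S.Nonempty → ∃ D, S ⊆ D ∧ D ⊆ A + B ∧
      A.card + B.card ≤ D.card + Nat.card (period D) := by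
    intro S
    induction S using Finset.induction_on with
    | empty => intro _ h; simp at h
    | insert x S _ ih =>
      intro hS _
      obtain ⟨a, ha, b, hb, rfl⟩ := Finset.mem_add.1 (hS (Finset.mem_insert_self x S))
      obtain ⟨D, hD, hab, hDc⟩ := exists_subset_add_card_le _ A B rfl a ha b hb
      rcases S.eq_empty_or_nonempty with rfl | hne
      · exact ⟨D, by simpa using hab, hD, hDc⟩
      · obtain ⟨E, hSE, hE, hEc⟩ := ih ((Finset.subset_insert _ _).trans hS) hne
        refine ⟨D ∪ E, ?_, Finset.union_subset hD hE, card_add_card_period_union D E hDc hEc⟩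
        exact Finset.insert_subset (Finset.mem_union_left _ hab)
          (hSE.trans Finset.subset_union_right)
  obtain ⟨D, h1, h2, h3⟩ := main (A + B) Finset.Subset.rfl (hA.add hB)
  rwa [Finset.Subset.antisymm h2 h1] at h3

theorem period_le_period_add [DecidableEq G] (A B : Finset G) : period A ≤ period (A + B) := by
  intro g hg
  refine mem_period_of_forall fun x hx => ?_
  obtain ⟨a, ha, b, hb, rfl⟩ := Finset.mem_add.1 hx
  rw [add_right_comm]
  exact Finset.add_mem_add ((hg a).2 ha) hb

theorem two_mul_card_le [Finite G] [DecidableEq G] {A : Finset G} (hA : A.Nonempty)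
    (h : period (A + A + A) = ⊥) : 2 * A.card ≤ (A + A).card + 1 := by
  have h2 : period (A + A) = ⊥ := le_bot_iff.1 (h ▸ period_le_period_add (A + A) A)
  have := kneser hA hA
  rw [h2, AddSubgroup.card_bot] at this
  omega

theorem three_mul_card_le [Finite G] [DecidableEq G] {A : Finset G} (hA : A.Nonempty)
    (h : period (A + A + A) = ⊥) : 3 * A.card ≤ (A + A + A).card + 2 := by
  have h2 := two_mul_card_le hA h
  have := kneser (hA.add hA) hA
  rw [h, AddSubgroup.card_bot] at this
  omega

open Classical in
/-- Passing to the quotient by the period `H` of `3A` replaces `A` by a set whose threefold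
sumset has trivial period. -/
theorem exists_quotient [Finite G] {A : Finset G} (hA : A.Nonempty)
    (h3 : (A + A + A).card < Nat.card G) :
    ∃ (H : AddSubgroup G) (B : Finset (G ⧸ H)), B.Nonempty ∧ A.card ≤ Nat.card H * B.card ∧
      (A + A + A).card = Nat.card H * (B + B + B).card ∧ period (B + B + B) = ⊥ ∧
      (B + B + B).card < Nat.card (G ⧸ H) := by
  have := Fintype.ofFinite G
  set H := period (A + A + A) with hH
  set B := A.image (fun x : G => (x : G ⧸ H)) with hB
  have hBBB : B + B + B = (A + A + A).image (fun x : G => (x : G ⧸ H)) := by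
    rw [hB]
    have := fun s t : Finset G => Finset.image_add (QuotientAddGroup.mk' H) (s := s) (t := t)
    simp only [QuotientAddGroup.coe_mk'] at this
    exact ((this (A + A) A).trans (by rw [this A A])).symm
  have hcard : (A + A + A).card = Nat.card H * (B + B + B).card := by
    rw [hBBB]; exact card_eq_mul_card_image_mk le_rfl
  refine ⟨H, B, hA.image _, ?_, hcard, ?_, ?_⟩
  · have : A ⊆ univ.filter (fun x : G => (x : G ⧸ H) ∈ B) := by
      intro x hx
      simp only [mem_filter, mem_univ, true_and]
      exact Finset.mem_image_of_mem _ hx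
    refine (Finset.card_le_card this).trans ?_
    rw [card_eq_mul_card_image_mk (H := H) (X := univ.filter (fun x : G => (x : G ⧸ H) ∈ B))]
    · refine Nat.mul_le_mul_left _ (Finset.card_le_card ?_)
      intro q hq
      obtain ⟨x, hx, rfl⟩ := Finset.mem_image.1 hq
      exact (Finset.mem_filter.1 hx).2
    · intro g hg x
      simp only [mem_filter, mem_univ, true_and]
      rw [QuotientAddGroup.mk_add, (QuotientAddGroup.eq_zero_iff g).2 hg, add_zero]
  · rw [eq_bot_iff]
    intro q hq
    obtain ⟨g, rfl⟩ := QuotientAddGroup.mk_surjective q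
    rw [AddSubgroup.mem_bot, QuotientAddGroup.eq_zero_iff]
    refine mem_period_of_forall fun x hx => ?_
    have hx' : (x : G ⧸ H) ∈ B + B + B := by
      rw [hBBB]; exact Finset.mem_image_of_mem _ hx
    have hy := (hq _).2 hx'
    rw [hBBB, ← QuotientAddGroup.mk_add] at hy
    obtain ⟨y, hy, hyx⟩ := Finset.mem_image.1 hy
    have := QuotientAddGroup.eq.1 hyx
    have h2 := (this y).2 hy
    rwa [add_neg_cancel_left] at h2
  · rw [AddSubgroup.card_eq_card_quotient_mul_card_addSubgroup H, hcard, mul_comm] at h3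
    exact Nat.lt_of_mul_lt_mul_right h3

/-! ### Ends and runs in a given direction -/

/-- The elements at which `A` stops when one moves in steps of `t`. -/
def ends [DecidableEq G] (t : G) (A : Finset G) : Finset G := A.filter (fun a => a + t ∉ A)

theorem mem_ends [DecidableEq G] {t : G} {A : Finset G} {a : G} :
    a ∈ ends t A ↔ a ∈ A ∧ a + t ∉ A := by
  simp [ends]

theorem ends_add_subset [DecidableEq G] (t : G) (A B : Finset G) :
    ends t (A + B) ⊆ ends t A + ends t B := by
  intro w hw
  obtain ⟨hw, hwt⟩ := mem_ends.1 hw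
  obtain ⟨a, ha, b, hb, rfl⟩ := mem_add.1 hw
  refine add_mem_add (mem_ends.2 ⟨ha, fun h => hwt ?_⟩) (mem_ends.2 ⟨hb, fun h => hwt ?_⟩)
  · rw [add_right_comm]; exact add_mem_add h hb
  · rw [add_assoc]; exact add_mem_add ha h

theorem card_ends_neg [DecidableEq G] (t : G) (A : Finset G) :
    (ends (-t) A).card = (ends t A).card := by
  have h1 := card_filter_add_card_filter_not (s := A) (fun a => a + t ∈ A)
  have h2 := card_filter_add_card_filter_not (s := A) (fun a => a + -t ∈ A)
  have h3 : (A.filter (fun a => a + t ∈ A)).card = (A.filter (fun a => a + -t ∈ A)).card := by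
    refine card_bij (fun a _ => a + t) ?_ ?_ ?_
    · intro a ha
      rw [mem_filter] at ha ⊢
      simpa using ha.symm
    · intro a _ b _ h
      exact add_right_cancel h
    · intro b hb
      rw [mem_filter] at hb
      exact ⟨b + -t, by rw [mem_filter]; simpa using hb.symm, by abel⟩
  unfold ends
  omega

theorem ends_eq_empty_iff [DecidableEq G] {t : G} {A : Finset G} :
    ends t A = ∅ ↔ t ∈ period A := by
  constructor
  · intro h
    refine mem_period_of_forall fun x hx => ?_
    by_contra hxt
    have : x ∈ ends t A := mem_ends.2 ⟨hx, hxt⟩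
    rw [h] at this
    simp at this
  · intro h
    rw [eq_empty_iff_forall_notMem]
    intro x hx
    obtain ⟨h1, h2⟩ := mem_ends.1 hx
    exact h2 ((h x).2 h1)

/-- If `x` and `x - t` are missing from `3A`, then `x - (A ∪ (A + t))` avoids `2A`. -/
theorem disjoint_of_notMem [DecidableEq G] {A : Finset G} {t x : G}
    (hx : x ∉ A + A + A) (hxt : x - t ∉ A + A + A) :
    Disjoint (A + A) ((A ∪ (ends t A).image (· + t)).image (fun a => x - a)) := by
  rw [disjoint_left]
  intro w hw hw'
  obtain ⟨a, ha, rfl⟩ := mem_image.1 hw'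
  rcases mem_union.1 ha with ha | ha
  · apply hx
    have := add_mem_add hw ha
    rwa [sub_add_cancel] at this
  · obtain ⟨b, hb, rfl⟩ := mem_image.1 ha
    apply hxt
    have := add_mem_add hw (mem_ends.1 hb).1
    rwa [show x - (b + t) + b = x - t by abel] at this

theorem card_union_image_ends [DecidableEq G] (A : Finset G) (t x : G) :
    ((A ∪ (ends t A).image (· + t)).image (fun a => x - a)).card = A.card + (ends t A).card := by
  rw [card_image_of_injective _ sub_right_injective, card_union_of_disjoint,
    card_image_of_injective _ (add_left_injective t)]
  rw [disjoint_left]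
  intro a ha ha'
  obtain ⟨b, hb, rfl⟩ := mem_image.1 ha'
  exact (mem_ends.1 hb).2 ha

theorem card_ends_add_le [Finite G] [DecidableEq G] {A : Finset G} {t x : G}
    (hx : x ∉ A + A + A) (hxt : x - t ∉ A + A + A) :
    (ends t A).card + A.card + (A + A).card ≤ Nat.card G := by
  have := Fintype.ofFinite G
  have h := card_le_univ ((A + A) ∪ (A ∪ (ends t A).image (· + t)).image (fun a => x - a))
  rw [card_union_of_disjoint (disjoint_of_notMem hx hxt), card_union_image_ends,
    ← Nat.card_eq_fintype_card] at h
  omega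

/-- When the bound of `card_ends_add_le` is attained, `2A` is everything that is not prevented by the
elements `x` and `x - t` missing from `3A`. -/
theorem mem_add_self_iff [Finite G] [DecidableEq G] {A : Finset G} {t x : G}
    (hx : x ∉ A + A + A) (hxt : x - t ∉ A + A + A)
    (hc : (ends t A).card + A.card + (A + A).card = Nat.card G) (w : G) :
    w ∈ A + A ↔ x - w ∉ A ∧ x - t - w ∉ A := by
  have := Fintype.ofFinite G
  have h : (A + A) ∪ (A ∪ (ends t A).image (· + t)).image (fun a => x - a) = univ := by
    rw [← card_eq_iff_eq_univ, card_union_of_disjoint (disjoint_of_notMem hx hxt),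
      card_union_image_ends, ← Nat.card_eq_fintype_card]
    omega
  constructor
  · intro hw
    constructor
    · intro h; apply hx; have := add_mem_add hw h; rwa [add_sub_cancel] at this
    · intro h; apply hxt; have := add_mem_add hw h; rwa [add_sub_cancel] at this
  · rintro ⟨h1, h2⟩
    have hw := h ▸ mem_univ w
    rcases mem_union.1 hw with hw | hw
    · exact hw
    · exfalso
      obtain ⟨a, ha, rfl⟩ := mem_image.1 hw
      rcases mem_union.1 ha with ha | ha
      · exact h1 (by simpa using ha)
      · obtain ⟨b, hb, rfl⟩ := mem_image.1 ha
        exact h2 (by simpa using (mem_ends.1 hb).1)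

theorem zsmul_eq_zero_iff_dvd {t : G} {k : ℤ} : k • t = 0 ↔ (addOrderOf t : ℤ) ∣ k :=
  addOrderOf_dvd_iff_zsmul_eq_zero.symm

/-- The part of `A` that ends at `p`: walking back from `p` in steps of `t` one stays in `A` for
`a` steps, where `1 ≤ a < ord t`. -/
theorem exists_run [Finite G] [DecidableEq G] {A : Finset G} {t p : G} (hp : p ∈ ends t A) :
    ∃ a : ℕ, 1 ≤ a ∧ a < addOrderOf t ∧ (∀ i < a, p - i • t ∈ A) ∧ p - a • t ∉ A := by
  obtain ⟨hpA, hpt⟩ := mem_ends.1 hp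
  have hpos : 0 < addOrderOf t := addOrderOf_pos t
  have hex : ∃ a : ℕ, p - a • t ∉ A := by
    refine ⟨addOrderOf t - 1, ?_⟩
    convert hpt using 2
    rw [sub_eq_add_neg, add_right_inj, neg_eq_iff_add_eq_zero, ← succ_nsmul,
      Nat.sub_add_cancel hpos, addOrderOf_nsmul_eq_zero]
  classical
  refine ⟨Nat.find hex, ?_, ?_, ?_, Nat.find_spec hex⟩
  · rw [Nat.one_le_iff_ne_zero]
    intro h
    have := Nat.find_spec hex
    rw [h] at this
    simp [hpA] at this
  · by_contra h
    push Not at h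
    have := Nat.find_min hex (m := addOrderOf t - 1) (by omega)
    push Not at this
    apply hpt
    convert this using 1
    rw [sub_eq_add_neg, add_right_inj, eq_neg_iff_add_eq_zero, ← succ_nsmul',
      Nat.sub_add_cancel hpos, addOrderOf_nsmul_eq_zero]
  · intro i hi
    have := Nat.find_min hex hi
    push Not at this
    exact this

/-- The progression `p, p - t, …, p - (a - 1) t`. -/
def run [DecidableEq G] (t p : G) (a : ℕ) : Finset G := (range a).image (fun i : ℕ => p - i • t)

theorem mem_run [DecidableEq G] {t p : G} {a : ℕ} {u : G} :
    u ∈ run t p a ↔ ∃ i < a, u = p - i • t := by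
  simp [run, eq_comm]

theorem card_run [Finite G] [DecidableEq G] {t p : G} {a : ℕ} (ha : a < addOrderOf t) :
    (run t p a).card = a := by
  rw [run, card_image_of_injOn, card_range]
  intro i hi j hj hij
  have hi' := mem_range.1 (mem_coe.1 hi)
  have hj' := mem_range.1 (mem_coe.1 hj)
  have : i • t = j • t := sub_right_injective hij
  exact nsmul_injOn_Iio_addOrderOf (Set.mem_Iio.2 (by omega)) (Set.mem_Iio.2 (by omega)) this

/-- A set with one end consists of one progression of length `a` and of full cosets of `⟨t⟩`. -/
theorem exists_eq_mul_add_of_ends_eq_singleton [Finite G] [DecidableEq G] {A : Finset G} {t p : G}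
    (h : ends t A = {p}) :
    ∃ a r : ℕ, 1 ≤ a ∧ a < addOrderOf t ∧ A.card = addOrderOf t * r + a := by
  obtain ⟨a, ha1, hat, hrun, hend⟩ := exists_run (p := p) (A := A) (t := t) (by simp [h])
  have hsub : run t p a ⊆ A := by
    intro u hu
    obtain ⟨i, hi, rfl⟩ := mem_run.1 hu
    exact hrun i hi
  have hper : t ∈ period (A \ run t p a) := by
    refine mem_period_of_forall fun x hx => ?_
    obtain ⟨hxA, hxr⟩ := mem_sdiff.1 hx
    rw [mem_sdiff]
    have hxt : x + t ∈ A := by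
      by_contra hcon
      have : x ∈ ends t A := mem_ends.2 ⟨hxA, hcon⟩
      rw [h, mem_singleton] at this
      subst this
      exact hxr (mem_run.2 ⟨0, by omega, by simp⟩)
    refine ⟨hxt, fun hcon => ?_⟩
    obtain ⟨i, hi, hix⟩ := mem_run.1 hcon
    have hx' : x = p - (i + 1) • t := by
      rw [eq_sub_of_add_eq hix, succ_nsmul]; abel
    rcases Nat.lt_or_ge (i + 1) a with h1 | h1
    · exact hxr (mem_run.2 ⟨i + 1, h1, hx'⟩)
    · have : i + 1 = a := by omega
      rw [this] at hx'
      exact hend (hx' ▸ hxA)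
  have hdvd := card_dvd_of_le_period (AddSubgroup.zmultiples_le_of_mem hper)
  rw [Nat.card_zmultiples, card_sdiff_of_subset hsub, card_run hat] at hdvd
  obtain ⟨r, hr⟩ := hdvd
  have := card_le_card hsub
  rw [card_run hat] at this
  exact ⟨a, r, ha1, hat, by omega⟩

/-- A set with two ends consists of two progressions and of full cosets of `⟨t⟩`. -/
theorem exists_two_runs [Finite G] [DecidableEq G] {A : Finset G} {t p q : G} (hpq : p ≠ q)
    (h : ends t A = {p, q}) :
    ∃ a b r : ℕ, 1 ≤ a ∧ a < addOrderOf t ∧ 1 ≤ b ∧ b < addOrderOf t ∧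
      (∀ i < a, p - i • t ∈ A) ∧ p - a • t ∉ A ∧ (∀ i < b, q - i • t ∈ A) ∧ q - b • t ∉ A ∧
      A.card = addOrderOf t * r + a + b ∧
      ∀ u ∈ A, (∃ i < a, u = p - i • t) ∨ (∃ i < b, u = q - i • t) ∨ ∀ k : ℤ, u + k • t ∈ A := by
  have hpE : p ∈ ends t A := by simp [h]
  have hqE : q ∈ ends t A := by simp [h]
  obtain ⟨a, ha1, hat, hrun, hend⟩ := exists_run hpE
  obtain ⟨b, hb1, hbt, hrun', hend'⟩ := exists_run hqE
  have hsub : run t p a ∪ run t q b ⊆ A := by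
    intro u hu
    rcases mem_union.1 hu with hu | hu
    · obtain ⟨i, hi, rfl⟩ := mem_run.1 hu
      exact hrun i hi
    · obtain ⟨i, hi, rfl⟩ := mem_run.1 hu
      exact hrun' i hi
  have hdisj : Disjoint (run t p a) (run t q b) := by
    rw [disjoint_left]
    intro u hu hu'
    obtain ⟨i, hi, rfl⟩ := mem_run.1 hu
    obtain ⟨j, hj, hij⟩ := mem_run.1 hu'
    rcases lt_trichotomy i j with hlt | heq | hlt
    · obtain ⟨k, rfl⟩ := Nat.exists_eq_add_of_lt hlt
      have h1 : p + t = q - k • t := by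
        rw [add_nsmul, add_nsmul, one_nsmul] at hij
        rw [sub_eq_iff_eq_add.1 hij]; abel
      exact (mem_ends.1 hpE).2 (h1 ▸ hrun' k (by omega))
    · subst heq
      exact hpq (sub_left_injective hij)
    · obtain ⟨k, rfl⟩ := Nat.exists_eq_add_of_lt hlt
      have h1 : q + t = p - k • t := by
        rw [add_nsmul, add_nsmul, one_nsmul] at hij
        rw [sub_eq_iff_eq_add.1 hij.symm]; abel
      exact (mem_ends.1 hqE).2 (h1 ▸ hrun k (by omega))
  have hstep : ∀ (c : ℕ) (s x : G), x ∈ A → x ∉ run t s c → s - c • t ∉ A → x + t ∉ run t s c := by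
    intro c s x hxA hxr hend hcon
    obtain ⟨i, hi, hix⟩ := mem_run.1 hcon
    have hx' : x = s - (i + 1) • t := by
      rw [eq_sub_of_add_eq hix, succ_nsmul]; abel
    rcases Nat.lt_or_ge (i + 1) c with h1 | h1
    · exact hxr (mem_run.2 ⟨i + 1, h1, hx'⟩)
    · have : i + 1 = c := by omega
      rw [this] at hx'
      exact hend (hx' ▸ hxA)
  have hper : t ∈ period (A \ (run t p a ∪ run t q b)) := by
    refine mem_period_of_forall fun x hx => ?_
    obtain ⟨hxA, hxr⟩ := mem_sdiff.1 hx
    rw [notMem_union] at hxr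
    rw [mem_sdiff, notMem_union]
    refine ⟨?_, hstep a p x hxA hxr.1 hend, hstep b q x hxA hxr.2 hend'⟩
    by_contra hcon
    have : x ∈ ends t A := mem_ends.2 ⟨hxA, hcon⟩
    rw [h, mem_insert, mem_singleton] at this
    rcases this with rfl | rfl
    · exact hxr.1 (mem_run.2 ⟨0, by omega, by simp⟩)
    · exact hxr.2 (mem_run.2 ⟨0, by omega, by simp⟩)
  have hle := AddSubgroup.zmultiples_le_of_mem hper
  have hdvd := card_dvd_of_le_period hle
  rw [Nat.card_zmultiples, card_sdiff_of_subset hsub, card_union_of_disjoint hdisj,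
    card_run hat, card_run hbt] at hdvd
  obtain ⟨r, hr⟩ := hdvd
  have hc := card_le_card hsub
  rw [card_union_of_disjoint hdisj, card_run hat, card_run hbt] at hc
  refine ⟨a, b, r, ha1, hat, hb1, hbt, hrun, hend, hrun', hend', by omega, ?_⟩
  intro u hu
  by_cases h1 : u ∈ run t p a
  · exact Or.inl (mem_run.1 h1)
  by_cases h2 : u ∈ run t q b
  · exact Or.inr (Or.inl (mem_run.1 h2))
  · refine Or.inr (Or.inr fun k => ?_)
    have hk : k • t ∈ period (A \ (run t p a ∪ run t q b)) :=
      hle (AddSubgroup.zsmul_mem_zmultiples t k)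
    have := (hk u).2 (by rw [mem_sdiff, notMem_union]; exact ⟨hu, h1, h2⟩)
    exact (mem_sdiff.1 this).1

theorem exists_prime_mod_three_eq_two {m : ℕ} (hm : m % 3 = 2) :
    ∃ q : ℕ, q.Prime ∧ q ∣ m ∧ q % 3 = 2 := by
  by_contra hcon
  push Not at hcon
  by_cases h3m : 3 ∣ m
  · omega
  have hall : ∀ d : ℕ, d ∣ m → d % 3 = 1 := by
    intro d
    induction d using Nat.recOnMul with
    | zero => intro h; rw [zero_dvd_iff.1 h] at h3m; simp at h3m
    | one => intro _; rfl
    | prime q hq =>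
      intro hqm
      have h1 := hcon q hq hqm
      have h2 : q % 3 ≠ 0 := fun h => h3m ((Nat.dvd_of_mod_eq_zero h).trans hqm)
      omega
    | mul x y hx hy =>
      intro h
      rw [Nat.mul_mod, hx ((dvd_mul_right x y).trans h), hy ((dvd_mul_left y x).trans h)]
  have := hall m dvd_rfl
  omega

/-- If `3|B| = |G|` and exactly two elements are missing from `3B`, then their difference `t` has
order divisible by the full power of `3` in `|G|`: up to full cosets of `⟨t⟩`, `B` is a
progression of difference `t`. -/
theorem exists_padicValNat_addOrderOf_eq [Finite G] [DecidableEq G] {B : Finset G}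
    (hper : period (B + B + B) = ⊥) (hB : 3 * B.card = Nat.card G)
    (h3 : (B + B + B).card + 2 = Nat.card G)
    (hq : ∀ q : ℕ, q.Prime → q ∣ Nat.card G → q % 3 ≠ 2) :
    ∃ t : G, padicValNat 3 (Nat.card G) = padicValNat 3 (addOrderOf t) := by
  have := Fintype.ofFinite G
  have hpos : 0 < Nat.card G := Nat.card_pos
  have hne : B.Nonempty := by rw [← card_pos]; omega
  have hcompl : ((B + B + B)ᶜ).card = 2 := by
    rw [card_compl, ← Nat.card_eq_fintype_card]; omega
  obtain ⟨x, y, hxy, hc⟩ := card_eq_two.1 hcompl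
  have hx : x ∉ B + B + B := by rw [← mem_compl, hc]; simp
  have hy : x - (x - y) ∉ B + B + B := by rw [← mem_compl, hc]; simp
  set t := x - y with ht
  have h2 := two_mul_card_le hne hper
  have hle := card_ends_add_le hx hy
  have hne' : (ends t B).Nonempty := by
    rw [nonempty_iff_ne_empty]
    intro hcon
    have := period_le_period_add _ B (period_le_period_add _ B (ends_eq_empty_iff.1 hcon))
    rw [hper, AddSubgroup.mem_bot, ht, sub_eq_zero] at this
    exact hxy this
  have := card_pos.2 hne'
  obtain ⟨p, hp⟩ := card_eq_one.1 (show (ends t B).card = 1 by omega)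
  obtain ⟨a, r, ha, hat, hr⟩ := exists_eq_mul_add_of_ends_eq_singleton hp
  refine ⟨t, ?_⟩
  set τ := addOrderOf t with hτ
  have hdvd : τ ∣ Nat.card G := addOrderOf_dvd_natCard t
  have h3a : τ ∣ 3 * a := by
    rw [← hB, hr, show 3 * (τ * r + a) = τ * (3 * r) + 3 * a by ring] at hdvd
    exact (Nat.dvd_add_right (dvd_mul_right _ _)).1 hdvd
  obtain ⟨c, hc⟩ := h3a
  have hc3 : c < 3 := by
    by_contra hcon
    push Not at hcon
    have : τ * 3 ≤ τ * c := Nat.mul_le_mul_left _ hcon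
    omega
  have hn : Nat.card G = τ * (3 * r + c) := by
    rw [← hB, hr, show 3 * (τ * r + a) = τ * (3 * r) + 3 * a by ring, hc]; ring
  have hc1 : c = 1 := by
    interval_cases c
    · omega
    · rfl
    · exfalso
      obtain ⟨q, hq1, hq2, hq3⟩ :=
        exists_prime_mod_three_eq_two (show (3 * r + 2) % 3 = 2 by omega)
      exact hq q hq1 (hn ▸ hq2.trans (dvd_mul_left _ _)) hq3
  subst hc1
  have : Fact (Nat.Prime 3) := ⟨Nat.prime_three⟩
  rw [hn, padicValNat.mul (by rintro h; rw [h] at hat; omega) (by omega),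
    padicValNat.eq_zero_of_not_dvd (by omega : ¬ 3 ∣ 3 * r + 1), add_zero]

/-! ### Threefold sumsets missing exactly two elements -/

/-- The ends of `2A` when `2A` is exactly the complement of `{x, x - t} - A`. -/
theorem mem_ends_add_self_iff [DecidableEq G] {A : Finset G} {t x : G}
    (h2A : ∀ w, w ∈ A + A ↔ x - w ∉ A ∧ x - t - w ∉ A) (w : G) :
    w ∈ ends t (A + A) ↔
      x - t - t - w ∈ ends t A ∧ x - w ∉ A := by
  rw [mem_ends, mem_ends, h2A, h2A]
  have e1 : x - (w + t) = x - t - w := by abel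
  have e2 : x - t - (w + t) = x - t - t - w := by abel
  have e3 : x - t - t - w + t = x - t - w := by abel
  rw [e1, e2, e3]
  tauto

/-- The same set-up seen in the direction `-t`. -/
theorem mem_add_self_iff_neg [DecidableEq G] {A : Finset G} {t x : G}
    (h2A : ∀ w, w ∈ A + A ↔ x - w ∉ A ∧ x - t - w ∉ A) (w : G) :
    w ∈ A + A ↔ x - t - w ∉ A ∧ x - t - -t - w ∉ A := by
  rw [h2A, show x - t - -t - w = x - w by abel]
  tauto

/-- When no gap of `A` has length one, both ends of `A` give ends of `2A`, and then the end of `3A`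
is a sum of ends in which both ends of `A` occur. -/
theorem eq_of_no_short_gap [DecidableEq G] {A : Finset G} {t x p q : G}
    (k2 : ∀ g : G, 2 • g = 0 → g = 0) (k3 : ∀ g : G, 3 • g = 0 → g = 0) (hpq : p ≠ q)
    (hE : ends t A = {p, q}) (h2A : ∀ w, w ∈ A + A ↔ x - w ∉ A ∧ x - t - w ∉ A)
    (hp : p + t + t ∉ A) (hq : q + t + t ∉ A) :
    x - t - t = p + p + q ∨ x - t - t = p + q + q := by
  have key : ∀ e ∈ ends t A, e + t + t ∉ A →
      x - t - t - e = p + p ∨ x - t - t - e = p + q ∨ x - t - t - e = q + q := by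
    intro e he het
    have h1 : x - t - t - e ∈ ends t (A + A) := by
      rw [mem_ends_add_self_iff h2A]
      constructor
      · rwa [show x - t - t - (x - t - t - e) = e by abel]
      · rwa [show x - (x - t - t - e) = e + t + t by abel]
    obtain ⟨u, hu, v, hv, huv⟩ := mem_add.1 (ends_add_subset t A A h1)
    rw [hE, mem_insert, mem_singleton] at hu hv
    rw [← huv]
    rcases hu with rfl | rfl <;> rcases hv with rfl | rfl
    · exact Or.inl rfl
    · exact Or.inr (Or.inl rfl)
    · exact Or.inr (Or.inl (add_comm _ _))
    · exact Or.inr (Or.inr rfl)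
  have hpE : p ∈ ends t A := by simp [hE]
  have hqE : q ∈ ends t A := by simp [hE]
  have hne : p - q ≠ 0 := sub_ne_zero.2 hpq
  set y := x - t - t with hy
  rcases key p hpE hp with h1 | h1 | h1
  · rcases key q hqE hq with h2 | h2 | h2
    · exact absurd (sub_right_injective (h1.trans h2.symm)) hpq
    · refine absurd (k2 _ ?_) hne
      rw [sub_eq_iff_eq_add.1 h1, add_sub_assoc, add_assoc] at h2
      have := add_left_cancel h2
      rw [show 2 • (p - q) = p + (p - q) - q by abel, this, sub_self]
    · refine absurd (k3 _ ?_) hne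
      rw [sub_eq_iff_eq_add.1 h1] at h2
      rw [show 3 • (p - q) = (p + p + p - q) - (q + q) by abel, h2, sub_self]
  · left
    rw [sub_eq_iff_eq_add.1 h1]; abel
  · right
    rw [sub_eq_iff_eq_add.1 h1]; abel

/-- The starts of the two runs of a set with two ends. -/
theorem ends_neg_eq_pair [DecidableEq G] {A : Finset G} {t p q : G} {a b : ℕ} (hpq : p ≠ q)
    (hE : ends t A = {p, q})
    (hp : ∀ i < a + 1, p - i • t ∈ A) (hpa : p - (a + 1) • t ∉ A)
    (hq : ∀ i < b + 1, q - i • t ∈ A) (hqb : q - (b + 1) • t ∉ A) :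
    p - a • t ≠ q - b • t ∧ ends (-t) A = {p - a • t, q - b • t} := by
  have hpt := (mem_ends.1 (show p ∈ ends t A by simp [hE])).2
  have hqt := (mem_ends.1 (show q ∈ ends t A by simp [hE])).2
  set P := p - a • t with hP
  set Q := q - b • t with hQ
  have hPA : P ∈ A := hp a (by omega)
  have hQA : Q ∈ A := hq b (by omega)
  have hPt : P - t ∉ A := by
    rwa [hP, sub_sub, ← succ_nsmul]
  have hQt : Q - t ∉ A := by
    rwa [hQ, sub_sub, ← succ_nsmul]
  have hPQ : P ≠ Q := by
    intro h
    rcases lt_trichotomy a b with hlt | heq | hlt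
    · obtain ⟨k, rfl⟩ := Nat.exists_eq_add_of_lt hlt
      apply hpt
      rw [hP, hQ, sub_eq_iff_eq_add] at h
      rw [h, show q - (a + k + 1) • t + a • t + t = q - k • t by
        rw [add_nsmul, add_nsmul, one_nsmul]; abel]
      exact hq k (by omega)
    · subst heq; exact hpq (sub_left_injective h)
    · obtain ⟨k, rfl⟩ := Nat.exists_eq_add_of_lt hlt
      apply hqt
      rw [hP, hQ, eq_comm, sub_eq_iff_eq_add] at h
      rw [h, show p - (b + k + 1) • t + b • t + t = p - k • t by
        rw [add_nsmul, add_nsmul, one_nsmul]; abel]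
      exact hp k (by omega)
  have hL : ends (-t) A = {P, Q} := by
    have hsub : {P, Q} ⊆ ends (-t) A := by
      intro u hu
      rw [mem_insert, mem_singleton] at hu
      rcases hu with rfl | rfl
      · exact mem_ends.2 ⟨hPA, by rwa [← sub_eq_add_neg]⟩
      · exact mem_ends.2 ⟨hQA, by rwa [← sub_eq_add_neg]⟩
    refine (eq_of_subset_of_card_le hsub ?_).symm
    rw [card_ends_neg, hE, card_pair hpq, card_pair hPQ]
  exact ⟨hPQ, hL⟩

/-- Two runs, no gap of length one. With `p` and `q` the ends of the runs, of lengths `a` and `b`,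
`3A` cannot miss exactly `x` and `x - t`. -/
theorem false_of_no_short_gap [Finite G] [DecidableEq G] {A : Finset G} {t x p q : G} {a b : ℕ}
    (k2 : ∀ g : G, 2 • g = 0 → g = 0) (k3 : ∀ g : G, 3 • g = 0 → g = 0) (hpq : p ≠ q)
    (hE : ends t A = {p, q}) (h2A : ∀ w, w ∈ A + A ↔ x - w ∉ A ∧ x - t - w ∉ A)
    (h3A : ∀ w, w ∈ A + A + A ↔ w ≠ x ∧ w ≠ x - t)
    (ha : 1 ≤ a) (hat : a < addOrderOf t) (hb : 1 ≤ b) (hbt : b < addOrderOf t)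
    (hp : ∀ i < a, p - i • t ∈ A) (hpa : p - a • t ∉ A)
    (hq : ∀ i < b, q - i • t ∈ A) (hqb : q - b • t ∉ A)
    (hcover : ∀ u ∈ A, (∃ i < a, u = p - i • t) ∨ (∃ i < b, u = q - i • t) ∨
      ∀ k : ℤ, u + k • t ∈ A)
    (hτ : addOrderOf t % 3 = 1) (hmod : addOrderOf t ∣ 3 * (a + b) + 1)
    (hp2 : p + t + t ∉ A) (hq2 : q + t + t ∉ A) (hx : x - t - t = p + p + q) : False := by
  have hpE : p ∈ ends t A := by simp [hE]
  have hqE : q ∈ ends t A := by simp [hE]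
  obtain ⟨hpA, hpt⟩ := mem_ends.1 hpE
  obtain ⟨hqA, hqt⟩ := mem_ends.1 hqE
  obtain ⟨a', rfl⟩ : ∃ a', a = a' + 1 := ⟨a - 1, by omega⟩
  obtain ⟨b', rfl⟩ : ∃ b', b = b' + 1 := ⟨b - 1, by omega⟩
  set P := p - a' • t with hP
  set Q := q - b' • t with hQ
  obtain ⟨hPQ, hL⟩ := ends_neg_eq_pair hpq hE hp hpa hq hqb
  rw [← hP, ← hQ] at hPQ hL
  have hPA : P ∈ A := hp a' (by omega)
  have hQA : Q ∈ A := hq b' (by omega)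
  have hL2 : ∀ l ∈ ends (-t) A, l + -t + -t ∉ A := by
    intro l hl hcon
    obtain ⟨hlA, hlt⟩ := mem_ends.1 hl
    have : l + -t + -t ∈ ends t A := mem_ends.2 ⟨hcon, by simpa using hlt⟩
    rw [hE, mem_insert, mem_singleton] at this
    rcases this with h | h
    · rw [← h] at hp2; exact hp2 (by simpa using hlA)
    · rw [← h] at hq2; exact hq2 (by simpa using hlA)
  have h2A' := mem_add_self_iff_neg h2A
  have hx' := eq_of_no_short_gap k2 k3 hPQ hL h2A' (hL2 P (by simp [hL])) (hL2 Q (by simp [hL]))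
  have hxt : x - t - -t - -t = x + t := by abel
  rw [hxt] at hx'
  have z : ∀ k : ℤ, k • t = 0 → (addOrderOf t : ℤ) ∣ k := fun k => zsmul_eq_zero_iff_dvd.1
  -- the ends of `2A`
  have hppE : p + p ∈ ends t (A + A) := by
    rw [mem_ends_add_self_iff h2A, show x - t - t - (p + p) = q by rw [hx]; abel]
    refine ⟨hqE, ?_⟩
    rwa [show x - (p + p) = q + t + t by
      rw [sub_eq_iff_eq_add, sub_eq_iff_eq_add] at hx; rw [hx]; abel]
  have hpqE : p + q ∈ ends t (A + A) := by
    rw [mem_ends_add_self_iff h2A, show x - t - t - (p + q) = p by rw [hx]; abel]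
    refine ⟨hpE, ?_⟩
    rwa [show x - (p + q) = p + t + t by
      rw [sub_eq_iff_eq_add, sub_eq_iff_eq_add] at hx; rw [hx]; abel]
  have hpp := (mem_ends.1 hppE).2
  have hpq' := (mem_ends.1 hpqE).2
  have hxeq : x = p + p + q + t + t := by
    rw [sub_eq_iff_eq_add, sub_eq_iff_eq_add] at hx; exact hx
  set τ := addOrderOf t with hτdef
  obtain ⟨c, hc⟩ := hmod
  have hc6 : c < 6 := by
    by_contra hcon
    push Not at hcon
    have : τ * 6 ≤ τ * c := Nat.mul_le_mul_left _ hcon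
    omega
  rcases hx' with hx' | hx'
  · -- the two runs lie in different cosets and `p + q + t` is a sum of elements of the runs
    have hz : (2 * a' + b' + 3 : ℤ) • t = 0 := by
      rw [hxeq, hP, hQ] at hx'
      have h0 : p + p + q + t + t + t - (p - a' • t + (p - a' • t) + (q - b' • t)) = 0 := by
        rw [hx', sub_self]
      rw [← h0]
      module
    obtain ⟨e, he⟩ := z _ hz
    have he' : 2 * a' + b' + 3 = τ * e.toNat := by
      have : 0 ≤ e := by
        by_contra hcon
        push Not at hcon
        have : (τ : ℤ) * e ≤ 0 := mul_nonpos_of_nonneg_of_nonpos (by positivity) hcon.le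
        omega
      zify
      rw [Int.toNat_of_nonneg this]
      exact_mod_cast he
    have he3 : e.toNat < 3 := by
      by_contra hcon
      push Not at hcon
      have : τ * 3 ≤ τ * e.toNat := Nat.mul_le_mul_left _ hcon
      omega
    have hbig : τ ≤ a' + b' + 1 := by
      generalize e.toNat = e' at he' he3
      interval_cases e' <;> interval_cases c <;> omega
    apply hpq'
    obtain ⟨i, hi, j, hj, hij⟩ : ∃ i < a' + 1, ∃ j < b' + 1, i + j + 1 = τ := by
      rcases le_total τ (a' + 1) with h | h
      · exact ⟨τ - 1, by omega, 0, by omega, by omega⟩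
      · exact ⟨a', by omega, τ - 1 - a', by omega, by omega⟩
    have := add_mem_add (hp i hi) (hq j hj)
    convert this using 1
    have h0 : (i + j + 1) • t = 0 := by rw [hij]; exact addOrderOf_nsmul_eq_zero t
    have h1 : p + q + t = p - i • t + (q - j • t) + (i + j + 1) • t := by module
    rw [h1, h0, add_zero]
  · have hz : q = p + (a' + 2 * b' + 3 : ℤ) • t := by
      rw [hxeq, hP, hQ] at hx'
      have h0 : p + p + q + t + t + t - (p - a' • t + (q - b' • t) + (q - b' • t)) = 0 := by
        rw [hx', sub_self]
      rw [← sub_eq_zero, ← neg_eq_zero, ← h0]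
      module
    have hnot : ∀ k : ℤ, (τ : ℤ) ∣ k → k • t = 0 := fun k => zsmul_eq_zero_iff_dvd.2
    have hmem : ∀ u ∈ A, (∃ m : ℤ, u = p + m • t ∧
        (-a' ≤ m ∧ m ≤ 0 ∨ a' + b' + 3 ≤ m ∧ m ≤ a' + 2 * b' + 3)) ∨ ∀ k : ℤ, u + k • t ∈ A := by
      intro u hu
      rcases hcover u hu with ⟨i, hi, rfl⟩ | ⟨i, hi, rfl⟩ | h
      · refine Or.inl ⟨-i, ?_, Or.inl (by omega)⟩
        module
      · refine Or.inl ⟨a' + 2 * b' + 3 - i, ?_, Or.inr (by omega)⟩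
        rw [hz]; module
      · exact Or.inr h
    have hc1 : τ = 3 * (a' + b' + 2) + 1 := by
      have hcc : c = 1 ∨ c = 4 := by
        interval_cases c <;> omega
      rcases hcc with rfl | rfl
      · omega
      · exfalso
        rcases Nat.lt_or_ge (3 * a') (2 * τ - 4) with h | h
        · -- `p - a t` would lie in the run of `q`
          apply hpa
          have hi : 2 * a' + 2 * b' + 4 - 2 * τ < b' + 1 := by omega
          have := hq _ hi
          convert this using 1
          rw [hz, ← sub_eq_zero]
          have h0 := hnot (2 * τ) (Dvd.intro_left 2 rfl)
          rw [← neg_eq_zero, ← h0, ← natCast_zsmul t (2 * a' + 2 * b' + 4 - 2 * τ),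
            Nat.cast_sub (by omega)]
          push_cast
          module
        · -- `q + t` would lie in the run of `p`
          apply hqt
          have hi : 2 * τ - (a' + 2 * b' + 4) < a' + 1 := by omega
          have := hp _ hi
          convert this using 1
          rw [hz, ← sub_eq_zero]
          have h0 := hnot (2 * τ) (Dvd.intro_left 2 rfl)
          rw [← h0, ← natCast_zsmul t (2 * τ - (a' + 2 * b' + 4)),
            Nat.cast_sub (by omega)]
          push_cast
          module
    have hsum : ∀ m : ℤ, p + p + m • t ∈ A + A → ∃ m₁ m₂ : ℤ, (τ : ℤ) ∣ m - m₁ - m₂ ∧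
        (-a' ≤ m₁ ∧ m₁ ≤ 0 ∨ a' + b' + 3 ≤ m₁ ∧ m₁ ≤ a' + 2 * b' + 3) ∧
        (-a' ≤ m₂ ∧ m₂ ≤ 0 ∨ a' + b' + 3 ≤ m₂ ∧ m₂ ≤ a' + 2 * b' + 3) := by
      intro m hm
      obtain ⟨u, hu, v, hv, huv⟩ := mem_add.1 hm
      have full : ∀ u v : G, u + v = p + p + m • t → (∀ k : ℤ, u + k • t ∈ A) → v ∈ A → False := by
        intro u v huv hu hv
        apply hpp
        have := add_mem_add (hu (1 - m)) hv
        convert this using 1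
        rw [show u + (1 - m) • t + v = u + v + (1 - m) • t by abel, huv]
        module
      rcases hmem u hu with ⟨m₁, rfl, h₁⟩ | h₁
      · rcases hmem v hv with ⟨m₂, rfl, h₂⟩ | h₂
        · refine ⟨m₁, m₂, z _ ?_, h₁, h₂⟩
          rw [← sub_eq_zero] at huv
          rw [← neg_eq_zero, ← huv]
          module
        · exact (full v _ (by rw [add_comm, huv]) h₂ hu).elim
      · exact (full u v huv h₁ hv).elim
    have hab : a' ≤ b' := by
      have hPP : P + P + -t ∈ A + A := by
        by_contra hcon
        have h1 : P + P ∈ ends (-t) (A + A) := mem_ends.2 ⟨add_mem_add hPA hPA, hcon⟩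
        rw [mem_ends_add_self_iff h2A', hL, hxt, mem_insert, mem_singleton] at h1
        rcases h1.1 with h1 | h1
        · rw [hx', show P + Q + Q - (P + P) = Q + Q - P by abel, sub_eq_iff_eq_add] at h1
          have : 2 • (P - Q) = 0 := by
            rw [show 2 • (P - Q) = P + P - (Q + Q) by abel, h1, sub_self]
          exact hPQ (sub_eq_zero.1 (k2 _ this))
        · rw [hx', show P + Q + Q - (P + P) = Q + (Q - P) by abel, add_eq_left, sub_eq_zero] at h1
          exact hPQ h1.symm
      have h1 : P + P + -t = p + p + (-(2 * a' + 1) : ℤ) • t := by rw [hP]; module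
      rw [h1] at hPP
      obtain ⟨m₁, m₂, ⟨e, he⟩, h₁, h₂⟩ := hsum _ hPP
      have hc1' : (τ : ℤ) = 3 * (a' + b' + 2) + 1 := by exact_mod_cast hc1
      have he1 : -2 < e := by
        by_contra hcon
        push Not at hcon
        have := mul_le_mul_of_nonneg_left hcon (Nat.cast_nonneg (α := ℤ) τ)
        omega
      have he2 : e < 1 := by
        by_contra hcon
        push Not at hcon
        have := mul_le_mul_of_nonneg_left hcon (Nat.cast_nonneg (α := ℤ) τ)
        omega
      have : e = -1 ∨ e = 0 := by omega
      rcases this with rfl | rfl <;> rw [hc1'] at he <;> omega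
    have hba : b' ≤ a' := by
      have hqq : q + q + t ∈ A + A := by
        by_contra hcon
        have h1 : q + q ∈ ends t (A + A) := mem_ends.2 ⟨add_mem_add hqA hqA, hcon⟩
        rw [mem_ends_add_self_iff h2A, hE, hx, mem_insert, mem_singleton] at h1
        rcases h1.1 with h1 | h1
        · rw [show p + p + q - (q + q) = p + (p - q) by abel, add_eq_left, sub_eq_zero] at h1
          exact hpq h1
        · rw [show p + p + q - (q + q) = p + p - q by abel, sub_eq_iff_eq_add] at h1
          have : 2 • (p - q) = 0 := by
            rw [show 2 • (p - q) = p + p - (q + q) by abel, h1, sub_self]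
          exact hpq (sub_eq_zero.1 (k2 _ this))
      have h1 : q + q + t = p + p + (2 * a' + 4 * b' + 7 : ℤ) • t := by rw [hz]; module
      rw [h1] at hqq
      obtain ⟨m₁, m₂, ⟨e, he⟩, h₁, h₂⟩ := hsum _ hqq
      have hc1' : (τ : ℤ) = 3 * (a' + b' + 2) + 1 := by exact_mod_cast hc1
      have he1 : -1 < e := by
        by_contra hcon
        push Not at hcon
        have := mul_le_mul_of_nonneg_left hcon (Nat.cast_nonneg (α := ℤ) τ)
        omega
      have he2 : e < 2 := by
        by_contra hcon
        push Not at hcon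
        have := mul_le_mul_of_nonneg_left hcon (Nat.cast_nonneg (α := ℤ) τ)
        omega
      have : e = 0 ∨ e = 1 := by omega
      rcases this with rfl | rfl <;> rw [hc1'] at he <;> omega
    have hab' : a' = b' := le_antisymm hab hba
    subst hab'
    have hc1' : (τ : ℤ) = 6 * a' + 7 := by rw [hc1]; push_cast; ring
    -- the runs form a progression of difference `(3 a' + 3) t`, so `3 p + t` is missing as well
    have hxA : x ∉ A + A + A := fun h => ((h3A x).1 h).1 rfl
    have hmiss : p + p + p + t ∉ A + A + A := by
      intro hcon
      obtain ⟨s, hs, w, hw, hsw⟩ := mem_add.1 hcon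
      obtain ⟨u, hu, v, hv, rfl⟩ := mem_add.1 hs
      have full : ∀ u v w : G, u + v + w = p + p + p + t → (∀ k : ℤ, u + k • t ∈ A) → v ∈ A →
          w ∈ A → False := by
        intro u v w h hu hv hw
        apply hxA
        have := add_mem_add (add_mem_add (hu (3 * a' + 4)) hv) hw
        convert this using 1
        rw [show u + (3 * a' + 4 : ℤ) • t + v + w = u + v + w + (3 * a' + 4 : ℤ) • t by abel, h,
          hxeq, hz]
        module
      rcases hmem u hu with ⟨m₁, rfl, h₁⟩ | h₁
      · rcases hmem v hv with ⟨m₂, rfl, h₂⟩ | h₂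
        · rcases hmem w hw with ⟨m₃, rfl, h₃⟩ | h₃
          · obtain ⟨e, he⟩ := z (m₁ + m₂ + m₃ - 1) (by
              rw [← sub_eq_zero] at hsw
              rw [← hsw]
              module)
            have he1 : -2 < e := by
              by_contra hcon
              push Not at hcon
              have := mul_le_mul_of_nonneg_left hcon (Nat.cast_nonneg (α := ℤ) τ)
              omega
            have he2 : e < 2 := by
              by_contra hcon
              push Not at hcon
              have := mul_le_mul_of_nonneg_left hcon (Nat.cast_nonneg (α := ℤ) τ)
              omega
            have : e = -1 ∨ e = 0 ∨ e = 1 := by omega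
            rcases this with rfl | rfl | rfl <;> rw [hc1'] at he <;> omega
          · exact full w _ _ (by rw [← hsw]; abel) h₃ hu hv
        · exact full v _ _ (by rw [← hsw]; abel) h₂ hu hw
      · exact full u v w hsw h₁ hv hw
    rw [h3A, not_and_or, not_not, not_not] at hmiss
    rcases hmiss with h | h
    · have := z (3 * a' + 4) (by
        rw [← sub_eq_zero] at h
        rw [← neg_eq_zero, ← h, hxeq, hz]
        module)
      have := Int.le_of_dvd (by omega) this
      omega
    · have := z (3 * a' + 3) (by
        rw [← sub_eq_zero] at h
        rw [← neg_eq_zero, ← h, hxeq, hz]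
        module)
      have := Int.le_of_dvd (by omega) this
      omega

/-- Two runs, one of the gaps of length one. Again `3A` cannot miss exactly `x` and `x - t`. -/
theorem false_of_short_gap [Finite G] [DecidableEq G] {A : Finset G} {t x p q : G} {a b : ℕ}
    (k2 : ∀ g : G, 2 • g = 0 → g = 0) (k3 : ∀ g : G, 3 • g = 0 → g = 0) (hpq : p ≠ q)
    (hE : ends t A = {p, q}) (h2A : ∀ w, w ∈ A + A ↔ x - w ∉ A ∧ x - t - w ∉ A)
    (h3A : ∀ w, w ∈ A + A + A ↔ w ≠ x ∧ w ≠ x - t)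
    (ha : 1 ≤ a) (hat : a < addOrderOf t) (hb : 1 ≤ b) (hbt : b < addOrderOf t)
    (hp : ∀ i < a, p - i • t ∈ A) (hpa : p - a • t ∉ A)
    (hq : ∀ i < b, q - i • t ∈ A) (hqb : q - b • t ∉ A)
    (hcover : ∀ u ∈ A, (∃ i < a, u = p - i • t) ∨ (∃ i < b, u = q - i • t) ∨
      ∀ k : ℤ, u + k • t ∈ A)
    (hτ : addOrderOf t % 3 = 1) (hmod : addOrderOf t ∣ 3 * (a + b) + 1)
    (hp2 : p + t + t ∈ A) : False := by
  have hpE : p ∈ ends t A := by simp [hE]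
  have hqE : q ∈ ends t A := by simp [hE]
  obtain ⟨hpA, hpt⟩ := mem_ends.1 hpE
  obtain ⟨hqA, hqt⟩ := mem_ends.1 hqE
  obtain ⟨a', rfl⟩ : ∃ a', a = a' + 1 := ⟨a - 1, by omega⟩
  obtain ⟨b', rfl⟩ : ∃ b', b = b' + 1 := ⟨b - 1, by omega⟩
  set P := p - a' • t with hP
  set Q := q - b' • t with hQ
  obtain ⟨hPQ, hL⟩ := ends_neg_eq_pair hpq hE hp hpa hq hqb
  rw [← hP, ← hQ] at hPQ hL
  have hPA : P ∈ A := hp a' (by omega)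
  have hQA : Q ∈ A := hq b' (by omega)
  have h2A' := mem_add_self_iff_neg h2A
  have z : ∀ k : ℤ, k • t = 0 → (addOrderOf t : ℤ) ∣ k := fun k => zsmul_eq_zero_iff_dvd.1
  have ht : t ≠ 0 := by
    rintro rfl
    simp at hat
  -- the only end of `2A` is `x - 2t - q`
  have hEw : ∀ w ∈ ends t (A + A), w = x - t - t - q := by
    intro w hw
    obtain ⟨h1, h2⟩ := (mem_ends_add_self_iff h2A w).1 hw
    rw [hE, mem_insert, mem_singleton] at h1
    rcases h1 with h1 | h1
    · exact absurd hp2 (by rwa [← h1, show x - t - t - w + t + t = x - w by abel])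
    · rw [← h1]; abel
  obtain ⟨w, hw⟩ : (ends t (A + A)).Nonempty := by
    rw [nonempty_iff_ne_empty]
    intro hcon
    have h1 := period_le_period_add _ A (ends_eq_empty_iff.1 hcon)
    have h2 : x - t - t ∈ A + A + A := by
      rw [h3A]
      constructor
      · intro h
        refine ht (k2 t ?_)
        rw [sub_sub, sub_eq_self] at h
        rw [two_nsmul, h]
      · intro h
        exact ht (sub_eq_self.1 h)
    have h3 := (h1 _).2 h2
    rw [sub_add_cancel, h3A] at h3
    exact h3.2 rfl
  have hLw : ∀ w ∈ ends (-t) (A + A), ∃ l ∈ ends (-t) A, l ≠ p + t + t ∧ w = x + t - l := by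
    intro w hw
    obtain ⟨h1, h2⟩ := (mem_ends_add_self_iff h2A' w).1 hw
    refine ⟨_, h1, ?_, by abel⟩
    intro h3
    apply h2
    have : x - t - w = p := by
      rw [show x - t - w = x - t - -t - -t - w - t - t by abel, h3]; abel
    rw [this]
    exact hpA
  obtain ⟨w', hw'⟩ : (ends (-t) (A + A)).Nonempty := by
    rw [nonempty_iff_ne_empty]
    intro hcon
    have h1 := period_le_period_add _ A (ends_eq_empty_iff.1 hcon)
    have h2 : x + t ∈ A + A + A := by
      rw [h3A]
      constructor
      · intro h
        exact ht (add_eq_left.1 h)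
      · intro h
        refine ht (k2 t ?_)
        rw [show 2 • t = x + t - (x - t) by abel, h, sub_self]
    have h3 := (h1 _).2 h2
    rw [add_neg_cancel_right, h3A] at h3
    exact h3.1 rfl
  set τ := addOrderOf t with hτdef
  obtain ⟨c, hc⟩ := hmod
  have hc6 : c < 6 := by
    by_contra hcon
    push Not at hcon
    have : τ * 6 ≤ τ * c := Nat.mul_le_mul_left _ hcon
    omega
  have hp2L : p + t + t ∈ ends (-t) A := mem_ends.2 ⟨hp2, by simpa using hpt⟩
  have hzero : ∀ i : ℕ, i = τ → i • t = 0 := by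
    rintro i rfl; exact addOrderOf_nsmul_eq_zero t
  -- in all cases `3q` and `3s` are the ends of `3A`, where `s` is the start of a run
  have final : ∀ s ∈ A, q + q = x - t - t - q → s + s = x + t - s → False := by
    intro s hs h1 h2
    apply hqt
    have : 3 • (s - (q + t)) = 0 := by
      rw [show 3 • (s - (q + t)) = (s + s) + s - (q + q + q) - 3 • t by abel, h2, h1]
      abel
    rw [← sub_eq_zero.1 (k3 _ this)]
    exact hs
  rw [hL, mem_insert, mem_singleton] at hp2L
  rcases hp2L with hPp | hQp
  · -- the run of `p` fills its coset up to one point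
    have hτa : τ = a' + 2 := by
      have hz : (a' + 2 : ℤ) • t = 0 := by
        rw [hP, ← sub_eq_zero] at hPp
        rw [← hPp]; module
      have h1 := Int.le_of_dvd (by omega) (z _ hz)
      omega
    have hb1 : 1 ≤ b' := by
      by_contra hcon
      have : b' = 0 := by omega
      subst this
      interval_cases c <;> omega
    have hpp : p + p + t ∈ A + A := by
      have := add_mem_add (hp a' (by omega)) (hp 1 (by omega))
      convert this using 1
      have h1 : p + p + t = p - a' • t + (p - 1 • t) + (a' + 2) • t := by module
      rw [h1, hzero _ hτa.symm, add_zero]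
    have hpq' : p + q + t ∈ A + A := by
      have := add_mem_add (hp a' (by omega)) (hq 1 (by omega))
      convert this using 1
      have h1 : p + q + t = p - a' • t + (q - 1 • t) + (a' + 2) • t := by module
      rw [h1, hzero _ hτa.symm, add_zero]
    have hPP' : P + P + -t ∈ A + A := by
      have := add_mem_add (hp (a' - 1) (by omega)) (hp 0 (by omega))
      convert this using 1
      rw [← hPp]
      obtain ⟨a'', rfl⟩ : ∃ a'', a' = a'' + 1 := ⟨a' - 1, by omega⟩
      have h1 : p + t + t + (p + t + t) + -t =
          p - (a'' + 1 - 1) • t + (p - 0 • t) + (a'' + 1 + 2) • t := by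
        rw [Nat.add_sub_cancel]; module
      rw [h1, hzero _ hτa.symm, add_zero]
    have hPQ' : P + Q + -t ∈ A + A := by
      have := add_mem_add (hp (b' - 1) (by omega)) (hq 0 (by omega))
      convert this using 1
      rw [← hPp, hQ]
      obtain ⟨b'', rfl⟩ : ∃ b'', b' = b'' + 1 := ⟨b' - 1, by omega⟩
      rw [Nat.add_sub_cancel]
      module
    have h1 : q + q = x - t - t - q := by
      rw [← hEw w hw]
      obtain ⟨u, hu, v, hv, huv⟩ := mem_add.1 (ends_add_subset t A A hw)
      have hwt := (mem_ends.1 hw).2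
      rw [hE, mem_insert, mem_singleton] at hu hv
      rcases hu with rfl | rfl <;> rcases hv with rfl | rfl
      · rw [← huv] at hwt; exact absurd hpp hwt
      · rw [← huv] at hwt; exact absurd hpq' hwt
      · rw [← huv, add_comm u v] at hwt; exact absurd hpq' hwt
      · exact huv
    refine final Q hQA h1 ?_
    have hw'' : w' = x + t - Q := by
      obtain ⟨l, hl, hlp, hlw⟩ := hLw w' hw'
      rw [hL, mem_insert, mem_singleton] at hl
      rcases hl with rfl | rfl
      · exact absurd hPp.symm hlp
      · exact hlw
    rw [← hw'']
    obtain ⟨u, hu, v, hv, huv⟩ := mem_add.1 (ends_add_subset (-t) A A hw')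
    have hwt := (mem_ends.1 hw').2
    rw [hL, mem_insert, mem_singleton] at hu hv
    rcases hu with rfl | rfl <;> rcases hv with rfl | rfl
    · rw [← huv] at hwt; exact absurd hPP' hwt
    · rw [← huv] at hwt; exact absurd hPQ' hwt
    · rw [← huv, add_comm Q P] at hwt; exact absurd hPQ' hwt
    · exact huv
  · -- both runs lie in the same coset, where `A` is a progression with one point removed
    have hz : q = p + (b' + 2 : ℤ) • t := by
      rw [hQ, eq_comm, sub_eq_iff_eq_add] at hQp
      rw [hQp]; module
    have hτ1 : a' + b' + 3 < τ := by
      by_contra hcon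
      push Not at hcon
      rcases Nat.lt_or_ge (b' + 2) τ with h | h
      · apply hqt
        have := hp (τ - (b' + 3)) (by omega)
        convert this using 1
        obtain ⟨s, hs⟩ := Nat.exists_eq_add_of_le (show b' + 3 ≤ τ by omega)
        rw [hs, Nat.add_sub_cancel_left, hz]
        have h1 : p + (b' + 2 : ℤ) • t + t = p - s • t + (b' + 3 + s) • t := by module
        rw [h1, hzero _ hs.symm, add_zero]
      · apply hpq
        have h1 : (b' + 2) • t = 0 := hzero _ (by omega)
        rw [hz, show (b' + 2 : ℤ) • t = (b' + 2) • t by module, h1, add_zero]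
    have hc1 : τ = 3 * (a' + b' + 2) + 1 := by
      interval_cases c <;> omega
    have hc1' : (τ : ℤ) = 3 * (a' + b' + 2) + 1 := by exact_mod_cast hc1
    have hmem : ∀ u ∈ A, (∃ m : ℤ, u = p + m • t ∧ -a' ≤ m ∧ m ≤ b' + 2) ∨
        ∀ k : ℤ, u + k • t ∈ A := by
      intro u hu
      rcases hcover u hu with ⟨i, hi, rfl⟩ | ⟨i, hi, rfl⟩ | h
      · refine Or.inl ⟨-i, ?_, by omega, by omega⟩
        module
      · refine Or.inl ⟨b' + 2 - i, ?_, by omega, by omega⟩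
        rw [hz]; module
      · exact Or.inr h
    have hwcoset : ∃ k : ℤ, w + t = p + p + k • t := by
      obtain ⟨u, hu, v, hv, huv⟩ := mem_add.1 (ends_add_subset t A A hw)
      rw [hE, mem_insert, mem_singleton] at hu hv
      rw [← huv]
      rcases hu with rfl | rfl <;> rcases hv with rfl | rfl
      · exact ⟨1, by module⟩
      · exact ⟨b' + 3, by rw [hz]; module⟩
      · exact ⟨b' + 3, by rw [hz]; module⟩
      · exact ⟨2 * b' + 5, by rw [hz]; module⟩
    obtain ⟨k₀, hk₀⟩ := hwcoset
    have hsum : ∀ m : ℤ, p + p + m • t ∈ A + A → ∃ s : ℤ, (τ : ℤ) ∣ m - s ∧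
        -2 * a' ≤ s ∧ s ≤ 2 * b' + 4 := by
      intro m hm
      obtain ⟨u, hu, v, hv, huv⟩ := mem_add.1 hm
      have full : ∀ u v : G, u + v = p + p + m • t → (∀ k : ℤ, u + k • t ∈ A) → v ∈ A → False := by
        intro u v huv hu hv
        apply (mem_ends.1 hw).2
        have := add_mem_add (hu (k₀ - m)) hv
        convert this using 1
        rw [show u + (k₀ - m) • t + v = u + v + (k₀ - m) • t by abel, huv, hk₀]
        module
      rcases hmem u hu with ⟨m₁, rfl, h₁, h₁'⟩ | h₁
      · rcases hmem v hv with ⟨m₂, rfl, h₂, h₂'⟩ | h₂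
        · refine ⟨m₁ + m₂, z _ ?_, by omega, by omega⟩
          rw [← sub_eq_zero] at huv
          rw [← neg_eq_zero, ← huv]
          module
        · exact (full v _ (by rw [add_comm, huv]) h₂ hu).elim
      · exact (full u v huv h₁ hv).elim
    refine final P hPA ?_ ?_
    · refine hEw _ (mem_ends.2 ⟨add_mem_add hqA hqA, fun hcon => ?_⟩)
      rw [show q + q + t = p + p + (2 * b' + 5 : ℤ) • t by rw [hz]; module] at hcon
      obtain ⟨s, hs, hs1, hs2⟩ := hsum _ hcon
      have := Int.le_of_dvd (by omega) hs
      omega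
    · have h1 : P + P ∈ ends (-t) (A + A) := by
        refine mem_ends.2 ⟨add_mem_add hPA hPA, fun hcon => ?_⟩
        rw [show P + P + -t = p + p + (-(2 * a' + 1) : ℤ) • t by rw [hP]; module] at hcon
        obtain ⟨s, hs, hs1, hs2⟩ := hsum _ hcon
        rw [← dvd_neg] at hs
        have := Int.le_of_dvd (by omega) hs
        omega
      obtain ⟨l, hl, hlp, hlw⟩ := hLw _ h1
      rw [hL, mem_insert, mem_singleton] at hl
      rcases hl with rfl | rfl
      · exact hlw
      · exact absurd hQp.symm hlp

/-- If all divisors of `|G|` are `1` modulo `3` and `|A| = (|G| - 1) / 3`, then `3A` does not miss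
exactly two elements. -/
theorem card_add_two_ne [Finite G] [DecidableEq G] {A : Finset G}
    (hn : ∀ d : ℕ, d ∣ Nat.card G → d % 3 = 1) (hA : 3 * A.card + 1 = Nat.card G)
    (hne : A.Nonempty) (hper : period (A + A + A) = ⊥) :
    (A + A + A).card + 2 ≠ Nat.card G := by
  intro h3
  have := Fintype.ofFinite G
  have hcompl : ((A + A + A)ᶜ).card = 2 := by
    rw [card_compl, ← Nat.card_eq_fintype_card]; omega
  obtain ⟨x, y, hxy, hc⟩ := card_eq_two.1 hcompl
  obtain ⟨t, rfl⟩ : ∃ t, y = x - t := ⟨x - y, by abel⟩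
  have h3A : ∀ w, w ∈ A + A + A ↔ w ≠ x ∧ w ≠ x - t := by
    intro w
    rw [← not_iff_not, ← mem_compl, hc, mem_insert, mem_singleton]
    tauto
  have hx : x ∉ A + A + A := fun h => ((h3A x).1 h).1 rfl
  have hxt : x - t ∉ A + A + A := fun h => ((h3A _).1 h).2 rfl
  have kp : ∀ p : ℕ, p.Prime → p % 3 ≠ 1 → ∀ g : G, p • g = 0 → g = 0 := by
    intro p hp hp3 g hg
    rw [← AddMonoid.addOrderOf_eq_one_iff]
    rcases (Nat.dvd_prime hp).1 (addOrderOf_dvd_of_nsmul_eq_zero hg) with h | h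
    · exact h
    · exact absurd (hn _ (h ▸ addOrderOf_dvd_natCard g)) hp3
  have k2 := kp 2 Nat.prime_two (by norm_num)
  have k3 := kp 3 Nat.prime_three (by norm_num)
  have ht : t ≠ 0 := by
    rintro rfl
    simp at hxy
  have h2 := two_mul_card_le hne hper
  have hle := card_ends_add_le hx hxt
  have hEne : (ends t A).card ≠ 0 := by
    rw [Ne, card_eq_zero]
    intro hcon
    have := period_le_period_add _ A (period_le_period_add _ A (ends_eq_empty_iff.1 hcon))
    rw [hper, AddSubgroup.mem_bot] at this
    exact ht this
  have hcard : (ends t A).card = 1 ∨ (ends t A).card = 2 := by omega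
  have hτ := hn _ (addOrderOf_dvd_natCard t)
  rcases hcard with h1 | h1
  · obtain ⟨p, hp⟩ := card_eq_one.1 h1
    obtain ⟨s, hs⟩ := card_eq_one.1 ((card_ends_neg t A).trans h1)
    have hpA := mem_ends.1 (show p ∈ ends t A by simp [hp])
    have hsA := mem_ends.1 (show s ∈ ends (-t) A by simp [hs])
    have e1 : x - t - t ∈ ends t (A + A + A) := by
      rw [mem_ends, h3A, sub_add_cancel]
      refine ⟨⟨fun h => ?_, fun h => ?_⟩, hxt⟩
      · rw [sub_sub, sub_eq_self, ← two_nsmul] at h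
        exact ht (k2 t h)
      · exact ht (sub_eq_self.1 h)
    have e2 : x + t ∈ ends (-t) (A + A + A) := by
      rw [mem_ends, h3A, add_neg_cancel_right]
      refine ⟨⟨fun h => ?_, fun h => ?_⟩, hx⟩
      · exact ht (add_eq_left.1 h)
      · refine ht (k2 t ?_)
        rw [show 2 • t = x + t - (x - t) by abel, h, sub_self]
    have e3 : x - t - t = p + p + p := by
      obtain ⟨u, hu, v, hv, huv⟩ := mem_add.1 (ends_add_subset t (A + A) A e1)
      obtain ⟨u', hu', v', hv', huv'⟩ := mem_add.1 (ends_add_subset t A A hu)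
      rw [hp, mem_singleton] at hv hu' hv'
      rw [← huv, ← huv', hv, hu', hv']
    have e4 : x + t = s + s + s := by
      obtain ⟨u, hu, v, hv, huv⟩ := mem_add.1 (ends_add_subset (-t) (A + A) A e2)
      obtain ⟨u', hu', v', hv', huv'⟩ := mem_add.1 (ends_add_subset (-t) A A hu)
      rw [hs, mem_singleton] at hv hu' hv'
      rw [← huv, ← huv', hv, hu', hv']
    apply hpA.2
    have : 3 • (s - (p + t)) = 0 := by
      rw [show 3 • (s - (p + t)) = (s + s + s) - (p + p + p) - 3 • t by abel, ← e3, ← e4]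
      abel
    rw [← sub_eq_zero.1 (k3 _ this)]
    exact hsA.1
  · obtain ⟨p, q, hpq, hE⟩ := card_eq_two.1 h1
    obtain ⟨a, b, r, ha, hat, hb, hbt, hp, hpa, hq, hqb, hr, hcover⟩ := exists_two_runs hpq hE
    have h2A := mem_add_self_iff hx hxt (by omega)
    have hmod : addOrderOf t ∣ 3 * (a + b) + 1 := by
      have h4 := addOrderOf_dvd_natCard t
      rw [← hA, hr, show 3 * (addOrderOf t * r + a + b) + 1 =
        addOrderOf t * (3 * r) + (3 * (a + b) + 1) by ring] at h4
      exact (Nat.dvd_add_right (dvd_mul_right _ _)).1 h4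
    have hcover' : ∀ u ∈ A, (∃ i < b, u = q - i • t) ∨ (∃ i < a, u = p - i • t) ∨
        ∀ k : ℤ, u + k • t ∈ A := fun u hu => or_left_comm.1 (hcover u hu)
    have hE' : ends t A = {q, p} := by rw [hE, pair_comm]
    have hmod' : addOrderOf t ∣ 3 * (b + a) + 1 := by rwa [add_comm b a]
    by_cases hp2 : p + t + t ∈ A
    · exact false_of_short_gap k2 k3 hpq hE h2A h3A ha hat hb hbt hp hpa hq hqb hcover hτ hmod hp2
    by_cases hq2 : q + t + t ∈ A
    · exact false_of_short_gap k2 k3 hpq.symm hE' h2A h3A hb hbt ha hat hq hqb hp hpa hcover' hτ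
        hmod' hq2
    rcases eq_of_no_short_gap k2 k3 hpq hE h2A hp2 hq2 with h | h
    · exact false_of_no_short_gap k2 k3 hpq hE h2A h3A ha hat hb hbt hp hpa hq hqb hcover hτ hmod
        hp2 hq2 h
    · exact false_of_no_short_gap k2 k3 hpq.symm hE' h2A h3A hb hbt ha hat hq hqb hp hpa hcover' hτ
        hmod' hq2 hp2 (by rw [h]; abel)

/-! ### Constructions of large incomplete sets -/

theorem exists_addSubgroup_card [Finite G] (k : ℕ) (hk : k ∣ Nat.card G) :
    ∃ L : AddSubgroup G, Nat.card L = k := by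
  induction k using induction_on_primes with
  | zero => exact absurd (zero_dvd_iff.1 hk) Nat.card_pos.ne'
  | one => exact ⟨⊥, AddSubgroup.card_bot⟩
  | prime_mul p a hp ih =>
    obtain ⟨L, hL⟩ := ih ((dvd_mul_left a p).trans hk)
    have hLpos : 0 < Nat.card L := Nat.card_pos
    have hcard := AddSubgroup.card_eq_card_quotient_mul_card_addSubgroup L
    have hpd : p ∣ Nat.card (G ⧸ L) := by
      rw [hcard, hL] at hk
      exact Nat.dvd_of_mul_dvd_mul_right (hL ▸ hLpos) hk
    have : Fact p.Prime := ⟨hp⟩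
    obtain ⟨q, hq⟩ := exists_prime_addOrderOf_dvd_card' p hpd
    refine ⟨(AddSubgroup.zmultiples q).comap (QuotientAddGroup.mk' L), ?_⟩
    have h1 := AddSubgroup.index_comap_of_surjective (AddSubgroup.zmultiples q)
      (QuotientAddGroup.mk'_surjective L)
    have h2 := AddSubgroup.card_mul_index
      ((AddSubgroup.zmultiples q).comap (QuotientAddGroup.mk' L))
    have h3 := AddSubgroup.card_mul_index (AddSubgroup.zmultiples q)
    rw [Nat.card_zmultiples, hq] at h3
    rw [h1, hcard, ← h3, hL] at h2
    have hpos : 0 < (AddSubgroup.zmultiples q).index := by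
      rw [Nat.pos_iff_ne_zero]
      exact AddSubgroup.index_ne_zero_of_finite
    refine Nat.eq_of_mul_eq_mul_right hpos (h2.trans ?_)
    ring

theorem exists_addSubgroup_le_card [Finite G] (M : AddSubgroup G) (k : ℕ) (hk : k ∣ Nat.card M) :
    ∃ L ≤ M, Nat.card L = k := by
  obtain ⟨L, hL⟩ := exists_addSubgroup_card k hk
  refine ⟨L.map M.subtype, AddSubgroup.map_subtype_le L, ?_⟩
  rw [← hL]
  exact AddSubgroup.card_map_of_injective M.subtype_injective

open Classical in
theorem card_filter_mk_mem [Fintype G] (H : AddSubgroup G) (C : Finset (G ⧸ H)) :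
    (univ.filter (fun x : G => (x : G ⧸ H) ∈ C)).card = Nat.card H * C.card := by
  rw [card_eq_mul_card_image_mk (H := H)]
  · congr 2
    ext q
    simp only [mem_image, mem_filter, mem_univ, true_and]
    constructor
    · rintro ⟨x, hx, rfl⟩; exact hx
    · intro hq
      obtain ⟨x, rfl⟩ := QuotientAddGroup.mk_surjective q
      exact ⟨x, hq, rfl⟩
  · intro g hg x
    simp only [mem_filter, mem_univ, true_and]
    rw [QuotientAddGroup.mk_add, (QuotientAddGroup.eq_zero_iff g).2 hg, add_zero]

theorem three_mul_card_add_one_le [Finite G] [DecidableEq G] {A : Finset G}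
    (hn : ∀ d : ℕ, d ∣ Nat.card G → d % 3 = 1) (hA : A.Nonempty)
    (h3 : (A + A + A).card < Nat.card G) : 3 * A.card + 1 ≤ Nat.card G := by
  classical
  have h3' : (A + A + A).card < Nat.card G := h3
  obtain ⟨H, B, hB, hAB, -, hper, hlt⟩ := exists_quotient hA (by convert h3')
  have hcard := AddSubgroup.card_eq_card_quotient_mul_card_addSubgroup H
  have hd := hn _ (Dvd.intro _ hcard.symm)
  have h := three_mul_card_le hB hper
  have hk : 3 * B.card + 1 ≤ Nat.card (G ⧸ H) := by omega
  have hpos : 0 < Nat.card H := Nat.card_pos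
  calc 3 * A.card + 1 ≤ 3 * (Nat.card H * B.card) + Nat.card H := by omega
    _ = (3 * B.card + 1) * Nat.card H := by ring
    _ ≤ Nat.card G := by rw [hcard]; exact Nat.mul_le_mul_right _ hk

/-- A "positive cone": `(|M| - 1) / 3` nonzero elements of `M` such that no sum of at most three of
them vanishes. It is lifted from the quotient by a cyclic subgroup `⟨g⟩` of order `3s + 1`, and
completed by `g, 2g, …, sg`. -/
theorem exists_cone (n : ℕ) : ∀ (M : Type u) [AddCommGroup M] [Finite M] [DecidableEq M],
    Nat.card M = n → (∀ d : ℕ, d ∣ n → d % 3 = 1) →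
    ∃ C : Finset M, 3 * C.card + 1 = n ∧ 0 ∉ C ∧
      ∀ a ∈ insert 0 C, ∀ b ∈ insert 0 C, ∀ c ∈ insert 0 C,
        a + b + c = 0 → a = 0 ∧ b = 0 ∧ c = 0 := by
  induction n using Nat.strong_induction_on with
  | _ n ih =>
  intro M _ _ _ hM hn
  classical
  have := Fintype.ofFinite M
  rcases subsingleton_or_nontrivial M with hs | hs
  · refine ⟨∅, ?_, by simp, ?_⟩
    · rw [← hM, Nat.card_of_subsingleton (0 : M)]; simp
    · intro a _ b _ c _ _
      exact ⟨Subsingleton.elim _ _, Subsingleton.elim _ _, Subsingleton.elim _ _⟩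
  · obtain ⟨g, hg⟩ := exists_ne (0 : M)
    set N := AddSubgroup.zmultiples g with hN
    have hNcard : Nat.card N = addOrderOf g := Nat.card_zmultiples g
    have hcard := AddSubgroup.card_eq_card_quotient_mul_card_addSubgroup N
    have hτ : addOrderOf g % 3 = 1 := hn _ (hM ▸ addOrderOf_dvd_natCard g)
    have hτ1 : addOrderOf g ≠ 1 := fun h => hg (AddMonoid.addOrderOf_eq_one_iff.1 h)
    have hQpos : 0 < Nat.card (M ⧸ N) := Nat.card_pos
    have hQlt : Nat.card (M ⧸ N) < n := by
      rw [← hM, hcard, hNcard]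
      exact lt_mul_of_one_lt_right hQpos (by omega)
    obtain ⟨C', hC'card, hC'0, hC'⟩ := ih _ hQlt (M ⧸ N) rfl
      (fun d hd => hn d (hd.trans (hM ▸ Dvd.intro _ hcard.symm)))
    obtain ⟨s, hs⟩ : ∃ s, addOrderOf g = 3 * s + 1 := ⟨addOrderOf g / 3, by omega⟩
    set U := univ.filter (fun x : M => (x : M ⧸ N) ∈ C') with hU
    set V := (Icc 1 s).image (fun i : ℕ => i • g) with hV
    have hVN : ∀ v ∈ V, (v : M ⧸ N) = 0 := by
      intro v hv
      obtain ⟨i, -, rfl⟩ := mem_image.1 hv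
      exact (QuotientAddGroup.eq_zero_iff _).2 (AddSubgroup.nsmul_mem_zmultiples g i)
    have hVcard : V.card = s := by
      rw [hV, card_image_of_injOn, Nat.card_Icc, Nat.add_sub_cancel]
      intro i hi j hj hij
      have hi' := mem_Icc.1 (mem_coe.1 hi)
      have hj' := mem_Icc.1 (mem_coe.1 hj)
      exact nsmul_injOn_Iio_addOrderOf (Set.mem_Iio.2 (by omega)) (Set.mem_Iio.2 (by omega)) hij
    have hmk : ∀ a ∈ insert 0 (U ∪ V), (a : M ⧸ N) ∈ insert 0 C' := by
      intro a ha
      rw [mem_insert, mem_union] at ha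
      rcases ha with rfl | ha | ha
      · simp
      · exact mem_insert_of_mem (mem_filter.1 ha).2
      · rw [hVN a ha]; exact mem_insert_self _ _
    have hrep : ∀ a ∈ insert 0 (U ∪ V), (a : M ⧸ N) = 0 → ∃ i ≤ s, a = i • g := by
      intro a ha ha0
      rw [mem_insert, mem_union] at ha
      rcases ha with rfl | ha | ha
      · exact ⟨0, by omega, by simp⟩
      · exact absurd (ha0 ▸ (mem_filter.1 ha).2) hC'0
      · obtain ⟨i, hi, rfl⟩ := mem_image.1 ha
        exact ⟨i, (mem_Icc.1 hi).2, rfl⟩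
    refine ⟨U ∪ V, ?_, ?_, ?_⟩
    · rw [card_union_of_disjoint, hVcard, hU, card_filter_mk_mem, ← hM, hcard, ← hC'card, hNcard,
        hs]
      · ring
      · rw [disjoint_left]
        intro a ha hv
        have := (mem_filter.1 ha).2
        rw [hVN a hv] at this
        exact hC'0 this
    · rw [mem_union, not_or]
      constructor
      · intro h; exact hC'0 (mem_filter.1 h).2
      · intro h
        obtain ⟨i, hi, hi0⟩ := mem_image.1 h
        have h1 := mem_Icc.1 hi
        have := Nat.le_of_dvd (by omega) (addOrderOf_dvd_of_nsmul_eq_zero hi0)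
        omega
    · intro a ha b hb c hc habc
      obtain ⟨h1, h2, h3⟩ := hC' _ (hmk a ha) _ (hmk b hb) _ (hmk c hc) (by
        rw [← QuotientAddGroup.mk_add, ← QuotientAddGroup.mk_add, habc]; rfl)
      obtain ⟨i, hi, rfl⟩ := hrep a ha h1
      obtain ⟨j, hj, rfl⟩ := hrep b hb h2
      obtain ⟨k, hk, rfl⟩ := hrep c hc h3
      rw [← add_nsmul, ← add_nsmul] at habc
      have h0 : i + j + k = 0 :=
        Nat.eq_zero_of_dvd_of_lt (addOrderOf_dvd_of_nsmul_eq_zero habc) (by omega)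
      obtain ⟨rfl, rfl, rfl⟩ : i = 0 ∧ j = 0 ∧ k = 0 := by omega
      simp

/-- A set `A₀` inside a subgroup `L` is completed by full cosets of `L` to a set `A` such that
`3A` consists of `3A₀` and of everything outside `L`. -/
theorem exists_completion [Finite G] [DecidableEq G] (L : AddSubgroup G)
    (hL : ∀ d : ℕ, d ∣ L.index → d % 3 = 1) (A₀ : Finset G) (hA₀ : ∀ a ∈ A₀, a ∈ L)
    (hne : A₀.Nonempty) :
    ∃ A : Finset G, 3 * A.card + Nat.card L = Nat.card G + 3 * A₀.card ∧
      (A + A + A).card + Nat.card L = Nat.card G + (A₀ + A₀ + A₀).card := by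
  classical
  have := Fintype.ofFinite G
  have hcard := AddSubgroup.card_eq_card_quotient_mul_card_addSubgroup L
  have hind : Nat.card (G ⧸ L) = L.index := rfl
  obtain ⟨C, hCcard, hC0, hC⟩ := exists_cone _ (G ⧸ L) rfl hL
  obtain ⟨a₀, ha₀⟩ := hne
  have hmk0 : ∀ a ∈ A₀, (a : G ⧸ L) = 0 := fun a ha => (QuotientAddGroup.eq_zero_iff a).2 (hA₀ a ha)
  set U := univ.filter (fun x : G => (x : G ⧸ L) ∈ C) with hU
  have hmk : ∀ a ∈ U ∪ A₀, (a : G ⧸ L) ∈ insert 0 C := by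
    intro a ha
    rcases mem_union.1 ha with ha | ha
    · exact mem_insert_of_mem (mem_filter.1 ha).2
    · rw [hmk0 a ha]; exact mem_insert_self _ _
  have hback : ∀ a ∈ U ∪ A₀, (a : G ⧸ L) = 0 → a ∈ A₀ := by
    intro a ha h0
    rcases mem_union.1 ha with ha | ha
    · exact absurd (h0 ▸ (mem_filter.1 ha).2) hC0
    · exact ha
  have hUA : Disjoint U A₀ := by
    rw [disjoint_left]
    intro a ha ha'
    have := (mem_filter.1 ha).2
    rw [hmk0 a ha'] at this
    exact hC0 this
  have hfull : insert 0 C + insert 0 C + insert 0 C = univ := by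
    by_contra hcon
    have hlt : (insert 0 C + insert 0 C + insert 0 C).card < Nat.card (G ⧸ L) := by
      rw [Nat.card_eq_fintype_card]
      exact (card_lt_iff_ne_univ _).2 hcon
    have := three_mul_card_add_one_le hL (insert_nonempty 0 C) hlt
    rw [card_insert_of_notMem hC0] at this
    omega
  have hlift : ∀ v ∈ insert 0 C, ∃ y ∈ U ∪ A₀, (y : G ⧸ L) = v := by
    intro v hv
    rcases mem_insert.1 hv with rfl | hv
    · exact ⟨a₀, mem_union_right _ ha₀, hmk0 a₀ ha₀⟩
    · obtain ⟨y, rfl⟩ := QuotientAddGroup.mk_surjective v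
      exact ⟨y, mem_union_left _ (mem_filter.2 ⟨mem_univ _, hv⟩), rfl⟩
  have hcover : ∀ x : G, ∀ u ∈ insert 0 C, ∀ v ∈ insert 0 C, ∀ w ∈ insert 0 C, u ≠ 0 →
      u + v + w = (x : G ⧸ L) → x ∈ (U ∪ A₀) + (U ∪ A₀) + (U ∪ A₀) := by
    intro x u hu v hv w hw hu0 huvw
    obtain ⟨y, hy, rfl⟩ := hlift v hv
    obtain ⟨z, hz, rfl⟩ := hlift w hw
    have huC := (mem_insert.1 hu).resolve_left hu0
    have : x - y - z ∈ U := by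
      refine mem_filter.2 ⟨mem_univ _, ?_⟩
      rw [QuotientAddGroup.mk_sub, QuotientAddGroup.mk_sub, ← huvw]
      convert huC using 1
      abel
    have h := add_mem_add (add_mem_add (mem_union_left A₀ this) hy) hz
    convert h using 1
    abel
  have h3 : (U ∪ A₀) + (U ∪ A₀) + (U ∪ A₀) = univ.filter (· ∉ L) ∪ (A₀ + A₀ + A₀) := by
    ext x
    rw [mem_union, mem_filter]
    constructor
    · intro hx
      by_cases hxL : x ∈ L
      · right
        obtain ⟨s, hs, c, hc, rfl⟩ := mem_add.1 hx
        obtain ⟨a, ha, b, hb, rfl⟩ := mem_add.1 hs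
        obtain ⟨h1, h2, h3⟩ := hC _ (hmk a ha) _ (hmk b hb) _ (hmk c hc)
          ((QuotientAddGroup.eq_zero_iff _).2 hxL)
        exact add_mem_add (add_mem_add (hback a ha h1) (hback b hb h2)) (hback c hc h3)
      · exact Or.inl ⟨mem_univ _, hxL⟩
    · rintro (⟨-, hx⟩ | hx)
      · have hx0 : (x : G ⧸ L) ≠ 0 := fun h => hx ((QuotientAddGroup.eq_zero_iff x).1 h)
        obtain ⟨s, hs, w, hw, hsw⟩ := mem_add.1 (hfull ▸ mem_univ (x : G ⧸ L))
        obtain ⟨u, hu, v, hv, rfl⟩ := mem_add.1 hs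
        by_cases hu0 : u = 0
        · by_cases hv0 : v = 0
          · refine hcover x w hw u hu v hv ?_ (by rw [← hsw]; abel)
            rintro rfl
            apply hx0
            rw [← hsw, hu0, hv0]; simp
          · exact hcover x v hv u hu w hw hv0 (by rw [← hsw]; abel)
        · exact hcover x u hu v hv w hw hu0 hsw
      · have hsub : A₀ ⊆ U ∪ A₀ := subset_union_right
        exact add_subset_add (add_subset_add hsub hsub) hsub hx
  refine ⟨U ∪ A₀, ?_, ?_⟩
  · rw [card_union_of_disjoint hUA, hU, card_filter_mk_mem, hcard, ← hCcard]; ring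
  · rw [h3, card_union_of_disjoint]
    · have h4 := card_filter_add_card_filter_not (s := (univ : Finset G)) (· ∈ L)
      rw [card_eq_natCard_of_mem_iff L (univ.filter (· ∈ L)) (by simp), card_univ,
        ← Nat.card_eq_fintype_card] at h4
      omega
    · rw [disjoint_left]
      intro x hx hx'
      obtain ⟨s, hs, c, hc, rfl⟩ := mem_add.1 hx'
      obtain ⟨a, ha, b, hb, rfl⟩ := mem_add.1 hs
      exact (mem_filter.1 hx).2 (L.add_mem (L.add_mem (hA₀ a ha) (hA₀ b hb)) (hA₀ c hc))

theorem range_add_range_add_range {m : ℕ} (hm : 1 ≤ m) :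
    range m + range m + range m = range (3 * m - 2) := by
  ext x
  simp only [mem_add, mem_range]
  constructor
  · rintro ⟨_, ⟨a, ha, b, hb, rfl⟩, c, hc, rfl⟩
    omega
  · intro hx
    rcases Nat.lt_or_ge x m with h | h
    · exact ⟨0, ⟨0, by omega, 0, by omega, rfl⟩, x, h, by omega⟩
    rcases Nat.lt_or_ge x (2 * m - 1) with h' | h'
    · exact ⟨m - 1, ⟨0, by omega, m - 1, by omega, by omega⟩, x - (m - 1), by omega, by omega⟩
    · exact ⟨2 * (m - 1), ⟨m - 1, by omega, m - 1, by omega, by omega⟩, x - 2 * (m - 1), by omega,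
        by omega⟩

/-- An interval with its last but one point removed. -/
theorem insert_range_add {j : ℕ} (hj : 3 ≤ j) :
    insert j (range (j - 1)) + insert j (range (j - 1)) + insert j (range (j - 1)) =
      insert (3 * j) (range (3 * j - 1)) := by
  ext x
  simp only [mem_add, mem_range, mem_insert]
  constructor
  · rintro ⟨_, ⟨a, ha, b, hb, rfl⟩, c, hc, rfl⟩
    omega
  · rintro (rfl | hx)
    · exact ⟨2 * j, ⟨j, by omega, j, by omega, by omega⟩, j, by omega, by omega⟩
    rcases Nat.lt_or_ge x (j - 1) with h | h
    · exact ⟨0, ⟨0, by omega, 0, by omega, rfl⟩, x, by omega, by omega⟩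
    rcases Nat.lt_or_ge x (2 * j - 3) with h' | h'
    · exact ⟨j - 2, ⟨0, by omega, j - 2, by omega, by omega⟩, x - (j - 2), by omega, by omega⟩
    rcases Nat.lt_or_ge x (2 * j - 1) with h' | h'
    · exact ⟨j, ⟨0, by omega, j, by omega, by omega⟩, x - j, by omega, by omega⟩
    rcases Nat.lt_or_ge x (3 * j - 3) with h'' | h''
    · exact ⟨j + (j - 2), ⟨j, by omega, j - 2, by omega, by omega⟩, x - (j + (j - 2)), by omega,
        by omega⟩
    · exact ⟨2 * j, ⟨j, by omega, j, by omega, by omega⟩, x - 2 * j, by omega, by omega⟩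

/-- The set of the multiples `i • g`, `i ∈ S`, has as many elements as `S`, and so does its
threefold sumset as long as nothing wraps around. -/
theorem exists_image_multiples [Finite G] [DecidableEq G] (g : G) (S : Finset ℕ)
    (hS : S ⊆ range (addOrderOf g)) (h3S : S + S + S ⊆ range (addOrderOf g)) :
    ∃ A₀ : Finset G, (∀ a ∈ A₀, a ∈ AddSubgroup.zmultiples g) ∧ A₀.card = S.card ∧
      (A₀ + A₀ + A₀).card = (S + S + S).card := by
  have hinj : ∀ T : Finset ℕ, T ⊆ range (addOrderOf g) →
      (T.image (multiplesHom G g)).card = T.card := by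
    intro T hT
    rw [card_image_of_injOn]
    intro i hi j hj hij
    have hi' := mem_range.1 (hT hi)
    have hj' := mem_range.1 (hT hj)
    exact nsmul_injOn_Iio_addOrderOf (Set.mem_Iio.2 hi') (Set.mem_Iio.2 hj') hij
  refine ⟨S.image (multiplesHom G g), ?_, hinj S hS, ?_⟩
  · intro a ha
    obtain ⟨i, -, rfl⟩ := mem_image.1 ha
    exact AddSubgroup.nsmul_mem_zmultiples g i
  · rw [← image_add, ← image_add, hinj _ h3S]

/-- Pulling back along a surjection multiplies the sizes of sets and of their sumsets by the size
of the kernel. -/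
theorem exists_preimage {Z : Type*} [AddCommGroup Z] [Finite G] [Finite Z] [DecidableEq G]
    [DecidableEq Z] (f : G →+ Z) (hf : Function.Surjective f) :
    ∃ k, Nat.card G = Nat.card Z * k ∧ ∀ I : Finset Z, ∃ A : Finset G,
      A.card = k * I.card ∧ (A + A + A).card = k * (I + I + I).card := by
  have := Fintype.ofFinite G
  have := Fintype.ofFinite Z
  have hfib : ∀ z : Z, (univ.filter (fun x => f x = z)).card =
      (univ.filter (fun x => f x = 0)).card := fun z =>
    AddMonoidHom.card_fiber_eq_of_mem_range f (hf z) (hf 0)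
  have hpre : ∀ I : Finset Z, (univ.filter (fun x => f x ∈ I)).card =
      (univ.filter (fun x => f x = 0)).card * I.card := by
    intro I
    rw [card_eq_sum_card_fiberwise (f := f) (t := I) (fun x hx => by simpa using hx),
      sum_const_nat (m := (univ.filter (fun x => f x = 0)).card), mul_comm]
    intro z hz
    rw [← hfib z, filter_filter]
    congr 1
    ext x
    simp only [mem_filter, mem_univ, true_and, and_iff_right_iff_imp]
    rintro rfl; exact hz
  refine ⟨(univ.filter (fun x => f x = 0)).card, ?_, fun I => ?_⟩
  · have := hpre univ
    rw [filter_true_of_mem (by simp), card_univ, card_univ] at this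
    rw [Nat.card_eq_fintype_card, Nat.card_eq_fintype_card, this, mul_comm]
  · refine ⟨univ.filter (fun x => f x ∈ I), hpre I, ?_⟩
    rw [← hpre]
    congr 1
    ext x
    simp only [mem_filter, mem_univ, true_and]
    constructor
    · intro hx
      obtain ⟨s, hs, c, hc, rfl⟩ := mem_add.1 hx
      obtain ⟨a, ha, b, hb, rfl⟩ := mem_add.1 hs
      rw [map_add, map_add]
      exact add_mem_add (add_mem_add (mem_filter.1 ha).2 (mem_filter.1 hb).2) (mem_filter.1 hc).2
    · intro hx
      obtain ⟨s, hs, c, hc, hsc⟩ := mem_add.1 hx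
      obtain ⟨a, ha, b, hb, rfl⟩ := mem_add.1 hs
      obtain ⟨a, rfl⟩ := hf a
      obtain ⟨b, rfl⟩ := hf b
      have : x - a - b ∈ univ.filter (fun x => f x ∈ I) := by
        rw [mem_filter, map_sub, map_sub, ← hsc]
        refine ⟨mem_univ _, ?_⟩
        convert hc using 1
        abel
      have hmem : ∀ y : G, f y ∈ I → y ∈ univ.filter (fun x => f x ∈ I) := fun y hy =>
        mem_filter.2 ⟨mem_univ y, hy⟩
      have h := add_mem_add (add_mem_add (hmem a ha) (hmem b hb)) this
      convert h using 1
      abel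

theorem exists_interval_zmod (q m : ℕ) [NeZero q] (hm : 1 ≤ m) (hmq : 3 * m - 2 ≤ q) :
    ∃ I : Finset (ZMod q), I.card = m ∧ (I + I + I).card = 3 * m - 2 := by
  have hinj : ∀ k ≤ q, ((range k).image (Nat.castAddMonoidHom (ZMod q))).card = k := by
    intro k hk
    rw [card_image_of_injOn, card_range]
    intro i hi j hj hij
    have hi' := mem_range.1 (mem_coe.1 hi)
    have hj' := mem_range.1 (mem_coe.1 hj)
    have := (ZMod.natCast_eq_natCast_iff' i j q).1 hij
    rwa [Nat.mod_eq_of_lt (by omega), Nat.mod_eq_of_lt (by omega)] at this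
  refine ⟨(range m).image (Nat.castAddMonoidHom (ZMod q)), hinj m (by omega), ?_⟩
  rw [← image_add, ← image_add, range_add_range_add_range hm, hinj _ hmq]

/-- If `p ^ a` divides the exponent of `G`, then `G` has a cyclic quotient of order `p ^ a`. -/
theorem exists_surjective_zmod [Finite G] {p : ℕ} (hp : p.Prime) {a : ℕ}
    (ha : p ^ a ∣ AddMonoid.exponent G) :
    ∃ f : G →+ ZMod (p ^ a), Function.Surjective f := by
  classical
  rcases Nat.eq_zero_or_pos a with rfl | ha0
  · have : Subsingleton (ZMod (p ^ 0)) := by rw [pow_zero]; infer_instance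
    exact ⟨0, fun z => ⟨0, Subsingleton.elim _ _⟩⟩
  obtain ⟨b, rfl⟩ : ∃ b, a = b + 1 := ⟨a - 1, by omega⟩
  obtain ⟨ι, _, q, hq, e, ⟨φ⟩⟩ := AddCommGroup.equiv_directSum_zmod_of_finite G
  by_cases h : ∃ i, p ^ (b + 1) ∣ q i ^ e i
  · obtain ⟨i, hi⟩ := h
    refine ⟨((ZMod.castHom hi (ZMod (p ^ (b + 1)))).toAddMonoidHom.comp
      (DFinsupp.evalAddMonoidHom i)).comp φ.toAddMonoidHom, ?_⟩
    intro z
    obtain ⟨y, rfl⟩ := ZMod.castHom_surjective hi z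
    refine ⟨φ.symm (DirectSum.of (fun i => ZMod (q i ^ e i)) i y), ?_⟩
    simp only [AddMonoidHom.comp_apply, AddEquiv.toAddMonoidHom_eq_coe, AddMonoidHom.coe_coe,
      AddEquiv.apply_symm_apply]
    exact congrArg (ZMod.castHom hi (ZMod (p ^ (b + 1))))
      (DirectSum.of_eq_same (β := fun i => ZMod (q i ^ e i)) i y)
  · -- otherwise the exponent divided by `p` would annihilate `G`
    exfalso
    push Not at h
    obtain ⟨m, hm⟩ := ha
    have hdvd : ∀ i, q i ^ e i ∣ p ^ b * m := by
      intro i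
      have h1 : q i ^ e i ∣ p ^ (b + 1) * m := by
        rw [← hm, ← CharP.cast_eq_zero_iff (ZMod (q i ^ e i))]
        have h2 : AddMonoid.exponent G • φ.symm (DirectSum.of (fun i => ZMod (q i ^ e i)) i 1) = 0 :=
          AddMonoid.exponent_nsmul_eq_zero _
        rw [← map_nsmul, ← map_nsmul, map_eq_zero_iff _ φ.symm.injective] at h2
        have h3 := DirectSum.of_injective i (h2.trans (map_zero _).symm)
        simpa using h3
      by_cases hqp : q i = p
      · have h2 := h i
        rw [hqp, Nat.pow_dvd_pow_iff_le_right hp.one_lt] at h2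
        rw [hqp]
        exact (pow_dvd_pow p (by omega)).trans (dvd_mul_right _ _)
      · exact (Nat.Coprime.dvd_of_dvd_mul_left
          (Nat.Coprime.pow _ _ ((Nat.coprime_primes (hq i) hp).2 hqp)) h1).trans (dvd_mul_left _ _)
    have hkill : ∀ x : G, (p ^ b * m) • x = 0 := by
      intro x
      apply φ.injective
      rw [map_nsmul, map_zero]
      ext i
      rw [DirectSum.smul_apply, DirectSum.zero_apply, nsmul_eq_mul,
        (CharP.cast_eq_zero_iff (ZMod (q i ^ e i)) _ _).2 (hdvd i), zero_mul]
    have h1 := AddMonoid.exponent_dvd_of_forall_nsmul_eq_zero hkill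
    have hpos : 0 < AddMonoid.exponent G :=
      Nat.pos_of_ne_zero AddMonoid.exponent_ne_zero_of_finite
    rw [hm] at h1 hpos
    have h2 : 0 < p ^ b * m := by
      rw [pow_succ, mul_right_comm] at hpos
      exact Nat.pos_of_mul_pos_right hpos
    have h3 := Nat.le_of_dvd h2 h1
    rw [pow_succ, mul_right_comm] at h3
    have h4 := hp.two_le
    nlinarith

/-- The set `(M \ H) ∪ (x + H)`, where `M` has index `3` and `x ∉ M`: its threefold sumset misses
just the coset `2x + H`. -/
theorem exists_card_add_eq [Finite G] [DecidableEq G] {H M : AddSubgroup G} (hHM : H ≤ M)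
    (hM : M.index = 3) (hH : 3 * Nat.card H ≤ Nat.card M) :
    ∃ A : Finset G, A.card = Nat.card M ∧ (A + A + A).card + Nat.card H = Nat.card G := by
  classical
  have := Fintype.ofFinite G
  have hHpos : 0 < Nat.card H := Nat.card_pos
  have hHc := card_eq_natCard_of_mem_iff H (univ.filter (· ∈ H)) (by simp)
  have hMc := card_eq_natCard_of_mem_iff M (univ.filter (· ∈ M)) (by simp)
  obtain ⟨x, hx⟩ : ∃ x, x ∉ M := by
    by_contra hcon
    push Not at hcon
    rw [(AddSubgroup.eq_top_iff' M).2 hcon, AddSubgroup.index_top] at hM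
    omega
  have h3 : ∀ y, 3 • y ∈ M := fun y => hM ▸ AddSubgroup.nsmul_index_mem M y
  have h2x : 2 • x ∉ M := fun h => hx (by
    have := M.sub_mem (h3 x) h
    rwa [show 3 • x - 2 • x = x by abel] at this)
  have htri : ∀ y, y ∈ M ∨ y - x ∈ M ∨ y - 2 • x ∈ M := by
    intro y
    have := Fintype.ofFinite (G ⧸ M)
    have hcard : ({0, (x : G ⧸ M), ((2 • x : G) : G ⧸ M)} : Finset (G ⧸ M)).card = 3 := by
      rw [card_eq_three]
      refine ⟨_, _, _, ?_, ?_, ?_, rfl⟩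
      · intro h; exact hx ((QuotientAddGroup.eq_zero_iff x).1 h.symm)
      · intro h; exact h2x ((QuotientAddGroup.eq_zero_iff _).1 h.symm)
      · intro h
        have := QuotientAddGroup.eq.1 h
        rw [show -x + 2 • x = x by abel] at this
        exact hx this
    have huniv : ({0, (x : G ⧸ M), ((2 • x : G) : G ⧸ M)} : Finset (G ⧸ M)) = univ := by
      rw [← card_eq_iff_eq_univ, hcard, ← Nat.card_eq_fintype_card]
      exact hM.symm
    have hy := huniv ▸ mem_univ (y : G ⧸ M)
    rw [mem_insert, mem_insert, mem_singleton] at hy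
    rcases hy with h | h | h
    · exact Or.inl ((QuotientAddGroup.eq_zero_iff y).1 h)
    · have := QuotientAddGroup.eq.1 h.symm
      exact Or.inr (Or.inl (by rwa [neg_add_eq_sub] at this))
    · have := QuotientAddGroup.eq.1 h.symm
      exact Or.inr (Or.inr (by rwa [neg_add_eq_sub] at this))
  set U := univ.filter (fun a => a ∈ M ∧ a ∉ H) with hU
  have hUmem : ∀ {a}, a ∈ U ↔ a ∈ M ∧ a ∉ H := by simp [hU]
  have hUcard : U.card + Nat.card H = Nat.card M := by
    have h4 := card_filter_add_card_filter_not (s := univ.filter (· ∈ M)) (· ∈ H)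
    rw [filter_filter, filter_filter, hMc] at h4
    rw [← h4, add_comm, ← hHc]
    congr 2
    ext a
    simp only [mem_filter, mem_univ, true_and]
    exact ⟨fun h => ⟨hHM h, h⟩, fun h => h.2⟩
  -- `U` is more than half of `M`
  have hsplit : ∀ z ∈ M, ∃ a ∈ U, z - a ∈ U := by
    intro z hz
    by_contra hcon
    push Not at hcon
    have hsub : U ⊆ (univ.filter (· ∈ H)).image (fun h => z - h) := by
      intro a ha
      have h1 := hcon a ha
      rw [hUmem] at h1
      have h2 : z - a ∈ H := by
        by_contra h3
        exact h1 ⟨M.sub_mem hz (hUmem.1 ha).1, h3⟩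
      exact mem_image.2 ⟨z - a, by simpa using h2, by abel⟩
    have h5 := (card_le_card hsub).trans card_image_le
    omega
  set V := (univ.filter (· ∈ H)).image (fun h => x + h) with hV
  have hVmem : ∀ {a}, a ∈ V ↔ a - x ∈ H := by
    intro a
    rw [hV, mem_image]
    constructor
    · rintro ⟨h, hh, rfl⟩; simpa using hh
    · intro h; exact ⟨a - x, by simpa using h, by abel⟩
  have hVcard : V.card = Nat.card H := by
    rw [hV, card_image_of_injective _ (add_right_injective x), hHc]
  set W := (univ.filter (· ∈ H)).image (fun h => 2 • x + h) with hW
  have hWmem : ∀ {a}, a ∈ W ↔ a - 2 • x ∈ H := by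
    intro a
    rw [hW, mem_image]
    constructor
    · rintro ⟨h, hh, rfl⟩; simpa using hh
    · intro h; exact ⟨a - 2 • x, by simpa using h, by abel⟩
  have hWcard : W.card = Nat.card H := by
    rw [hW, card_image_of_injective _ (add_right_injective _), hHc]
  have hxV : x ∈ V := hVmem.2 (by simp [H.zero_mem])
  have h3A : (U ∪ V) + (U ∪ V) + (U ∪ V) = Wᶜ := by
    ext y
    rw [mem_compl, hWmem]
    constructor
    · rintro hy hyH
      obtain ⟨s, hs, c, hc, rfl⟩ := mem_add.1 hy
      obtain ⟨a, ha, b, hb, rfl⟩ := mem_add.1 hs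
      have hyM := hHM hyH
      have two : ∀ a b c : G, a ∈ U → b ∈ V → c ∈ V → a + b + c - 2 • x ∈ H → False := by
        intro a b c ha hb hc h
        refine (hUmem.1 ha).2 ?_
        have := H.sub_mem (H.sub_mem h (hVmem.1 hb)) (hVmem.1 hc)
        convert this using 1
        abel
      have one : ∀ a b c : G, a ∈ U → b ∈ U → c ∈ V → a + b + c - 2 • x ∈ M → False := by
        intro a b c ha hb hc h
        apply hx
        have := M.sub_mem (M.add_mem (M.add_mem (hUmem.1 ha).1 (hUmem.1 hb).1)
          (hHM (hVmem.1 hc))) h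
        convert this using 1
        abel
      rcases mem_union.1 ha with ha | ha <;> rcases mem_union.1 hb with hb | hb <;>
        rcases mem_union.1 hc with hc | hc
      · apply h2x
        have := M.sub_mem (M.add_mem (M.add_mem (hUmem.1 ha).1 (hUmem.1 hb).1)
          (hUmem.1 hc).1) hyM
        convert this using 1
        abel
      · exact one a b c ha hb hc hyM
      · exact one a c b ha hc hb (by rwa [add_right_comm])
      · exact two a b c ha hb hc hyH
      · exact one b c a hb hc ha (by rwa [add_comm (b + c), ← add_assoc])
      · exact two b a c hb ha hc (by rwa [add_comm b])
      · exact two c a b hc ha hb (by rwa [add_assoc, add_comm c])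
      · apply hx
        have := M.sub_mem hyM (M.add_mem (M.add_mem (hHM (hVmem.1 ha)) (hHM (hVmem.1 hb)))
          (hHM (hVmem.1 hc)))
        convert this using 1
        abel
    · intro hy
      have hUs : ∀ {a}, a ∈ U → a ∈ U ∪ V := fun h => mem_union_left _ h
      have hVs : ∀ {a}, a ∈ V → a ∈ U ∪ V := fun h => mem_union_right _ h
      rcases htri y with h | h | h
      · obtain ⟨a, ha, -⟩ := hsplit 0 M.zero_mem
        obtain ⟨b, hb, hb'⟩ := hsplit (y - a) (M.sub_mem h (hUmem.1 ha).1)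
        have h6 := add_mem_add (add_mem_add (hUs ha) (hUs hb)) (hUs hb')
        rwa [show a + b + (y - a - b) = y by abel] at h6
      · obtain ⟨b, hb, hb'⟩ := hsplit (y - x) h
        have h6 := add_mem_add (add_mem_add (hVs hxV) (hUs hb)) (hUs hb')
        rwa [show x + b + (y - x - b) = y by abel] at h6
      · have h6 := add_mem_add (add_mem_add (hVs hxV) (hVs hxV)) (hUs (hUmem.2 ⟨h, hy⟩))
        rwa [show x + x + (y - 2 • x) = y by abel] at h6
  refine ⟨U ∪ V, ?_, ?_⟩
  · rw [card_union_of_disjoint, hVcard, hUcard]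
    rw [disjoint_left]
    intro a ha ha'
    apply hx
    have := M.sub_mem (hUmem.1 ha).1 (hHM (hVmem.1 ha'))
    rwa [sub_sub_cancel] at this
  · have := card_le_univ W
    rw [hWcard] at this
    rw [h3A, card_compl, hWcard, Nat.card_eq_fintype_card (α := G)]
    omega

/-! ### Elementary abelian 7-groups: lines and planes -/

instance : Fact (Nat.Prime 7) := ⟨by norm_num⟩

/-- The Cauchy-Davenport theorem for three sets in `ZMod 7` without a zero sum. -/
theorem card_add_card_add_card_le {S T U : Finset (ZMod 7)} (hS : S.Nonempty) (hT : T.Nonempty)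
    (hU : U.Nonempty) (h : ∀ s ∈ S, ∀ t ∈ T, ∀ u ∈ U, s + t + u ≠ 0) :
    S.card + T.card + U.card ≤ 8 := by
  have h1 := ZMod.cauchy_davenport (p := 7) (by norm_num) hS hT
  have h2 : Disjoint (S + T) (U.image (fun u => -u)) := by
    rw [disjoint_left]
    intro x hx hx'
    obtain ⟨s, hs, t, ht, rfl⟩ := mem_add.1 hx
    obtain ⟨u, hu, hu'⟩ := mem_image.1 hx'
    refine h s hs t ht u hu ?_
    rw [← hu', neg_add_cancel]
  have h3 := card_le_univ ((S + T) ∪ U.image (fun u => -u))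
  rw [card_union_of_disjoint h2, card_image_of_injective _ neg_injective, ZMod.card] at h3
  have h4 := card_pos.2 hU
  omega

theorem zero_notMem {A : Finset G}
    (h0 : ∀ a ∈ A, ∀ b ∈ A, ∀ c ∈ A, a + b + c ≠ 0) : (0 : G) ∉ A :=
  fun h => h0 0 h 0 h 0 h (by simp)

section ElementarySeven

variable [Module (ZMod 7) G]

/-- Linear independence of a pair of vectors. -/
def Indep (c v : G) : Prop := ∀ i j : ZMod 7, i • c + j • v = 0 → i = 0 ∧ j = 0

theorem Indep.symm {c v : G} (h : Indep c v) : Indep v c := by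
  intro i j hij
  rw [add_comm] at hij
  exact (h j i hij).symm

variable [DecidableEq G] {A : Finset G}

theorem card_filter_smul_le (h0 : ∀ a ∈ A, ∀ b ∈ A, ∀ c ∈ A, a + b + c ≠ 0) (g : G) :
    (univ.filter (fun i : ZMod 7 => i • g ∈ A)).card ≤ 2 := by
  rcases (univ.filter (fun i : ZMod 7 => i • g ∈ A)).eq_empty_or_nonempty with h | h
  · rw [h]; simp
  · have := card_add_card_add_card_le h h h (by
      intro s hs t ht u hu hstu
      refine h0 _ (mem_filter.1 hs).2 _ (mem_filter.1 ht).2 _ (mem_filter.1 hu).2 ?_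
      rw [← add_smul, ← add_smul, hstu, zero_smul])
    omega

/-- Double counting over all lines through `0`: an extremal set meets each of them in exactly two
points. -/
theorem card_filter_smul_eq [Fintype G] (h0 : ∀ a ∈ A, ∀ b ∈ A, ∀ c ∈ A, a + b + c ≠ 0)
    (hA : 3 * A.card + 1 = Nat.card G) (g : G) (hg : g ≠ 0) :
    (univ.filter (fun i : ZMod 7 => i • g ∈ A)).card = 2 := by
  have hsum : ∑ g ∈ univ.erase (0 : G), (univ.filter (fun i : ZMod 7 => i • g ∈ A)).card =
      ∑ g ∈ univ.erase (0 : G), 2 := by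
    have h1 : ∑ g ∈ univ.erase (0 : G), (univ.filter (fun i : ZMod 7 => i • g ∈ A)).card =
        ∑ g : G, (univ.filter (fun i : ZMod 7 => i • g ∈ A)).card := by
      refine sum_subset (erase_subset _ _) ?_
      intro g _ hg
      have : g = 0 := by simpa using hg
      subst this
      simp [zero_notMem h0]
    have h2 : ∑ g : G, (univ.filter (fun i : ZMod 7 => i • g ∈ A)).card =
        ∑ i : ZMod 7, (univ.filter (fun g : G => i • g ∈ A)).card := by
      simp only [card_filter]
      exact sum_comm
    have h3 : ∀ i : ZMod 7, i ≠ 0 → (univ.filter (fun g : G => i • g ∈ A)).card = A.card := by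
      intro i hi
      refine card_bij (fun g _ => i • g) ?_ ?_ ?_
      · intro g hg; exact (mem_filter.1 hg).2
      · intro g _ g' _ h; exact smul_right_injective G hi h
      · intro b hb
        refine ⟨i⁻¹ • b, ?_, ?_⟩
        · rw [mem_filter, smul_inv_smul₀ hi]; exact ⟨mem_univ _, hb⟩
        · rw [smul_inv_smul₀ hi]
    have h4 : (univ.filter (fun g : G => (0 : ZMod 7) • g ∈ A)).card = 0 := by
      simp [zero_notMem h0]
    rw [h1, h2, ← add_sum_erase univ _ (mem_univ (0 : ZMod 7)), h4,
      sum_congr rfl (fun i hi => h3 i (ne_of_mem_erase hi)), sum_const, sum_const,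
      card_erase_of_mem (mem_univ _), card_erase_of_mem (mem_univ _), card_univ, card_univ,
      ZMod.card, ← Nat.card_eq_fintype_card, ← hA, smul_eq_mul, smul_eq_mul]
    omega
  exact (sum_eq_sum_iff_of_le (fun g _ => card_filter_smul_le h0 g)).1 hsum g
    (mem_erase.2 ⟨hg, mem_univ g⟩)

/-- The extremal sets: no zero sum of three elements, and two points on every line through `0`. -/
structure IsExtremal (A : Finset G) : Prop where
  sum_ne_zero : ∀ a ∈ A, ∀ b ∈ A, ∀ c ∈ A, a + b + c ≠ 0
  card_line : ∀ g : G, g ≠ 0 → (univ.filter (fun i : ZMod 7 => i • g ∈ A)).card = 2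

theorem IsExtremal.exists_pair (hA : IsExtremal A) {g : G} (hg : g ≠ 0) :
    ∃ i j : ZMod 7, i ≠ j ∧ i • g ∈ A ∧ j • g ∈ A ∧ (∀ k : ZMod 7, k • g ∈ A → k = i ∨ k = j) ∧
      i ≠ 0 ∧ j ≠ 0 ∧ i + i + j ≠ 0 ∧ i + j + j ≠ 0 := by
  obtain ⟨i, j, hij, h⟩ := card_eq_two.1 (hA.card_line g hg)
  have hmem : ∀ k : ZMod 7, k • g ∈ A ↔ k = i ∨ k = j := by
    intro k
    have : k ∈ univ.filter (fun i : ZMod 7 => i • g ∈ A) ↔ k ∈ ({i, j} : Finset (ZMod 7)) := by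
      rw [h]
    simpa using this
  have hi := (hmem i).2 (Or.inl rfl)
  have hj := (hmem j).2 (Or.inr rfl)
  refine ⟨i, j, hij, hi, hj, fun k => (hmem k).1, ?_, ?_, ?_, ?_⟩
  · rintro rfl; exact zero_notMem hA.sum_ne_zero (by simpa using hi)
  · rintro rfl; exact zero_notMem hA.sum_ne_zero (by simpa using hj)
  · intro h0
    exact hA.sum_ne_zero _ hi _ hi _ hj (by rw [← add_smul, ← add_smul, h0, zero_smul])
  · intro h0
    exact hA.sum_ne_zero _ hi _ hj _ hj (by rw [← add_smul, ← add_smul, h0, zero_smul])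

/-- The points of `A` on the line `i c + ⟨v⟩`. -/
def slice (A : Finset G) (c v : G) (i : ZMod 7) : Finset (ZMod 7) :=
  univ.filter (fun t => i • c + t • v ∈ A)

theorem mem_slice {c v : G} {i t : ZMod 7} : t ∈ slice A c v i ↔ i • c + t • v ∈ A := by
  simp [slice]

theorem IsExtremal.sum_card_slice (hA : IsExtremal A) {c v : G} (h : Indep c v) :
    ∑ i ∈ univ.erase (0 : ZMod 7), (slice A c v i).card = 14 := by
  have h1 : ∑ u : ZMod 7, (univ.filter (fun i : ZMod 7 => i • (c + u • v) ∈ A)).card = 14 := by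
    rw [sum_congr rfl (fun u _ => hA.card_line (c + u • v) ?_)]
    · simp [ZMod.card]
    · intro h0
      have := (h 1 u (by rw [one_smul]; exact h0)).1
      exact absurd this (by decide)
  rw [← h1]
  have h2 : ∑ u : ZMod 7, (univ.filter (fun i : ZMod 7 => i • (c + u • v) ∈ A)).card =
      ∑ i : ZMod 7, (univ.filter (fun u : ZMod 7 => i • (c + u • v) ∈ A)).card := by
    simp only [card_filter]
    exact sum_comm
  rw [h2, ← add_sum_erase univ _ (mem_univ (0 : ZMod 7))]
  have h3 : (univ.filter (fun u : ZMod 7 => (0 : ZMod 7) • (c + u • v) ∈ A)).card = 0 := by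
    simp [zero_notMem hA.sum_ne_zero]
  rw [h3, zero_add]
  refine sum_congr rfl fun i hi => ?_
  have hi0 := ne_of_mem_erase hi
  symm
  refine card_bij (fun u _ => i * u) ?_ ?_ ?_
  · intro u hu
    have := (mem_filter.1 hu).2
    rw [mem_slice]
    rwa [smul_add, smul_smul] at this
  · intro u _ u' _ h; exact mul_left_cancel₀ hi0 h
  · intro t ht
    refine ⟨i⁻¹ * t, ?_, mul_inv_cancel_left₀ hi0 t⟩
    rw [mem_filter, smul_add, smul_smul, mul_inv_cancel_left₀ hi0]
    exact ⟨mem_univ _, mem_slice.1 ht⟩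

/-- `A` contains the two lines `z + ⟨w⟩` and `2 z + ⟨w⟩`. -/
def ContainsLines (A : Finset G) (z w : G) : Prop :=
  ∀ t : ZMod 7, z + t • w ∈ A ∧ (2 : ZMod 7) • z + t • w ∈ A

theorem IsExtremal.card_slice_zero (hA : IsExtremal A) {c v : G} (h : Indep c v) :
    (slice A c v 0).card = 2 := by
  have hv : v ≠ 0 := by
    rintro rfl
    exact absurd (h 0 1 (by simp)).2 (by decide)
  rw [← hA.card_line v hv]
  simp [slice]

theorem IsExtremal.card_slice_add_le (hA : IsExtremal A) (c v : G) {i j k : ZMod 7}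
    (hijk : i + j + k = 0) :
    (slice A c v i).card = 0 ∨ (slice A c v j).card = 0 ∨ (slice A c v k).card = 0 ∨
      (slice A c v i).card + (slice A c v j).card + (slice A c v k).card ≤ 8 := by
  by_contra hcon
  push Not at hcon
  obtain ⟨h1, h2, h3, h4⟩ := hcon
  refine absurd (card_add_card_add_card_le (card_ne_zero.1 h1) (card_ne_zero.1 h2)
    (card_ne_zero.1 h3) ?_) (by omega)
  intro s hs t ht u hu h0
  refine hA.sum_ne_zero _ (mem_slice.1 hs) _ (mem_slice.1 ht) _ (mem_slice.1 hu) ?_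
  have : i • c + s • v + (j • c + t • v) + (k • c + u • v) =
      (i + j + k) • c + (s + t + u) • v := by module
  rw [this, hijk, h0, zero_smul, zero_smul, add_zero]

theorem mem_of_card_slice_eq {c v : G} {i : ZMod 7} (h : (slice A c v i).card = 7) (t : ZMod 7) :
    i • c + t • v ∈ A := by
  have : slice A c v i = univ := by rw [← card_eq_iff_eq_univ, h, ZMod.card]
  exact mem_slice.1 (this ▸ mem_univ t)

/-- A line off `0` with at least four points of `A` forces two full lines parallel to it: this is
what the Cauchy-Davenport inequalities between the parallel lines leave. -/
theorem IsExtremal.containsLines_of_four_le (hA : IsExtremal A) {c v : G} (h : Indep c v)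
    (h4 : 4 ≤ (slice A c v 1).card) :
    ContainsLines A c v ∨ ContainsLines A ((4 : ZMod 7) • c) v := by
  have hs := hA.sum_card_slice h
  have h0 := hA.card_slice_zero h
  have hle : ∀ i, (slice A c v i).card ≤ 7 := fun i => (card_le_univ _).trans (by rw [ZMod.card])
  have hs' : (slice A c v 1).card + (slice A c v 2).card + (slice A c v 3).card +
      (slice A c v 4).card + (slice A c v 5).card + (slice A c v 6).card = 14 := by
    rw [← hs, show univ.erase (0 : ZMod 7) = {1, 2, 3, 4, 5, 6} by decide]
    rw [sum_insert (by decide), sum_insert (by decide), sum_insert (by decide),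
      sum_insert (by decide), sum_insert (by decide), sum_singleton]
    omega
  have k115 := hA.card_slice_add_le c v (show (1 : ZMod 7) + 1 + 5 = 0 by decide)
  have k223 := hA.card_slice_add_le c v (show (2 : ZMod 7) + 2 + 3 = 0 by decide)
  have k331 := hA.card_slice_add_le c v (show (3 : ZMod 7) + 3 + 1 = 0 by decide)
  have k124 := hA.card_slice_add_le c v (show (1 : ZMod 7) + 2 + 4 = 0 by decide)
  have k016 := hA.card_slice_add_le c v (show (0 : ZMod 7) + 1 + 6 = 0 by decide)
  have k034 := hA.card_slice_add_le c v (show (0 : ZMod 7) + 3 + 4 = 0 by decide)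
  have h1 := hle 1
  have h2 := hle 2
  have h4' := hle 4
  have key : (slice A c v 1).card = 7 ∧ (slice A c v 2).card = 7 ∨
      (slice A c v 1).card = 7 ∧ (slice A c v 4).card = 7 := by
    generalize (slice A c v 0).card = s0 at *
    generalize (slice A c v 1).card = s1 at *
    generalize (slice A c v 2).card = s2 at *
    generalize (slice A c v 3).card = s3 at *
    generalize (slice A c v 4).card = s4 at *
    generalize (slice A c v 5).card = s5 at *
    generalize (slice A c v 6).card = s6 at *
    have e5 : s5 = 0 := by omega
    subst e5
    subst h0
    interval_cases s1 <;> omega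
  rcases key with ⟨k1, k2⟩ | ⟨k1, k4⟩
  · refine Or.inl fun t => ⟨?_, mem_of_card_slice_eq k2 t⟩
    have := mem_of_card_slice_eq k1 t
    rwa [one_smul] at this
  · refine Or.inr fun t => ⟨mem_of_card_slice_eq k4 t, ?_⟩
    have := mem_of_card_slice_eq k1 t
    rwa [smul_smul, show (2 : ZMod 7) * 4 = 1 by decide]

/-- In every plane some line off `0` has at least four points of `A`: otherwise, counting along
the lines through a point of `A`, all lines off `0` would have `0` or `3` points. -/
theorem IsExtremal.exists_four_le (hA : IsExtremal A) {c v : G} (h : Indep c v) :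
    ∃ z w : G, z ∈ Submodule.span (ZMod 7) {c, v} ∧ w ∈ Submodule.span (ZMod 7) {c, v} ∧
      Indep z w ∧ 4 ≤ (slice A z w 1).card := by
  by_contra hcon
  push Not at hcon
  have hc : c ∈ Submodule.span (ZMod 7) {c, v} := Submodule.subset_span (by simp)
  have hv : v ∈ Submodule.span (ZMod 7) {c, v} := Submodule.subset_span (by simp)
  have h3 : ∀ i : ZMod 7, i ≠ 0 → 3 ∣ (slice A c v i).card := by
    intro i hi
    rcases (slice A c v i).eq_empty_or_nonempty with he | ⟨t, ht⟩
    · rw [he]; simp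
    set z := i • c + t • v with hz
    have hzA : z ∈ A := mem_slice.1 ht
    have hzP : z ∈ Submodule.span (ZMod 7) {c, v} :=
      Submodule.add_mem _ (Submodule.smul_mem _ _ hc) (Submodule.smul_mem _ _ hv)
    have hzv : Indep z v := by
      intro a b hab
      have := h (a * i) (a * t + b) (by rw [← hab, hz]; module)
      have ha : a = 0 := (mul_eq_zero.1 this.1).resolve_right hi
      subst ha
      simpa using this.2
    have hind : ∀ u : ZMod 7, Indep z (v + u • z) := by
      intro u a b hab
      have := hzv (a + b * u) b (by rw [← hab]; module)
      have hb := this.2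
      subst hb
      simpa using this.1
    have hle : ∀ u ∈ (univ : Finset (ZMod 7)), (slice A z (v + u • z) 1).card ≤ 3 := by
      intro u _
      have := hcon z (v + u • z) hzP
        (Submodule.add_mem _ hv (Submodule.smul_mem _ _ hzP)) (hind u)
      omega
    have hsum : ∑ u : ZMod 7, (slice A z (v + u • z) 1).card = ∑ _u : ZMod 7, 3 := by
      have e1 : ∑ u : ZMod 7, (slice A z (v + u • z) 1).card = ∑ s : ZMod 7,
          (univ.filter (fun u : ZMod 7 => (1 : ZMod 7) • z + s • (v + u • z) ∈ A)).card := by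
        simp only [slice, card_filter]
        exact sum_comm
      have e2 : (univ.filter
          (fun u : ZMod 7 => (1 : ZMod 7) • z + (0 : ZMod 7) • (v + u • z) ∈ A)).card = 7 := by
        rw [filter_true_of_mem, card_univ, ZMod.card]
        intro u _
        rwa [zero_smul, add_zero, one_smul]
      rw [e1, ← add_sum_erase univ _ (mem_univ (0 : ZMod 7)), e2]
      have e3 := hA.sum_card_slice hzv.symm
      have e4 : ∀ s ∈ univ.erase (0 : ZMod 7),
          (univ.filter (fun u : ZMod 7 => (1 : ZMod 7) • z + s • (v + u • z) ∈ A)).card =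
          (slice A v z s).card := by
        intro s hs
        have hs0 := ne_of_mem_erase hs
        refine card_bij (fun u _ => 1 + s * u) ?_ ?_ ?_
        · intro u hu
          rw [mem_slice]
          convert (mem_filter.1 hu).2 using 1
          module
        · intro u _ u' _ huu
          exact mul_left_cancel₀ hs0 (add_left_cancel huu)
        · intro r hr
          refine ⟨s⁻¹ * (r - 1), ?_, ?_⟩
          · rw [mem_filter]
            refine ⟨mem_univ _, ?_⟩
            rw [show (1 : ZMod 7) • z + s • (v + (s⁻¹ * (r - 1)) • z) =
              s • v + (1 + s * (s⁻¹ * (r - 1))) • z by module, mul_inv_cancel_left₀ hs0,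
              add_sub_cancel]
            exact mem_slice.1 hr
          · rw [mul_inv_cancel_left₀ hs0]; ring
      rw [sum_congr rfl e4, e3]
      simp [ZMod.card]
    have h0 := (sum_eq_sum_iff_of_le hle).1 hsum 0 (mem_univ _)
    rw [zero_smul, add_zero] at h0
    have : (slice A c v i).card = (slice A z v 1).card := by
      refine card_bij (fun r _ => r - t) ?_ ?_ ?_
      · intro r hr
        rw [mem_slice] at hr ⊢
        convert hr using 1
        rw [hz]; module
      · intro r _ r' _ hrr
        exact sub_left_injective hrr
      · intro r hr
        refine ⟨r + t, ?_, by ring⟩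
        rw [mem_slice] at hr ⊢
        convert hr using 1
        rw [hz]; module
    rw [this, h0]
  have h14 := hA.sum_card_slice h
  have : 3 ∣ ∑ i ∈ univ.erase (0 : ZMod 7), (slice A c v i).card :=
    dvd_sum (fun i hi => h3 i (ne_of_mem_erase hi))
  rw [h14] at this
  exact absurd this (by norm_num)

theorem IsExtremal.exists_containsLines (hA : IsExtremal A) {c v : G} (h : Indep c v) :
    ∃ z w : G, z ∈ Submodule.span (ZMod 7) {c, v} ∧ w ∈ Submodule.span (ZMod 7) {c, v} ∧
      Indep z w ∧ ContainsLines A z w := by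
  obtain ⟨z, w, hz, hw, hzw, h4⟩ := hA.exists_four_le h
  rcases hA.containsLines_of_four_le hzw h4 with h5 | h5
  · exact ⟨z, w, hz, hw, hzw, h5⟩
  · refine ⟨(4 : ZMod 7) • z, w, Submodule.smul_mem _ _ hz, hw, ?_, h5⟩
    intro i j hij
    rw [smul_smul] at hij
    have := hzw _ _ hij
    exact ⟨(mul_eq_zero.1 this.1).resolve_right (by decide), this.2⟩

/-- If `A` contains `z + ⟨w⟩` and `2z + ⟨w⟩`, then within the plane and off `⟨w⟩` it contains
nothing else; so there it is `w`-periodic. -/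
theorem IsExtremal.add_smul_mem (hA : IsExtremal A) {z w : G} {i j : ZMod 7}
    (hzw : ContainsLines A z w) (hi : i ≠ 0) (hg : z + (i⁻¹ * j) • w ≠ 0)
    (hx : i • z + j • w ∈ A) (t : ZMod 7) : i • z + j • w + t • w ∈ A := by
  obtain ⟨a, b, hab, ha, hb, hk, -⟩ := hA.exists_pair hg
  have h1 := hk 1 (by rw [one_smul]; exact (hzw _).1)
  have h2 := hk 2 (by rw [smul_add, smul_smul]; exact (hzw _).2)
  have h3 := hk i (by rwa [smul_add, smul_smul, mul_inv_cancel_left₀ hi])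
  have h12 : i = 1 ∨ i = 2 := by
    clear hk ha hb hx hg
    revert a b i
    decide
  rcases h12 with rfl | rfl
  · rw [one_smul, add_assoc, ← add_smul]; exact (hzw _).1
  · rw [add_assoc, ← add_smul]; exact (hzw _).2

end ElementarySeven

/-! ### Elementary abelian 7-groups: bottom lines -/

section BottomLine

variable [Module (ZMod 7) G]

theorem seven_smul_eq_zero (g : G) : (7 : ZMod 7) • g = 0 := by
  rw [show (7 : ZMod 7) = 0 by decide, zero_smul]

variable [DecidableEq G] {A : Finset G}

/-- The possible pairs on a line avoiding the multipliers `5` and `6`. -/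
theorem IsExtremal.mem_or_four_smul_mem (hA : IsExtremal A) {g : G} (hg : g ≠ 0)
    (h5 : (5 : ZMod 7) • g ∉ A) (h6 : (6 : ZMod 7) • g ∉ A) :
    (g ∈ A ∧ (2 : ZMod 7) • g ∈ A ∧ (4 : ZMod 7) • g ∉ A) ∨
      ((4 : ZMod 7) • g ∈ A ∧ (g ∉ A → (2 : ZMod 7) • g ∉ A → (3 : ZMod 7) • g ∈ A)) := by
  obtain ⟨i, j, hij, hi, hj, hk, hi0, hj0, h1, h2⟩ := hA.exists_pair hg
  have key : ∀ i j : ZMod 7, i ≠ j → i ≠ 0 → j ≠ 0 → i + i + j ≠ 0 → i + j + j ≠ 0 →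
      i ≠ 5 → i ≠ 6 → j ≠ 5 → j ≠ 6 →
      ((i = 1 ∧ j = 2 ∨ i = 2 ∧ j = 1) ∨ (i = 4 ∧ (j = 1 ∨ j = 2 ∨ j = 3)) ∨
        (j = 4 ∧ (i = 1 ∨ i = 2 ∨ i = 3))) := by decide
  have hi5 : i ≠ 5 := by rintro rfl; exact h5 hi
  have hi6 : i ≠ 6 := by rintro rfl; exact h6 hi
  have hj5 : j ≠ 5 := by rintro rfl; exact h5 hj
  have hj6 : j ≠ 6 := by rintro rfl; exact h6 hj
  rcases key i j hij hi0 hj0 h1 h2 hi5 hi6 hj5 hj6 with h | ⟨rfl, h⟩ | ⟨rfl, h⟩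
  · left
    have h4 : (4 : ZMod 7) • g ∉ A := by
      intro h4
      have := hk 4 h4
      rcases h with ⟨rfl, rfl⟩ | ⟨rfl, rfl⟩ <;> exact absurd this (by decide)
    rcases h with ⟨rfl, rfl⟩ | ⟨rfl, rfl⟩ <;> rw [one_smul] at *
    · exact ⟨hi, hj, h4⟩
    · exact ⟨hj, hi, h4⟩
  · right
    refine ⟨hi, fun n1 n2 => ?_⟩
    rcases h with rfl | rfl | rfl
    · rw [one_smul] at hj; exact absurd hj n1
    · exact absurd hj n2
    · exact hj
  · right
    refine ⟨hj, fun n1 n2 => ?_⟩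
    rcases h with rfl | rfl | rfl
    · rw [one_smul] at hi; exact absurd hi n1
    · exact absurd hi n2
    · exact hi

/-- Two pairs of parallel lines, in the directions `w` and `d`, propagate to a pair of parallel
planes. -/
theorem IsExtremal.smul_mem_of_containsLines (hA : IsExtremal A) {c d w : G}
    (hd : ContainsLines A d w) (hc : ContainsLines A c d)
    (hind : ∀ α β : ZMod 7, c + α • d + β • w ≠ 0) (α β : ZMod 7) :
    c + α • d + β • w ∈ A ∧ (2 : ZMod 7) • (c + α • d + β • w) ∈ A ∧
      (4 : ZMod 7) • (c + α • d + β • w) ∉ A := by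
  have h5 : ∀ α β : ZMod 7, (5 : ZMod 7) • (c + α • d + β • w) ∉ A := by
    intro α β h
    refine hA.sum_ne_zero _ (hc (2 * α - 1)).2 _ (hd (2 * β)).1 _ h ?_
    rw [← seven_smul_eq_zero (c + α • d + β • w)]
    module
  have h6 : ∀ α β : ZMod 7, (6 : ZMod 7) • (c + α • d + β • w) ∉ A := by
    intro α β h
    refine hA.sum_ne_zero _ (hc (α - 1)).1 _ (hd β).1 _ h ?_
    rw [← seven_smul_eq_zero (c + α • d + β • w)]
    module
  have hdich := fun α β => hA.mem_or_four_smul_mem (hind α β) (h5 α β) (h6 α β)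
  set Q : ZMod 7 → Prop := fun β => ∃ α : ZMod 7, (4 : ZMod 7) • (c + α • d + β • w) ∈ A with hQ
  have hR : ∀ β, Q β → ∀ α : ZMod 7, c + α • d + (3 * β) • w ∉ A ∧
      (2 : ZMod 7) • c + α • d + (3 * β) • w ∉ A := by
    rintro β ⟨α, hα⟩ α'
    refine ⟨fun h => hA.sum_ne_zero _ hα _ h _ (hc (-(4 * α + α'))).2 ?_,
      fun h => hA.sum_ne_zero _ hα _ h _ (hc (-(4 * α + α'))).1 ?_⟩ <;>
    · rw [← seven_smul_eq_zero (c + β • w)]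
      module
  have hQ3 : ∀ β, Q β → Q (3 * β) := by
    intro β h
    rcases hdich 0 (3 * β) with h1 | h1
    · exact absurd h1.1 (hR β h 0).1
    · exact ⟨0, h1.1⟩
  have hno : ∀ β, β ≠ 0 → ¬ Q β := by
    intro β hβ h
    have hall : ∀ γ, γ ≠ 0 → Q γ := by
      intro γ hγ
      -- `3` is a primitive root modulo `7`
      have hpow : ∀ β γ : ZMod 7, β ≠ 0 → γ ≠ 0 → γ = β ∨ γ = 3 * β ∨ γ = 3 * (3 * β) ∨
          γ = 3 * (3 * (3 * β)) ∨ γ = 3 * (3 * (3 * (3 * β))) ∨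
          γ = 3 * (3 * (3 * (3 * (3 * β)))) := by decide
      have q1 := hQ3 _ h
      have q2 := hQ3 _ q1
      have q3 := hQ3 _ q2
      have q4 := hQ3 _ q3
      have q5 := hQ3 _ q4
      rcases hpow β γ hβ hγ with e | e | e | e | e | e <;> rw [e] <;> assumption
    have hdiv : ∀ γ : ZMod 7, γ ≠ 0 → ∃ δ, δ ≠ 0 ∧ γ = 3 * δ := by decide
    have hR' : ∀ γ : ZMod 7, γ ≠ 0 → ∀ α : ZMod 7, c + α • d + γ • w ∉ A ∧
        (2 : ZMod 7) • c + α • d + γ • w ∉ A := by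
      intro γ hγ
      obtain ⟨δ, hδ, rfl⟩ := hdiv γ hγ
      exact hR δ (hall δ hδ)
    have h3 : ∀ γ : ZMod 7, γ ≠ 0 → (3 : ZMod 7) • (c + (0 : ZMod 7) • d + γ • w) ∈ A := by
      intro γ hγ
      rcases hdich 0 γ with h1 | h1
      · exact absurd h1.1 (hR' γ hγ 0).1
      · refine h1.2 (hR' γ hγ 0).1 ?_
        have h2 := (hR' (2 * γ) (mul_ne_zero (by decide) hγ) 0).2
        rwa [show (2 : ZMod 7) • (c + (0 : ZMod 7) • d + γ • w) =
          (2 : ZMod 7) • c + (0 : ZMod 7) • d + (2 * γ) • w by module]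
    refine hA.sum_ne_zero _ (h3 1 (by decide)) _ (h3 (-1) (by decide)) _ (hc 0).1 ?_
    rw [← seven_smul_eq_zero c]
    module
  rcases hdich α β with h1 | h1
  · exact h1
  · exfalso
    by_cases hβ : β = 0
    · subst hβ
      obtain ⟨i, j, hij, -, -, hk, -⟩ := hA.exists_pair (hind α 0)
      have k1 := hk 1 (by rw [one_smul, zero_smul, add_zero]; exact (hc α).1)
      have k2 := hk 2 (by
        have := (hc (2 * α)).2
        rwa [show (2 : ZMod 7) • (c + α • d + (0 : ZMod 7) • w) =
          (2 : ZMod 7) • c + (2 * α) • d by module])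
      have k4 := hk 4 h1.1
      clear hk
      revert i j
      decide
    · exact hno β hβ ⟨α, h1.1⟩

/-- `⟨v⟩` is a bottom line of `A` in the subspace `V`: off `⟨v⟩`, the part of `A` in `V` is
periodic modulo `v`. -/
structure IsBottom (A : Finset G) (V : Submodule (ZMod 7) G) (v : G) : Prop where
  ne_zero : v ≠ 0
  mem : v ∈ V
  add_smul_mem : ∀ x ∈ V, x ∈ A → x ∉ Submodule.span (ZMod 7) {v} → ∀ t : ZMod 7, x + t • v ∈ A

/-- If the bottom line `⟨v⟩` of `V` is not a bottom line of the whole space, then some plane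
through it contains two lines of `A` parallel to a line leaving `V`. -/
theorem IsBottom.exists_containsLines (hA : IsExtremal A) {V : Submodule (ZMod 7) G} {v : G}
    (hV : IsBottom A V v) (hv : ¬ IsBottom A ⊤ v) :
    ∃ (k : ZMod 7) (w : G), k ≠ 0 ∧ w ∉ V ∧ ContainsLines A (k • v) w := by
  have : ∃ x ∈ A, x ∉ Submodule.span (ZMod 7) {v} ∧ ∃ t : ZMod 7, x + t • v ∉ A := by
    by_contra hcon
    push Not at hcon
    exact hv ⟨hV.ne_zero, Submodule.mem_top, fun x _ hx hxv t => hcon x hx hxv t⟩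
  obtain ⟨x, hx, hxv, t, ht⟩ := this
  have hxV : x ∉ V := fun h => ht (hV.add_smul_mem x h hx hxv t)
  have hxv' : ∀ i j : ZMod 7, i • x + j • v ∈ V → i = 0 := by
    intro i j h
    by_contra hi
    have h1 : i • x ∈ V := (Submodule.add_mem_iff_left _ (V.smul_mem j hV.mem)).1 h
    exact hxV ((Submodule.smul_mem_iff _ hi).1 h1)
  have hind : Indep x v := by
    intro i j h
    have hi := hxv' i j (h ▸ V.zero_mem)
    subst hi
    rw [zero_smul, zero_add] at h
    exact ⟨rfl, (smul_eq_zero.1 h).resolve_right hV.ne_zero⟩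
  obtain ⟨z, w, hz, hw, hzw, hlines⟩ := hA.exists_containsLines hind
  obtain ⟨a, b, hz⟩ := Submodule.mem_span_pair.1 hz
  obtain ⟨a', b', hw⟩ := Submodule.mem_span_pair.1 hw
  have hD : a * b' - a' * b ≠ 0 := by
    intro hD
    have h1 := hzw (-a') a (by
      rw [← hz, ← hw, show -a' • (a • x + b • v) + a • (a' • x + b' • v) =
        (a * b' - a' * b) • v by module, hD, zero_smul])
    have h2 := hzw b' (-b) (by
      rw [← hz, ← hw, show b' • (a • x + b • v) + -b • (a' • x + b' • v) =
        (a * b' - a' * b) • x by module, hD, zero_smul])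
    have hz0 : z = 0 := by
      rw [← hz, h1.2, neg_eq_zero.1 h2.2, zero_smul, zero_smul, add_zero]
    exact absurd (hzw 1 0 (by rw [hz0]; simp)).1 (by decide)
  have ha' : a' ≠ 0 := by
    rintro rfl
    have hab : a * b' ≠ 0 := by simpa using hD
    have ha := left_ne_zero_of_mul hab
    have hb := right_ne_zero_of_mul hab
    have hx' : x = a⁻¹ • z + (-(a⁻¹ * b * b'⁻¹)) • w := by
      rw [← hz, ← hw]
      have e1 : a⁻¹ * a = 1 := inv_mul_cancel₀ ha
      have e2 : b'⁻¹ * b' = 1 := inv_mul_cancel₀ hb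
      calc x = (1 : ZMod 7) • x + (a⁻¹ * b - a⁻¹ * b * 1) • v := by module
        _ = (a⁻¹ * a) • x + (a⁻¹ * b - a⁻¹ * b * (b'⁻¹ * b')) • v := by rw [e1, e2]
        _ = _ := by module
    have h1 := hA.add_smul_mem hlines (inv_ne_zero ha) (fun h0 =>
      absurd (hzw 1 _ (by rw [one_smul]; exact h0)).1 (by decide)) (hx' ▸ hx) (t * b'⁻¹)
    rw [← hx', ← hw] at h1
    apply ht
    rwa [show (t * b'⁻¹) • ((0 : ZMod 7) • x + b' • v) = (t * (b'⁻¹ * b')) • v by module,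
      inv_mul_cancel₀ hb, mul_one] at h1
  -- `v = α z + β w` with `α = -a' / D`
  refine ⟨-(a * b' - a' * b) * a'⁻¹, w, mul_ne_zero (neg_ne_zero.2 hD) (inv_ne_zero ha'),
    fun h => ha' (hxv' a' b' (hw ▸ h)), ?_⟩
  have hd : (-(a * b' - a' * b) * a'⁻¹) • v = z + (-(a * a'⁻¹)) • w := by
    rw [← hz, ← hw]
    have e1 : a' * a'⁻¹ = 1 := mul_inv_cancel₀ ha'
    calc (-(a * b' - a' * b) * a'⁻¹) • v = (-(a * b') * a'⁻¹ + b * (a' * a'⁻¹)) • v +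
          (a - a * 1) • x := by module
      _ = (-(a * b') * a'⁻¹ + b * 1) • v + (a - a * (a' * a'⁻¹)) • x := by rw [e1]
      _ = _ := by module
  intro s
  rw [hd]
  constructor
  · have := (hlines (-(a * a'⁻¹) + s)).1
    rwa [add_smul, ← add_assoc] at this
  · have := (hlines (2 * (-(a * a'⁻¹)) + s)).2
    rwa [add_smul, mul_smul, ← add_assoc, ← smul_add] at this

/-- The direction `w` of the two lines of `A` leaving `V` becomes the bottom line of the enlarged
space: the lines of `A` parallel to `v` combine with them to planes. -/
theorem IsBottom.sup_span (hA : IsExtremal A) {V : Submodule (ZMod 7) G} {v w : G}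
    (hV : IsBottom A V v) {k : ZMod 7} (hk : k ≠ 0) (hw : w ∉ V)
    (hlines : ContainsLines A (k • v) w) : IsBottom A (V ⊔ Submodule.span (ZMod 7) {w}) w := by
  have hw' : ∀ x ∈ V, ∀ β : ZMod 7, x + β • w = 0 → β = 0 ∧ x = 0 := by
    intro x hx β h
    have hβ : β = 0 := by
      by_contra hβ
      refine hw ((Submodule.smul_mem_iff _ hβ).1 ?_)
      rw [← neg_eq_of_add_eq_zero_right h]
      exact V.neg_mem hx
    subst hβ
    rw [zero_smul, add_zero] at h
    exact ⟨rfl, h⟩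
  have hkv : k • v ∈ V := V.smul_mem _ hV.mem
  refine ⟨fun h => hw (h ▸ V.zero_mem), Submodule.mem_sup_right (Submodule.mem_span_singleton_self w),
    ?_⟩
  intro x hx hxA hxw t
  obtain ⟨y, hy, y', hy', rfl⟩ := Submodule.mem_sup.1 hx
  obtain ⟨s, rfl⟩ := Submodule.mem_span_singleton.1 hy'
  by_cases hyv : y ∈ Submodule.span (ZMod 7) {v}
  · obtain ⟨i, rfl⟩ := Submodule.mem_span_singleton.1 hyv
    have hi : i * k⁻¹ ≠ 0 := by
      refine mul_ne_zero ?_ (inv_ne_zero hk)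
      rintro rfl
      apply hxw
      rw [zero_smul, zero_add]
      exact hy'
    have e : i • v = (i * k⁻¹) • k • v := by
      rw [smul_smul, inv_mul_cancel_right₀ hk]
    rw [e] at hxA ⊢
    refine hA.add_smul_mem hlines hi (fun h0 => ?_) hxA t
    exact (smul_ne_zero hk hV.ne_zero) (hw' _ hkv _ h0).2
  · have hy0 : y ≠ 0 := fun h => hyv (h ▸ Submodule.zero_mem _)
    have hsm : ∀ m : ZMod 7, m ≠ 0 → m • y ∉ Submodule.span (ZMod 7) {v} := by
      intro m hm h
      exact hyv ((Submodule.smul_mem_iff _ hm).1 h)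
    obtain ⟨i, j, hij, hi, hj, -, hi0, hj0, h1, h2⟩ := hA.exists_pair hy0
    obtain ⟨e, -, -, he, -⟩ := hA.exists_pair hV.ne_zero
    have hper : ∀ m : ZMod 7, m ≠ 0 → m • y ∈ A → ∀ t : ZMod 7, m • y + t • v ∈ A :=
      fun m hm h t => hV.add_smul_mem _ (V.smul_mem m hy) h (hsm m hm) t
    have hcases : ∀ i j : ZMod 7, i ≠ j ∧ i ≠ 0 ∧ j ≠ 0 ∧ i + i + j ≠ 0 ∧ i + j + j ≠ 0 →
        j = 2 * i ∨ i = 2 * j ∨ i + j = 0 := by decide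
    have hm : ∃ m : ZMod 7, m ≠ 0 ∧ m • y ∈ A ∧ (2 * m) • y ∈ A := by
      rcases hcases i j ⟨hij, hi0, hj0, h1, h2⟩ with rfl | rfl | h
      · exact ⟨i, hi0, hi, hj⟩
      · exact ⟨j, hj0, hj, hi⟩
      · exfalso
        refine hA.sum_ne_zero _ hi _ (hper j hj0 hj (-e)) _ he ?_
        rw [show i • y + (j • y + -e • v) + e • v = (i + j) • y by module, h, zero_smul]
    obtain ⟨m, hm0, hm1, hm2⟩ := hm
    have hc : ContainsLines A (m • y) (k • v) := by
      intro t
      rw [smul_smul, smul_smul]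
      exact ⟨hper _ hm0 hm1 _, hper _ (mul_ne_zero (by decide) hm0) hm2 _⟩
    have hplane := hA.smul_mem_of_containsLines hlines hc (by
      intro α β h0
      have := (hw' _ (V.add_mem (V.smul_mem m hy) (V.smul_mem α hkv)) β h0).2
      refine hsm m hm0 ?_
      rw [eq_neg_of_add_eq_zero_left this]
      exact Submodule.neg_mem _ (Submodule.smul_mem _ _ (Submodule.smul_mem _ _
        (Submodule.mem_span_singleton_self v))))
    have hg : m • y + (0 : ZMod 7) • k • v + (m * s) • w ≠ 0 := by
      intro h0
      have := (hplane 0 (m * s)).1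
      rw [h0] at this
      exact zero_notMem hA.sum_ne_zero this
    obtain ⟨a, b, hab, -, -, hk', -⟩ := hA.exists_pair hg
    have k1 := hk' 1 (by rw [one_smul]; exact (hplane 0 (m * s)).1)
    have k2 := hk' 2 (hplane 0 (m * s)).2.1
    have k3 := hk' m⁻¹ (by
      rw [show m⁻¹ • (m • y + (0 : ZMod 7) • k • v + (m * s) • w) =
        (m⁻¹ * m) • y + ((m⁻¹ * m) * s) • w by module, inv_mul_cancel₀ hm0, one_smul, one_mul]
      exact hxA)
    have hm12 : m⁻¹ = 1 ∨ m⁻¹ = 2 := by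
      generalize m⁻¹ = r at *
      clear hk' hg
      revert a b r
      decide
    have hfin : y + s • w + t • w = m⁻¹ • (m • y + (0 : ZMod 7) • k • v + (m * (s + t)) • w) := by
      rw [show m⁻¹ • (m • y + (0 : ZMod 7) • k • v + (m * (s + t)) • w) =
        (m⁻¹ * m) • y + ((m⁻¹ * m) * (s + t)) • w by module, inv_mul_cancel₀ hm0, one_smul,
        one_mul]
      module
    rw [hfin]
    rcases hm12 with h | h <;> rw [h]
    · rw [one_smul]; exact (hplane 0 _).1
    · exact (hplane 0 _).2.1

/-- A bottom line of a maximal subspace having one is a bottom line of the whole space. -/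
theorem IsExtremal.exists_isBottom [Finite G] [Nontrivial G] (hA : IsExtremal A) :
    ∃ v, IsBottom A ⊤ v := by
  obtain ⟨v, hv⟩ := exists_ne (0 : G)
  have hne : ({V | ∃ v, IsBottom A V v} : Set (Submodule (ZMod 7) G)).Nonempty :=
    ⟨Submodule.span (ZMod 7) {v}, v, hv, Submodule.mem_span_singleton_self v,
      fun x hx _ hx' => absurd hx hx'⟩
  obtain ⟨V, hV⟩ := (Set.toFinite _).exists_maximal hne
  obtain ⟨v, hVv⟩ := hV.prop
  refine ⟨v, ?_⟩
  by_contra hcon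
  obtain ⟨k, w, hk, hw, hl⟩ := hVv.exists_containsLines hA hcon
  have := hV.le_of_ge ⟨w, hVv.sup_span hA hk hw hl⟩ le_sup_left
  exact hw (this (Submodule.mem_sup_right (Submodule.mem_span_singleton_self w)))

/-- A sum in the bottom line `⟨v⟩` of the whole space uses only the two points of `A` on `⟨v⟩`: by
periodicity, a summand off `⟨v⟩` would turn it into a zero sum. Two points have at most four
threefold sums, so some nonzero multiple of `v` is missing. -/
theorem IsExtremal.exists_ne_zero_notMem [Finite G] [Nontrivial G] (hA : IsExtremal A) :
    ∃ x : G, x ≠ 0 ∧ x ∉ A + A + A := by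
  obtain ⟨v, hv⟩ := hA.exists_isBottom
  obtain ⟨i, j, -, -, -, hk, -⟩ := hA.exists_pair hv.ne_zero
  have hκ : ∀ i j : ZMod 7, ∃ κ : ZMod 7, κ ≠ 0 ∧ ∀ a b c : ZMod 7, (a = i ∨ a = j) →
      (b = i ∨ b = j) → (c = i ∨ c = j) → a + b + c ≠ κ := by
    have h : ∀ i j : ZMod 7, ∃ κ : ZMod 7, κ ≠ 0 ∧ i + i + i ≠ κ ∧ i + i + j ≠ κ ∧
      i + j + j ≠ κ ∧ j + j + j ≠ κ := by decide
    intro i j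
    obtain ⟨κ, h0, h1, h2, h3, h4⟩ := h i j
    refine ⟨κ, h0, ?_⟩
    rintro a b c (rfl | rfl) (rfl | rfl) (rfl | rfl) h <;> first
      | exact h1 h
      | exact h4 h
      | exact h2 (Eq.trans (by ring1) h)
      | exact h3 (Eq.trans (by ring1) h)
  obtain ⟨κ, hκ0, hκ⟩ := hκ i j
  refine ⟨κ • v, smul_ne_zero hκ0 hv.ne_zero, ?_⟩
  intro hmem
  obtain ⟨ab, hab, c, hc, h⟩ := mem_add.1 hmem
  obtain ⟨a, ha, b, hb, rfl⟩ := mem_add.1 hab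
  have hspan : ∀ a ∈ A, ∀ b ∈ A, ∀ c ∈ A, a + b + c = κ • v →
      a ∈ Submodule.span (ZMod 7) {v} := by
    intro a ha b hb c hc h
    by_contra hav
    have := hv.add_smul_mem a Submodule.mem_top ha hav (-κ)
    refine hA.sum_ne_zero _ this _ hb _ hc ?_
    rw [show a + -κ • v + b + c = (a + b + c) - κ • v by module, h, sub_self]
  obtain ⟨x, hx⟩ := Submodule.mem_span_singleton.1 (hspan a ha b hb c hc h)
  obtain ⟨y, hy⟩ := Submodule.mem_span_singleton.1 (hspan b hb c hc a ha (by rw [← h]; abel))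
  obtain ⟨z, hz⟩ := Submodule.mem_span_singleton.1 (hspan c hc a ha b hb (by rw [← h]; abel))
  refine hκ x y z (hk x (hx ▸ ha)) (hk y (hy ▸ hb)) (hk z (hz ▸ hc)) ?_
  rw [← hx, ← hy, ← hz, ← add_smul, ← add_smul] at h
  exact smul_left_injective _ hv.ne_zero h

end BottomLine

/-- In an elementary abelian `7`-group, the three-fold sumset of a set of size `(n - 1) / 3` cannot
miss exactly one element. -/
theorem card_add_one_ne [Fintype G] [DecidableEq G] [Nontrivial G] (h7 : ∀ g : G, 7 • g = 0)
    {A : Finset G} (hA : 3 * A.card + 1 = Nat.card G) :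
    (A + A + A).card + 1 ≠ Nat.card G := by
  intro hcard
  let _ : Module (ZMod 7) G := AddCommGroup.zmodModule h7
  have h1 : (A + A + A)ᶜ.card = 1 := by
    rw [card_compl, ← Nat.card_eq_fintype_card]
    omega
  obtain ⟨x, hx⟩ := card_eq_one.1 h1
  have hmem : ∀ y, y ∉ A + A + A → y = x := by
    intro y hy
    rw [← mem_singleton, ← hx, mem_compl]
    exact hy
  have hxA : x ∉ A + A + A := by
    rw [← mem_compl, hx, mem_singleton]
  -- translating by `y` with `3 y = x` moves the missing element to `0`
  set y := 5 • x with hy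
  have hyx : y + y + y = x := by
    have := h7 x
    rw [hy, show 5 • x + 5 • x + 5 • x = 2 • (7 • x) + x by module, this, smul_zero, zero_add]
  set B := A.image (fun a => a - y) with hB
  have hBmem : ∀ b, b ∈ B ↔ b + y ∈ A := by
    intro b
    rw [hB, mem_image]
    constructor
    · rintro ⟨a, ha, rfl⟩; rwa [sub_add_cancel]
    · intro h; exact ⟨_, h, add_sub_cancel_right _ _⟩
  have h0 : ∀ a ∈ B, ∀ b ∈ B, ∀ c ∈ B, a + b + c ≠ 0 := by
    intro a ha b hb c hc h
    apply hxA
    have := add_mem_add (add_mem_add ((hBmem a).1 ha) ((hBmem b).1 hb)) ((hBmem c).1 hc)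
    rwa [show a + y + (b + y) + (c + y) = (a + b + c) + (y + y + y) by abel, h, hyx,
      zero_add] at this
  have hBcard : B.card = A.card := card_image_of_injective _ sub_left_injective
  have hext : IsExtremal B := ⟨h0, fun g hg => card_filter_smul_eq h0 (by rw [hBcard, hA]) g hg⟩
  obtain ⟨z, hz, hzB⟩ := hext.exists_ne_zero_notMem
  apply hz
  have : z + x = x := by
    apply hmem
    intro h
    apply hzB
    obtain ⟨ab, hab, c, hc, h⟩ := mem_add.1 h
    obtain ⟨a, ha, b, hb, rfl⟩ := mem_add.1 hab
    have hsub : ∀ a ∈ A, a - y ∈ B := fun a ha => (hBmem _).2 (by rwa [sub_add_cancel])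
    have := add_mem_add (add_mem_add (hsub a ha) (hsub b hb)) (hsub c hc)
    rwa [show a - y + (b - y) + (c - y) = (a + b + c) - (y + y + y) by abel, h, hyx,
      add_sub_cancel_right] at this
  exact add_eq_right.1 this

/-! ### The critical number and the three cases -/

theorem hfold_three [DecidableEq G] (A : Finset G) : hfold 3 A = A + A + A := by
  ext x
  rw [mem_hfold]
  constructor
  · rintro ⟨a, ha, rfl⟩
    rw [Fin.sum_univ_three]
    exact add_mem_add (add_mem_add (ha 0) (ha 1)) (ha 2)
  · intro hx
    obtain ⟨ab, hab, c, hc, rfl⟩ := mem_add.1 hx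
    obtain ⟨a, ha, b, hb, rfl⟩ := mem_add.1 hab
    refine ⟨![a, b, c], ?_, by simp [Fin.sum_univ_three]⟩
    intro i
    fin_cases i <;> assumption

theorem hfold_three_ne_univ [Fintype G] [DecidableEq G] (A : Finset G) :
    hfold 3 A ≠ univ ↔ (A + A + A).card < Nat.card G := by
  rw [hfold_three, Nat.card_eq_fintype_card, Ne, ← card_eq_iff_eq_univ]
  have := card_le_univ (A + A + A)
  omega

/-- Once the greatest size of a `3`-incomplete set is known to be `k`, the critical number and
`S(G, 3)` are determined by the sets of that size. -/
theorem isGreatest_incompleteSizes [Fintype G] [DecidableEq G] {k : ℕ} (hk : 0 < k)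
    (hmax : ∀ A : Finset G, A.Nonempty → (A + A + A).card < Nat.card G → A.card ≤ k)
    {A₀ : Finset G} (hA₀ : A₀.card = k) (h₀ : (A₀ + A₀ + A₀).card < Nat.card G) :
    IsGreatest (incompleteSizes G 3) k ∧ criticalNumber G 3 = k + 1 ∧
      S G 3 = {s | ∃ A : Finset G, A.card = k ∧ (A + A + A).card < Nat.card G ∧
        (A + A + A).card = s} := by
  have hcrit : criticalNumber G 3 = k + 1 := by
    refine IsLeast.csInf_eq ⟨?_, ?_⟩
    · intro A hA
      by_contra hne
      have := hmax A (card_pos.1 (by omega)) ((hfold_three_ne_univ A).1 hne)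
      omega
    · intro m hm
      by_contra hlt
      exact (hfold_three_ne_univ A₀).2 h₀ (hm A₀ (by omega))
  refine ⟨⟨⟨A₀, ⟨card_pos.1 (by omega), (hfold_three_ne_univ A₀).2 h₀⟩, hA₀⟩, ?_⟩, hcrit, ?_⟩
  · rintro _ ⟨A, ⟨hA, hne⟩, rfl⟩
    exact hmax A hA ((hfold_three_ne_univ A).1 hne)
  · ext s
    simp only [S, hcrit, Set.mem_ofPred_eq, hfold_three_ne_univ, add_left_inj]
    simp only [hfold_three]

theorem dvd_exponent_of_prime [Finite G] {p : ℕ} (hp : p.Prime) (h : p ∣ Nat.card G) :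
    p ∣ AddMonoid.exponent G := by
  have := Fact.mk hp
  obtain ⟨x, hx⟩ := exists_prime_addOrderOf_dvd_card' p h
  rw [← hx]
  exact AddMonoid.addOrder_dvd_exponent x

section LeastPrime

variable [Finite G] [DecidableEq G] {p : ℕ}

/-- The size bound when `p` is the least prime divisor congruent to `2` modulo `3`, together with
the case of equality: a quotient of order `d ≡ 2` contributes `(d + 1) / (3 d)`, which is largest
for `d = p`, and every other quotient contributes at most `1 / 3`. -/
theorem card_mul_le_of_least_prime (hp : p.Prime)
    (hmin : ∀ q : ℕ, q.Prime → q ∣ Nat.card G → q % 3 = 2 → p ≤ q) {A : Finset G}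
    (hA : A.Nonempty) (h3 : (A + A + A).card < Nat.card G) :
    A.card * (3 * p) ≤ (p + 1) * Nat.card G ∧
      (A.card * (3 * p) = (p + 1) * Nat.card G →
        (A + A + A).card = Nat.card G - Nat.card G / p) := by
  classical
  have h3' := h3
  obtain ⟨H, B, hB, hAB, hA3, hper, hlt⟩ := exists_quotient hA (by convert h3')
  have hA3' : (A + A + A).card = Nat.card H * (B + B + B).card := by convert hA3
  have hn := AddSubgroup.card_eq_card_quotient_mul_card_addSubgroup H
  have hk := three_mul_card_le hB hper
  have hh : 0 < Nat.card H := Nat.card_pos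
  have hp0 := hp.pos
  rw [hA3', hn]
  generalize Nat.card (G ⧸ H) = d at *
  generalize Nat.card H = h at *
  generalize (B + B + B).card = s at *
  generalize B.card = k at *
  have key : 3 * k * p ≤ (p + 1) * d ∧ (3 * k * p = (p + 1) * d → d = p ∧ s + 1 = d) := by
    by_cases hd : d % 3 = 2
    · obtain ⟨q, hq, hqd, hq3⟩ := exists_prime_mod_three_eq_two hd
      have hpq := hmin q hq (hn ▸ hqd.mul_right h) hq3
      have hqd' := Nat.le_of_dvd (by omega) hqd
      have h1 : 3 * k * p ≤ (d + 1) * p := Nat.mul_le_mul_right _ (by omega)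
      refine ⟨by nlinarith, fun heq => ?_⟩
      have hdp : d = p := by nlinarith
      refine ⟨hdp, ?_⟩
      subst hdp
      have := Nat.eq_of_mul_eq_mul_right hp0 heq
      omega
    · have h1 : 3 * k * p ≤ d * p := Nat.mul_le_mul_right _ (by omega)
      have h2 : d * p < (p + 1) * d := by nlinarith
      exact ⟨by omega, fun heq => by omega⟩
  have h1 : A.card * (3 * p) ≤ h * (3 * k * p) := by
    calc A.card * (3 * p) ≤ h * k * (3 * p) := Nat.mul_le_mul_right _ hAB
      _ = h * (3 * k * p) := by ring
  have h2 : h * ((p + 1) * d) = (p + 1) * (d * h) := by ring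
  refine ⟨by rw [← h2]; exact h1.trans (Nat.mul_le_mul_left _ key.1), fun heq => ?_⟩
  obtain ⟨rfl, rfl⟩ := key.2
    (le_antisymm key.1 (Nat.le_of_mul_le_mul_left (by rw [h2, ← heq]; exact h1) hh))
  rw [Nat.mul_div_cancel_left _ hp0]
  rw [Nat.add_mul, one_mul, Nat.add_sub_cancel, mul_comm]

/-- The preimage of an interval of `(p + 1) / 3` elements under a surjection onto `ZMod p`. -/
theorem exists_card_mul_eq (hp : p.Prime) (hpn : p ∣ Nat.card G) (hp3 : p % 3 = 2) :
    ∃ A : Finset G, A.card * (3 * p) = (p + 1) * Nat.card G ∧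
      (A + A + A).card < Nat.card G := by
  obtain ⟨f, hf⟩ := exists_surjective_zmod (G := G) hp (a := 1)
    (by rw [pow_one]; exact dvd_exponent_of_prime hp hpn)
  have hp0 := hp.pos
  have hpow : p ^ 1 = p := pow_one p
  have : NeZero (p ^ 1) := ⟨by omega⟩
  obtain ⟨k, hk, hpre⟩ := exists_preimage f hf
  obtain ⟨I, hI, hI3⟩ := exists_interval_zmod (p ^ 1) ((p + 1) / 3) (by omega) (by omega)
  obtain ⟨A, hA, hA3⟩ := hpre I
  rw [Nat.card_zmod, hpow] at hk
  have hn : 0 < Nat.card G := Nat.card_pos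
  have hk0 : 0 < k := Nat.pos_of_ne_zero (by rintro rfl; omega)
  refine ⟨A, ?_, ?_⟩
  · rw [hA, hI, hk]
    calc k * ((p + 1) / 3) * (3 * p) = ((p + 1) / 3 * 3) * (p * k) := by ring
      _ = _ := by rw [Nat.div_mul_cancel (by omega)]
  · rw [hA3, hI3, hk, mul_comm p k]
    exact Nat.mul_lt_mul_of_pos_left (by omega) hk0

end LeastPrime

section DivisibleByThree

variable [Finite G] [DecidableEq G]

/-- Without prime divisors congruent to `2` modulo `3`, an incomplete set has at most `n / 3` elements;
with `d` the order of the quotient by the period, equality leaves only two sizes for `3A`, since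
in the quotient one or two elements are missing. -/
theorem three_mul_card_le_card (hq : ∀ q : ℕ, q.Prime → q ∣ Nat.card G → q % 3 ≠ 2)
    {A : Finset G} (hA : A.Nonempty) (h3 : (A + A + A).card < Nat.card G) :
    3 * A.card ≤ Nat.card G ∧ (3 * A.card = Nat.card G →
      (∃ d : ℕ, d ∣ Nat.card G ∧ 3 ∣ d ∧ d ≠ 3 ∧
        (A + A + A).card = Nat.card G - Nat.card G / d) ∨
      (∃ d : ℕ, d ∣ Nat.card G ∧ 1 ≤ padicValNat 3 d ∧
        padicValNat 3 d ≤ padicValNat 3 (AddMonoid.exponent G) ∧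
        (A + A + A).card = Nat.card G - 2 * Nat.card G / d)) := by
  classical
  have h3' := h3
  obtain ⟨H, B, hB, hAB, hA3, hper, hlt⟩ := exists_quotient hA (by convert h3')
  have hA3' : (A + A + A).card = Nat.card H * (B + B + B).card := by convert hA3
  have hn := AddSubgroup.card_eq_card_quotient_mul_card_addSubgroup H
  have hk := three_mul_card_le hB hper
  have hh : 0 < Nat.card H := Nat.card_pos
  have hqd : ∀ q : ℕ, q.Prime → q ∣ Nat.card (G ⧸ H) → q % 3 ≠ 2 :=
    fun q h1 h2 => hq q h1 (hn ▸ h2.mul_right _)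
  have hd2 : Nat.card (G ⧸ H) % 3 ≠ 2 := by
    intro h
    obtain ⟨q, h1, h2, h3⟩ := exists_prime_mod_three_eq_two h
    exact hqd q h1 h2 h3
  have hkd : 3 * B.card ≤ Nat.card (G ⧸ H) := by omega
  have h1 : 3 * A.card ≤ Nat.card H * (3 * B.card) := by
    calc 3 * A.card ≤ 3 * (Nat.card H * B.card) := Nat.mul_le_mul_left _ hAB
      _ = _ := by ring
  have hn' : Nat.card G = Nat.card H * Nat.card (G ⧸ H) := by rw [hn, mul_comm]
  refine ⟨?_, fun heq => ?_⟩
  · rw [hn']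
    exact h1.trans (Nat.mul_le_mul_left _ hkd)
  have hkd' : 3 * B.card = Nat.card (G ⧸ H) :=
    le_antisymm hkd (Nat.le_of_mul_le_mul_left (by rw [← hn', ← heq]; exact h1) hh)
  have hdvd : Nat.card (G ⧸ H) ∣ Nat.card G := ⟨_, hn⟩
  have hd0 : 0 < Nat.card (G ⧸ H) := Nat.card_pos
  have h3d : 3 ∣ Nat.card (G ⧸ H) := ⟨_, hkd'.symm⟩
  rcases (by omega : (B + B + B).card + 1 = Nat.card (G ⧸ H) ∨
    (B + B + B).card + 2 = Nat.card (G ⧸ H)) with hs | hs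
  · left
    refine ⟨Nat.card (G ⧸ H), hdvd, h3d, ?_, ?_⟩
    · intro h
      obtain ⟨b, rfl⟩ := card_eq_one.1 (by omega : B.card = 1)
      rw [singleton_add_singleton, singleton_add_singleton, card_singleton] at hs
      omega
    · rw [hA3', hn', Nat.mul_div_cancel _ hd0, ← hs, mul_add, mul_one, Nat.add_sub_cancel]
  · right
    obtain ⟨t, ht⟩ := exists_padicValNat_addOrderOf_eq hper hkd' hs hqd
    refine ⟨Nat.card (G ⧸ H), hdvd, ?_, ?_, ?_⟩
    · exact one_le_padicValNat_of_dvd hd0.ne' h3d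
    · rw [ht]
      have hexp : addOrderOf t ∣ AddMonoid.exponent G :=
        (AddMonoid.addOrder_dvd_exponent t).trans
          (AddMonoidHom.exponent_dvd (f := QuotientAddGroup.mk' H)
            (QuotientAddGroup.mk'_surjective H))
      exact (padicValNat_dvd_iff_le AddMonoid.exponent_ne_zero_of_finite).1
        (pow_padicValNat_dvd.trans hexp)
    · rw [hA3', hn', ← mul_assoc, Nat.mul_div_cancel _ hd0, ← hs, mul_add]
      omega

theorem exists_card_eq_sub_div (hq : ∀ q : ℕ, q.Prime → q ∣ Nat.card G → q % 3 ≠ 2) {d : ℕ}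
    (hd : d ∣ Nat.card G) (h3 : 3 ∣ d) (hd3 : d ≠ 3) :
    ∃ A : Finset G, 3 * A.card = Nat.card G ∧
      (A + A + A).card = Nat.card G - Nat.card G / d ∧ (A + A + A).card < Nat.card G := by
  have hn : 0 < Nat.card G := Nat.card_pos
  have hd0 : 0 < d := Nat.pos_of_dvd_of_pos hd hn
  obtain ⟨m, hm⟩ := h3.trans hd
  obtain ⟨M, hM⟩ := exists_addSubgroup_card (G := G) m ⟨3, by omega⟩
  have hMi : M.index = 3 := by
    have := M.card_mul_index
    rw [hM, hm, mul_comm] at this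
    exact Nat.eq_of_mul_eq_mul_right (by omega) this
  obtain ⟨e, rfl⟩ := h3
  have he : e ≠ 2 := by
    rintro rfl
    exact hq 2 Nat.prime_two ((by norm_num : 2 ∣ 3 * 2).trans hd) rfl
  obtain ⟨r, hr⟩ := hd
  have hmr : m = e * r := by
    apply Nat.eq_of_mul_eq_mul_left (show 0 < 3 by norm_num)
    rw [← hm, hr, mul_assoc]
  obtain ⟨H, hHM, hH⟩ := exists_addSubgroup_le_card M r ⟨e, by rw [hM, hmr, mul_comm]⟩
  obtain ⟨A, hA, hA3⟩ := exists_card_add_eq hHM hMi (by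
    rw [hH, hM, hmr]
    exact Nat.mul_le_mul_right _ (by omega))
  have hr' : Nat.card G / (3 * e) = r := by rw [hr, Nat.mul_div_cancel_left _ hd0]
  have hr0 : 0 < r := Nat.pos_of_ne_zero (by rintro rfl; omega)
  refine ⟨A, by omega, by omega, by omega⟩

/-- Write `d = 3 ^ a * m` with `m` prime to `3`. A subgroup `L` of index `m` still maps onto
`ZMod (3 ^ a)`; the preimage in `L` of an interval of `3 ^ (a - 1)` elements is completed to `G`. -/
theorem exists_card_eq_sub_two_mul_div (hq : ∀ q : ℕ, q.Prime → q ∣ Nat.card G → q % 3 ≠ 2)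
    {d : ℕ} (hd : d ∣ Nat.card G) (h1 : 1 ≤ padicValNat 3 d)
    (h2 : padicValNat 3 d ≤ padicValNat 3 (AddMonoid.exponent G)) :
    ∃ A : Finset G, 3 * A.card = Nat.card G ∧
      (A + A + A).card = Nat.card G - 2 * Nat.card G / d ∧ (A + A + A).card < Nat.card G := by
  have hn : 0 < Nat.card G := Nat.card_pos
  have hd0 : 0 < d := Nat.pos_of_dvd_of_pos hd hn
  set a := padicValNat 3 d with ha
  obtain ⟨m, hm⟩ : 3 ^ a ∣ d := pow_padicValNat_dvd
  have hm0 : 0 < m := Nat.pos_of_ne_zero (by rintro rfl; omega)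
  have h3m : ¬ 3 ∣ m := by
    rintro ⟨r, hr⟩
    have : 3 ^ (a + 1) ∣ d := ⟨r, by rw [hm, hr]; ring⟩
    exact pow_succ_padicValNat_not_dvd hd0.ne' this
  have hmn : m ∣ Nat.card G := (Dvd.intro_left _ hm.symm).trans hd
  have hdiv : ∀ e : ℕ, e ∣ m → e % 3 = 1 := by
    intro e he
    have h0 : ¬ 3 ∣ e := fun h => h3m (h.trans he)
    have h2 : e % 3 ≠ 2 := by
      intro h
      obtain ⟨q, hqp, hqe, hq3⟩ := exists_prime_mod_three_eq_two h
      exact hq q hqp ((hqe.trans he).trans hmn) hq3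
    omega
  obtain ⟨r, hr⟩ := hmn
  obtain ⟨L, hL⟩ := exists_addSubgroup_card (G := G) r ⟨m, by rw [hr, mul_comm]⟩
  have hLi : L.index = m := by
    have := L.card_mul_index
    rw [hL, hr, mul_comm] at this
    exact Nat.eq_of_mul_eq_mul_right (Nat.pos_of_ne_zero (by rintro rfl; omega)) this
  obtain ⟨f, hf⟩ := exists_surjective_zmod (G := G) Nat.prime_three (a := a)
    ((pow_dvd_pow 3 h2).trans pow_padicValNat_dvd)
  have : NeZero (3 ^ a) := ⟨by positivity⟩
  -- the index of the image of `L` divides both `m` and a power of `3`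
  have hfL : Function.Surjective (f.comp L.subtype) := by
    have hi1 : (L.map f).index ∣ m := hLi ▸ L.index_map_dvd hf
    have hi2 : (L.map f).index ∣ 3 ^ a := by
      have := (L.map f).index_dvd_card
      rwa [Nat.card_zmod] at this
    have hcop : Nat.Coprime m (3 ^ a) :=
      Nat.Coprime.pow_right _ ((Nat.prime_three.coprime_iff_not_dvd.2 h3m).symm)
    have hi : (L.map f).index = 1 := Nat.eq_one_of_dvd_coprimes hcop hi1 hi2
    intro z
    have hz : z ∈ L.map f := by rw [AddSubgroup.index_eq_one.1 hi]; trivial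
    obtain ⟨x, hx, rfl⟩ := AddSubgroup.mem_map.1 hz
    exact ⟨⟨x, hx⟩, rfl⟩
  obtain ⟨k, hk, hpre⟩ := exists_preimage _ hfL
  rw [Nat.card_zmod, hL] at hk
  obtain ⟨b, hb⟩ : ∃ b, a = b + 1 := ⟨a - 1, by omega⟩
  have h3b : 1 ≤ 3 ^ b := Nat.one_le_pow _ _ (by norm_num)
  have hpow : 3 ^ a = 3 * 3 ^ b := by rw [hb, pow_succ, mul_comm]
  obtain ⟨I, hI, hI3⟩ := exists_interval_zmod (3 ^ a) (3 ^ b) h3b (by omega)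
  obtain ⟨A', hA', hA3'⟩ := hpre I
  have hr0 : 0 < r := Nat.pos_of_ne_zero (by rintro rfl; omega)
  have hk0 : 0 < k := Nat.pos_of_ne_zero (by rintro rfl; omega)
  have hinj : Function.Injective L.subtype := L.subtype_injective
  obtain ⟨A, hA, hA3⟩ := exists_completion L (by rw [hLi]; exact hdiv) (A'.image L.subtype) (by
    intro x hx
    obtain ⟨y, -, rfl⟩ := mem_image.1 hx
    exact y.2) (by
    rw [image_nonempty, ← card_pos, hA', hI]
    positivity)
  rw [← image_add, ← image_add, card_image_of_injective _ hinj, hA3', hI3, hL] at hA3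
  rw [card_image_of_injective _ hinj, hA', hI, hL] at hA
  have hcn : Nat.card G = d * k := by rw [hr, hk, hm]; ring
  have hdk : 2 * Nat.card G / d = 2 * k := by
    rw [hcn, show 2 * (d * k) = d * (2 * k) by ring, Nat.mul_div_cancel_left _ hd0]
  have hrk : r = 3 * (k * 3 ^ b) := by rw [hk, hpow]; ring
  have hsub : k * (3 * 3 ^ b - 2) + 2 * k = r := by
    rw [hrk, mul_comm 2 k, ← mul_add, Nat.sub_add_cancel (by omega)]; ring
  refine ⟨A, by omega, by omega, by omega⟩

end DivisibleByThree

section DivisorsOne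

variable [Finite G] [DecidableEq G]

theorem card_add_three_or_one (hn : ∀ d : ℕ, d ∣ Nat.card G → d % 3 = 1) {A : Finset G}
    (hA : 3 * A.card + 1 = Nat.card G) (hne : A.Nonempty) (h3 : (A + A + A).card < Nat.card G) :
    (A + A + A).card + 3 = Nat.card G ∨ (A + A + A).card + 1 = Nat.card G := by
  classical
  have h3' := h3
  obtain ⟨H, B, hB, hAB, hA3, hper, hlt⟩ := exists_quotient hne (by convert h3')
  have hA3' : (A + A + A).card = Nat.card H * (B + B + B).card := by convert hA3
  have hcard := AddSubgroup.card_eq_card_quotient_mul_card_addSubgroup H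
  have hk := three_mul_card_le hB hper
  have hh : 0 < Nat.card H := Nat.card_pos
  have hd := hn _ ⟨_, hcard⟩
  have hkd : 3 * B.card + 1 ≤ Nat.card (G ⧸ H) := by omega
  have h1 : Nat.card H * (3 * B.card + 1) ≤ Nat.card G := by
    rw [hcard, mul_comm]; exact Nat.mul_le_mul_right _ hkd
  -- the extremal size leaves room only for the trivial subgroup
  have hH1 : Nat.card H = 1 := by
    have : Nat.card H * (3 * B.card + 1) = 3 * (Nat.card H * B.card) + Nat.card H := by ring
    omega
  rw [hH1, one_mul] at hA3' hAB
  rw [hH1, mul_one] at hcard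
  have hBc : 3 * B.card + 1 = Nat.card (G ⧸ H) := by omega
  have h2 := card_add_two_ne (by rw [← hcard]; exact hn) hBc hB hper
  omega

/-- The progression `0, g, …, (s - 1) g` in a cyclic subgroup of order `3 s + 1`, completed to `G`. -/
theorem exists_card_add_three [Nontrivial G] (hn : ∀ d : ℕ, d ∣ Nat.card G → d % 3 = 1) :
    ∃ A : Finset G, 3 * A.card + 1 = Nat.card G ∧ (A + A + A).card + 3 = Nat.card G := by
  obtain ⟨g, hg⟩ := exists_ne (0 : G)
  have hτ := hn _ (addOrderOf_dvd_natCard g)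
  have hτ1 : addOrderOf g ≠ 1 := fun h => hg (AddMonoid.addOrderOf_eq_one_iff.1 h)
  have hr := range_add_range_add_range (m := (addOrderOf g - 1) / 3) (by omega)
  obtain ⟨A₀, hL, hA₀, hA₀3⟩ := exists_image_multiples g (range ((addOrderOf g - 1) / 3))
    (range_subset_range.2 (by omega)) (by rw [hr]; exact range_subset_range.2 (by omega))
  rw [card_range] at hA₀
  rw [hr, card_range] at hA₀3
  obtain ⟨A, hA, hA3⟩ := exists_completion (AddSubgroup.zmultiples g)
    (fun d hd => hn d (hd.trans (AddSubgroup.index_dvd_card _))) A₀ hL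
    (card_pos.1 (by omega))
  rw [Nat.card_zmultiples] at hA hA3
  exact ⟨A, by omega, by omega⟩

/-- In a cyclic subgroup of order `3 j + 1 > 7`, the progression `0, g, …, j g` without `(j - 1) g`
has a threefold sumset missing one element of the subgroup; it is completed to `G`. -/
theorem exists_card_add_one (hn : ∀ d : ℕ, d ∣ Nat.card G → d % 3 = 1) {g : G} (hg : 7 • g ≠ 0) :
    ∃ A : Finset G, 3 * A.card + 1 = Nat.card G ∧ (A + A + A).card + 1 = Nat.card G := by
  have hdvd := addOrderOf_dvd_natCard g
  have hτ := hn _ hdvd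
  have hτ1 : addOrderOf g ≠ 1 := by
    intro h
    rw [AddMonoid.addOrderOf_eq_one_iff.1 h, smul_zero] at hg
    exact hg rfl
  have hτ4 : addOrderOf g ≠ 4 := by
    intro h
    rw [h] at hdvd
    exact absurd (hn 2 ((by norm_num : 2 ∣ 4).trans hdvd)) (by norm_num)
  have hτ7 : addOrderOf g ≠ 7 := fun h => hg (h ▸ addOrderOf_nsmul_eq_zero g)
  obtain ⟨j, hj⟩ : ∃ j, addOrderOf g = 3 * j + 1 := ⟨addOrderOf g / 3, by omega⟩
  have hr := insert_range_add (j := j) (by omega)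
  obtain ⟨A₀, hL, hA₀, hA₀3⟩ := exists_image_multiples g (insert j (range (j - 1)))
    (by
      rw [insert_subset_iff, mem_range, range_subset_range]
      omega)
    (by
      rw [hr, insert_subset_iff, mem_range, range_subset_range]
      omega)
  rw [card_insert_of_notMem (by simp), card_range] at hA₀
  rw [hr, card_insert_of_notMem (by simp), card_range] at hA₀3
  obtain ⟨A, hA, hA3⟩ := exists_completion (AddSubgroup.zmultiples g)
    (fun d hd => hn d (hd.trans (AddSubgroup.index_dvd_card _))) A₀ hL
    (card_pos.1 (by omega))
  rw [Nat.card_zmultiples] at hA hA3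
  exact ⟨A, by omega, by omega⟩

end DivisorsOne

end SumsetBasis

theorem theorem2 (G : Type*) [AddCommGroup G] [Fintype G] [DecidableEq G]
    (n : ℕ) (hcard : Fintype.card G = n) (hn : 2 ≤ n) :
    -- some prime divisor of `n` is `≡ 2 (mod 3)`, and `p` is the smallest one
    (∀ p : ℕ, p.Prime → p ∣ n → p % 3 = 2 →
      (∀ q : ℕ, q.Prime → q ∣ n → q % 3 = 2 → p ≤ q) →
        3 * p ∣ (p + 1) * n ∧
        IsGreatest (SumsetBasis.incompleteSizes G 3) ((p + 1) * n / (3 * p)) ∧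
        SumsetBasis.criticalNumber G 3 = (p + 1) * n / (3 * p) + 1 ∧
        SumsetBasis.S G 3 = {n - n / p}) ∧
    -- `3 ∣ n` and no prime divisor of `n` is `≡ 2 (mod 3)`
    (3 ∣ n → (∀ q : ℕ, q.Prime → q ∣ n → q % 3 ≠ 2) →
        IsGreatest (SumsetBasis.incompleteSizes G 3) (n / 3) ∧
        SumsetBasis.criticalNumber G 3 = n / 3 + 1 ∧
        SumsetBasis.S G 3 =
          {s : ℕ | ∃ d : ℕ, d ∣ n ∧ 3 ∣ d ∧ d ≠ 3 ∧ s = n - n / d} ∪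
          {s : ℕ | ∃ d : ℕ, d ∣ n ∧ 1 ≤ padicValNat 3 d ∧
            padicValNat 3 d ≤ padicValNat 3 (AddMonoid.exponent G) ∧ s = n - 2 * n / d}) ∧
    -- every divisor of `n` is `≡ 1 (mod 3)`
    ((∀ d : ℕ, d ∣ n → d % 3 = 1) →
        IsGreatest (SumsetBasis.incompleteSizes G 3) ((n - 1) / 3) ∧
        SumsetBasis.criticalNumber G 3 = (n - 1) / 3 + 1 ∧
        (SumsetBasis.IsElementaryAbelian 7 G → SumsetBasis.S G 3 = {n - 3}) ∧
        (¬ SumsetBasis.IsElementaryAbelian 7 G → SumsetBasis.S G 3 = {n - 3, n - 1})) := by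
  have hnG : Nat.card G = n := by rw [Nat.card_eq_fintype_card, hcard]
  have hnt : Nontrivial G := Fintype.one_lt_card_iff_nontrivial.1 (by omega)
  refine ⟨?_, ?_, ?_⟩
  · intro p hp hpn hp3 hmin
    rw [← hnG] at hpn hmin
    obtain ⟨A₀, hA₀, h₀⟩ := SumsetBasis.exists_card_mul_eq hp hpn hp3
    rw [hnG] at hA₀
    have hpos : 0 < 3 * p := by have := hp.pos; omega
    have hk : (p + 1) * n / (3 * p) = A₀.card := by rw [← hA₀, Nat.mul_div_cancel _ hpos]
    have hk0 : 0 < A₀.card := by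
      refine Nat.pos_of_ne_zero fun h => ?_
      rw [h, zero_mul] at hA₀
      have : 0 < (p + 1) * n := by positivity
      omega
    obtain ⟨h1, h2, h3⟩ := SumsetBasis.isGreatest_incompleteSizes hk0 (fun A hA hlt => by
      have := (SumsetBasis.card_mul_le_of_least_prime hp hmin hA hlt).1
      rw [hnG, ← hA₀] at this
      exact Nat.le_of_mul_le_mul_right this hpos) rfl h₀
    open scoped Pointwise in
    have hS : ∀ A : Finset G, A.card = A₀.card → (A + A + A).card < Nat.card G →
        (A + A + A).card = n - n / p := by
      intro A hA hlt
      have := (SumsetBasis.card_mul_le_of_least_prime hp hmin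
        (Finset.card_pos.1 (by omega)) hlt).2 (by rw [hA, hA₀, hnG])
      rwa [hnG] at this
    rw [hk]
    refine ⟨⟨_, by rw [← hA₀, mul_comm]⟩, h1, h2, ?_⟩
    rw [h3]
    ext s
    constructor
    · rintro ⟨A, hA, hlt, rfl⟩
      exact hS A hA hlt
    · rintro rfl
      exact ⟨A₀, rfl, h₀, hS A₀ rfl h₀⟩
  · intro h3n hq
    rw [← hnG] at h3n hq
    obtain ⟨A₀, hA₀, -, h₀⟩ := SumsetBasis.exists_card_eq_sub_two_mul_div hq h3n
      (by rw [padicValNat_self])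
      (by
        rw [padicValNat_self]
        exact one_le_padicValNat_of_dvd AddMonoid.exponent_ne_zero_of_finite
          (SumsetBasis.dvd_exponent_of_prime Nat.prime_three h3n))
    have hk : n / 3 = A₀.card := by omega
    obtain ⟨h1, h2, h3⟩ := SumsetBasis.isGreatest_incompleteSizes (k := A₀.card) (by omega)
      (fun A hA hlt => by
        have := (SumsetBasis.three_mul_card_le_card hq hA hlt).1
        omega) rfl h₀
    rw [hk]
    refine ⟨h1, h2, ?_⟩
    rw [h3, ← hnG]
    ext s
    constructor
    · rintro ⟨A, hA, hlt, rfl⟩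
      exact (SumsetBasis.three_mul_card_le_card hq (Finset.card_pos.1 (by omega)) hlt).2
        (by omega)
    · rintro (⟨d, hd, hd3, hne, rfl⟩ | ⟨d, hd, hd1, hd2, rfl⟩)
      · obtain ⟨A, hA, hA3, hlt⟩ := SumsetBasis.exists_card_eq_sub_div hq hd hd3 hne
        exact ⟨A, by omega, hlt, hA3⟩
      · obtain ⟨A, hA, hA3, hlt⟩ := SumsetBasis.exists_card_eq_sub_two_mul_div hq hd hd1 hd2
        exact ⟨A, by omega, hlt, hA3⟩
  · intro hdiv
    rw [← hnG] at hdiv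
    obtain ⟨A₀, hA₀, h₀⟩ := SumsetBasis.exists_card_add_three hdiv
    have hk : (n - 1) / 3 = A₀.card := by omega
    obtain ⟨h1, h2, h3⟩ := SumsetBasis.isGreatest_incompleteSizes (k := A₀.card) (by omega)
      (fun A hA hlt => by
        have := SumsetBasis.three_mul_card_add_one_le hdiv hA hlt
        omega) rfl (by omega)
    open scoped Pointwise in
    have hS : ∀ A : Finset G, A.card = A₀.card → (A + A + A).card < Nat.card G →
        (A + A + A).card + 3 = Nat.card G ∨ (A + A + A).card + 1 = Nat.card G := fun A hA hlt =>
      SumsetBasis.card_add_three_or_one hdiv (by omega) (Finset.card_pos.1 (by omega)) hlt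
    rw [hk, h3]
    refine ⟨h1, h2, ?_, ?_⟩
    · rintro ⟨-, h7⟩
      ext s
      constructor
      · rintro ⟨A, hA, hlt, rfl⟩
        have := SumsetBasis.card_add_one_ne h7 (A := A) (by omega)
        have := hS A hA hlt
        rw [Set.mem_singleton_iff]
        omega
      · rintro rfl
        exact ⟨A₀, rfl, by omega, by omega⟩
    · intro h7
      obtain ⟨g, hg⟩ : ∃ g : G, 7 • g ≠ 0 := by
        by_contra hcon
        push Not at hcon
        exact h7 ⟨hnt, hcon⟩
      ext s
      constructor
      · rintro ⟨A, hA, hlt, rfl⟩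
        have := hS A hA hlt
        rw [Set.mem_insert_iff, Set.mem_singleton_iff]
        omega
      · rintro (rfl | rfl)
        · exact ⟨A₀, rfl, by omega, by omega⟩
        · obtain ⟨A, hA, hA3⟩ := SumsetBasis.exists_card_add_one hdiv hg
          exact ⟨A, by omega, by omega, by omega⟩
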